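/- **Setting.** Let $G$ be a simply connected complex Lie group with simple Lie algebra $\mathfrak g$, $\mathfrak t\subseteq\mathfrak g$ a Cartan subalgebra, $\Phi$ its root system, $\Delta$ a base with positive roots $\Phi^+$, and $\Pi\subseteq\Delta$. Put $\Xi_0=\mathrm{span}_{\mathbb R}(\Pi)\cap\Phi$, $\Xi_+=\Phi^+\setminus\Xi_0$, $\mathfrak l=\mathfrak t\oplus\bigoplus_{\alpha\in\Xi_0}\mathfrak g_\alpha$, $\mathfrak n^\pm=\bigoplus_{\alpha\in\Xi_+}\mathfrak g_{\pm\alpha}$, $\mathfrak p=\mathfrak l\oplus\mathfrak n^+$, and let $P\subseteq G$ be the parabolic subgroup with Lie algebra $\mathfrak p$, $X=G/P$. Let $B$ be the Killing form, and for $\alpha\in\Phi$ let $H_\alpha\in\mathfrak t$ be given by $\alpha(H)=B(H,H_\alpha)$ for all $H\in\mathfrak t$. Choose root vectors $x_\alpha\in\mathfrak g_\alpha$ $(\alpha\in\Phi)$ with $[x_\alpha,x_{-\alpha}]=H_\alpha$ and $[x_\alpha,x_\beta]=N_{\alpha,\beta}x_{\alpha+\beta}$ whenever $\alpha,\beta,\alpha+\beta\in\Phi$,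 where the $N_{\alpha,\beta}$ are real and $N_{-\alpha,-\beta}=-N_{\alpha,\beta}$; put $y_\alpha=x_{-\alpha}$. Let $\theta$ be the conjugate linear involution of $\mathfrak g$ with $\theta H_\alpha=-H_\alpha$ and $\theta x_\alpha=-y_\alpha$, $\mathfrak u=\mathfrak g^\theta$, and let $U\subseteq G$ be the connected subgroup with Lie algebra $\mathfrak u$. Fix $C_o\in\mathfrak t$ with $\alpha(C_o)=0$ for $\alpha\in\Pi$ and $\alpha(C_o)>0$ for $\alpha\in\Delta\setminus\Pi$, and the $U$-invariant Kähler metric $h$ on $X$ that is given at the base point by the pairing $h_o(x,y)=B(C_o,[x,y])$ of $T^{0,1}_o\cong\mathfrak n^+$ with $T^{1,0}_o\cong\mathfrak n^-\cong\mathfrak g/\mathfrak p$. Put $c_\lambda=\lambda(C_o)$ for $\lambda\in\mathfrak t^*$. For a finite dimensional holomorphic $P$-module $W$, smooth sections of $G\times^PW$ are smooth maps $F:G\to W$ with $F(gp)=p^{-1}.F(g)$; in the compact picture such a section is represented by the restriction $f=F|_U$. The Cauchy–Riemann operator $\bar D$ of $G\times^PW$ is the $\bar\partial$-operator followed by the isomorphism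 $(T^{0,1})^*\cong T^{1,0}$ induced by $h$, and $\bar D^m$ is its $m$-fold iterate, so that for $E=G\times^PE_o$ the section $\bar D^mf$ of $E\otimes(T^{1,0})^{\otimes m}$ has in the compact picture values in $E_o\otimes(\mathfrak n^-)^{\otimes m}$. For $v\in\mathfrak u$ let $\mathcal R_vf(u)=\frac{d}{dt}f(ue^{tv})|_{t=0}$, and for $x=v_1+iv_2\in\mathfrak g$ with $v_1,v_2\in\mathfrak u$ let $\mathcal R^{\mathbb C}_xf=\mathcal R_{v_1}f+i\,\mathcal R_{v_2}f$; put $\mathcal R_\alpha=\mathcal R^{\mathbb C}_{x_\alpha}$ for $\alpha\in\Xi_+$. For $\boldsymbol\beta=(\beta_1,\dots,\beta_m)\in\Xi_+^m$ put $$y_{\boldsymbol\beta}=y_{\beta_1}\otimes\cdots\otimes y_{\beta_m},\qquad c_{\boldsymbol\beta}=c_{\beta_1}\,c_{\beta_1+\beta_2}\cdots c_{\beta_1+\cdots+\beta_m},\qquad \mathcal R_{\boldsymbol\beta}=\mathcal R_{\beta_m}\mathcal R_{\beta_{m-1}}\cdots\mathcal R_{\beta_1}.$$ **Proposition.** Let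 $E_o$ be a (finite dimensional, holomorphic) simple $P$-module, $E=G\times^PE_o$, and $m\in\mathbb N$. In the compact picture, for every smooth section $f$ of $E$ and all $u\in U$, $$(\bar D^mf)(u)=\sum_{\boldsymbol\alpha\in\Xi_+^m}(\bar D_{\boldsymbol\alpha}f)(u)\otimes y_{\boldsymbol\alpha}\quad\text{with}\quad(\bar D_{\boldsymbol\alpha}f)(u)=\sum_{\sigma\in\mathfrak S_m}c_{\sigma(\boldsymbol\alpha)}^{-1}\,\mathcal R_{\sigma(\boldsymbol\alpha)}f(u),$$ where $\sigma(\boldsymbol\alpha)=(\alpha_{\sigma(1)},\dots,\alpha_{\sigma(m)})$. -/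

import Mathlib

open scoped Manifold ContDiff TensorProduct

namespace FlagCR

noncomputable section

/-! ### Root data, parabolic subalgebras and compact real forms -/

section Algebra

variable {L : Type*} [LieRing L] [LieAlgebra ℂ L] [FiniteDimensional ℂ L]
  [LieAlgebra.IsKilling ℂ L]

variable (L) in
/-- A Cartan subalgebra `𝔱` of `L`, a base `Δ` of its root system, and a subset `Π` of `Δ`. This
determines a Borel subalgebra and a standard parabolic subalgebra containing it. -/
structure ParabolicData where
  /-- The Cartan subalgebra `𝔱`. -/
  t : LieSubalgebra ℂ L
  cartan : t.IsCartanSubalgebra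
  /-- The base `Δ` of the root system. -/
  base : (LieAlgebra.IsKilling.rootSystem t).Base
  /-- The subset `Π`, as a set of linear forms on `𝔱`. -/
  simpleLevi : Set (Module.Dual ℂ t)
  simpleLevi_subset : simpleLevi ⊆ (LieAlgebra.IsKilling.rootSystem t).root '' base.support

attribute [instance] ParabolicData.cartan

namespace ParabolicData

variable (D : ParabolicData L)

/-- The set of roots `Φ`, as linear forms on `𝔱`. -/
def roots : Set (Module.Dual ℂ D.t) := Set.range (LieAlgebra.IsKilling.rootSystem D.t).root

/-- The set of simple roots `Δ`. -/
def simpleRoots : Set (Module.Dual ℂ D.t) :=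
  (LieAlgebra.IsKilling.rootSystem D.t).root '' D.base.support

/-- The set of positive roots `Φ⁺`. -/
def posRoots : Set (Module.Dual ℂ D.t) :=
  {α | α ∈ D.roots ∧ α ∈ AddSubmonoid.closure D.simpleRoots}

/-- `Ξ₀ = span_ℝ(Π) ∩ Φ`. -/
def XiZero : Set (Module.Dual ℂ D.t) :=
  {α | α ∈ D.roots ∧ α ∈ Submodule.span ℝ D.simpleLevi}

/-- `Ξ₊ = Φ⁺ \ Ξ₀`. -/
def XiPos : Set (Module.Dual ℂ D.t) := D.posRoots \ D.XiZero

theorem finite_XiPos : Finite D.XiPos :=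
  (((Set.finite_range (LieAlgebra.IsKilling.rootSystem D.t).root).subset
    (fun _ h => h.1 : D.posRoots ⊆ D.roots)).subset Set.sdiff_subset).to_subtype

instance : Fintype D.XiPos :=
  haveI := D.finite_XiPos
  Fintype.ofFinite _

/-- The root space `𝔤_α`, as a linear subspace. -/
def rootSubspace (α : Module.Dual ℂ D.t) : Submodule ℂ L :=
  (LieAlgebra.rootSpace D.t α).toSubmodule

/-- `𝔩 = 𝔱 ⊕ ⨁_{α ∈ Ξ₀} 𝔤_α`. -/
def levi : Submodule ℂ L := D.t.toSubmodule ⊔ ⨆ α ∈ D.XiZero, D.rootSubspace α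

/-- `𝔫⁺ = ⨁_{α ∈ Ξ₊} 𝔤_α`. -/
def nPos : Submodule ℂ L := ⨆ α ∈ D.XiPos, D.rootSubspace α

/-- `𝔫⁻ = ⨁_{α ∈ Ξ₋} 𝔤_α`, where `Ξ₋ = -Ξ₊`. -/
def nNeg : Submodule ℂ L := ⨆ α ∈ D.XiPos, D.rootSubspace (-α)

/-- The parabolic subalgebra `𝔭 = 𝔩 ⊕ 𝔫⁺`. -/
def parabolic : Submodule ℂ L := D.levi ⊔ D.nPos

/-- The element `H_α` of `𝔱` with `α(H) = B(H, H_α)` for all `H ∈ 𝔱`, `B` the Killing form. -/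
def Hvec (α : Module.Dual ℂ D.t) : L :=
  ((LieAlgebra.IsKilling.cartanEquivDual D.t).symm α : D.t)

/-- The cone `𝔷(𝔩)⁺` of elements of `𝔱` on which the roots in `Π` vanish and the other simple
roots take real positive values. It parametrizes the invariant Kähler metrics. -/
def kahlerCone : Set D.t :=
  {C | (∀ α ∈ D.simpleLevi, α C = 0) ∧
    ∀ α ∈ D.simpleRoots \ D.simpleLevi, (α C).im = 0 ∧ 0 < (α C).re}

/-- A normalized system of root vectors `x_α`, `α ∈ Φ`: `[x_α, x_{-α}] = H_α`, and the structure
constants `N_{α,β}` in `[x_α, x_β] = N_{α,β} x_{α+β}` are real with `N_{-α,-β} = -N_{α,β}`.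
The values of `x` off the roots are irrelevant. -/
structure RootVectors where
  x : Module.Dual ℂ D.t → L
  mem : ∀ α ∈ D.roots, x α ∈ D.rootSubspace α
  lie_neg : ∀ α ∈ D.roots, ⁅x α, x (-α)⁆ = D.Hvec α
  lie_add : ∀ α ∈ D.roots, ∀ β ∈ D.roots, α + β ∈ D.roots →
    ∃ N : ℝ, ⁅x α, x β⁆ = (N : ℂ) • x (α + β) ∧ ⁅x (-α), x (-β)⁆ = (-N : ℂ) • x (-(α + β))

variable {D} (X : D.RootVectors)

/-- `y_α = x_{-α}`. -/
def RootVectors.y (α : Module.Dual ℂ D.t) : L := X.x (-α)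

/-- The conjugate linear map `θ` determined by `θ H_α = -H_α` and `θ x_α = -y_α` for all roots
`α`; it exists and is unique, because `𝔱` is the complexification of the real span of the
`H_α`. -/
def RootVectors.θ : L →ₛₗ[starRingEnd ℂ] L :=
  Classical.epsilon fun θ =>
    ∀ α ∈ D.roots, θ (D.Hvec α) = -D.Hvec α ∧ θ (X.x α) = -X.y α

/-- The compact real form `𝔲 = 𝔤^θ`. -/
def RootVectors.compactForm : Submodule ℝ L where
  carrier := {v | X.θ v = v}
  add_mem' {v w} hv hw := by
    simp only [Set.mem_ofPred_eq] at hv hw ⊢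
    rw [map_add, hv, hw]
  zero_mem' := map_zero _
  smul_mem' r v hv := by
    simp only [Set.mem_ofPred_eq] at hv ⊢
    rw [← Complex.coe_smul, map_smulₛₗ, hv, Complex.conj_ofReal]

/-- The bilinear form `h_o(x, y) = B(C, [x, y])` as a linear form in `y ∈ 𝔫⁻`, for fixed `x`. -/
def metricForm (D : ParabolicData L) (C : D.t) (x : L) : D.nNeg →ₗ[ℂ] ℂ :=
  (killingForm ℂ L (C : L)) ∘ₗ (LieAlgebra.ad ℂ L x : L →ₗ[ℂ] L) ∘ₗ D.nNeg.subtype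

/-- `c_λ = λ(C)` for `λ ∈ 𝔱^*`. -/
def cval (C : D.t) (lam : Module.Dual ℂ D.t) : ℂ := lam C

/-- `c_β = c_{β₁} c_{β₁+β₂} ⋯ c_{β₁+⋯+β_m}` for a tuple `β ∈ Ξ₊^m`. -/
def ctuple (C : D.t) {m : ℕ} (β : Fin m → D.XiPos) : ℂ :=
  ∏ k : Fin m, cval C (∑ j ∈ Finset.Iic k, (β j : Module.Dual ℂ D.t))

end ParabolicData

end Algebra

/-! ### Calculus of vector valued functions

Finite dimensional complex vector spaces carry no chosen norm; smoothness and derivatives of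
functions with values in them are meant componentwise. -/

section Calculus

variable {W : Type*} [AddCommGroup W] [Module ℂ W] [FiniteDimensional ℂ W]

/-- The derivative at `t = 0` of a curve in `W`, in the components of a basis. -/
def curveDeriv (c : ℝ → W) : W :=
  ∑ i, deriv (fun t => (Module.finBasis ℂ W).repr (c t) i) 0 • Module.finBasis ℂ W i

end Calculus

/-! ### Lie groups -/

section Group

variable {E : Type*} [NormedAddCommGroup E] [NormedSpace ℂ E] [FiniteDimensional ℂ E]
  [CompleteSpace E]
  {G : Type*} [TopologicalSpace G] [ChartedSpace E G] [Group G] [LieGroup 𝓘(ℂ, E) ω G]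

instance : FiniteDimensional ℂ (GroupLieAlgebra 𝓘(ℂ, E) G) :=
  inferInstanceAs (FiniteDimensional ℂ E)

/-- `γ` is the one-parameter subgroup of `G` with initial velocity `v`. -/
def IsOneParameterSubgroup (γ : ℝ → G) (v : GroupLieAlgebra 𝓘(ℂ, E) G) : Prop :=
  (∀ s t, γ (s + t) = γ s * γ t) ∧
    HasMFDerivAt 𝓘(ℝ, ℝ) 𝓘(ℝ, E) γ 0 (ContinuousLinearMap.toSpanSingleton ℝ (show E from v))

open Classical in
/-- The exponential map: the value at `1` of the one-parameter subgroup with initial velocity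
`v`, which exists and is unique. -/
def lieExp (v : GroupLieAlgebra 𝓘(ℂ, E) G) : G :=
  if h : ∃ γ : ℝ → G, IsOneParameterSubgroup γ v then h.choose 1 else 1

/-- The subgroup generated by `exp S`; if `S` is a real Lie subalgebra, this is the connected
Lie subgroup with Lie algebra `S`. -/
def analyticSubgroup (S : Set (GroupLieAlgebra 𝓘(ℂ, E) G)) : Subgroup G :=
  Subgroup.closure (lieExp '' S)

theorem lieExp_mem {S : Set (GroupLieAlgebra 𝓘(ℂ, E) G)} {v : GroupLieAlgebra 𝓘(ℂ, E) G}
    (hv : v ∈ S) : lieExp v ∈ analyticSubgroup S :=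
  Subgroup.subset_closure ⟨v, hv, rfl⟩

/-- The derivative at the identity of the conjugation `h ↦ g h g⁻¹`. -/
def AdMap (g : G) : GroupLieAlgebra 𝓘(ℂ, E) G →ₗ[ℂ] GroupLieAlgebra 𝓘(ℂ, E) G :=
  ((show E →L[ℂ] E from mfderiv 𝓘(ℂ, E) 𝓘(ℂ, E) (fun h : G => g * h * g⁻¹) 1) : E →ₗ[ℂ] E)

theorem contMDiff_conj (g : G) :
    ContMDiff 𝓘(ℂ, E) 𝓘(ℂ, E) ω (fun h : G => g * h * g⁻¹) :=
  (contMDiff_mul_right (a := g⁻¹)).comp (contMDiff_mul_left (a := g))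

theorem AdMap_one : AdMap (E := E) (1 : G) = 1 := by
  have h : (fun h : G => (1 : G) * h * (1 : G)⁻¹) = id := by ext; simp
  ext v
  change (mfderiv 𝓘(ℂ, E) 𝓘(ℂ, E) (fun h : G => (1 : G) * h * (1 : G)⁻¹) 1 : E → E) v = v
  rw [h]
  exact congrArg (fun A : E →L[ℂ] E => A v) (mfderiv_id (I := 𝓘(ℂ, E)) (x := (1 : G)))

theorem AdMap_mul (a b : G) : AdMap (E := E) (a * b) = AdMap a * AdMap b := by
  have h : (fun h : G => (a * b) * h * (a * b)⁻¹)
      = (fun h : G => a * h * a⁻¹) ∘ (fun h : G => b * h * b⁻¹) := by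
    ext; simp [mul_assoc]
  have ha : MDifferentiable 𝓘(ℂ, E) 𝓘(ℂ, E) (fun h : G => a * h * a⁻¹) :=
    (contMDiff_conj a).mdifferentiable (by simp)
  have hb : MDifferentiable 𝓘(ℂ, E) 𝓘(ℂ, E) (fun h : G => b * h * b⁻¹) :=
    (contMDiff_conj b).mdifferentiable (by simp)
  have h1 : b * 1 * b⁻¹ = 1 := by simp
  ext v
  change (mfderiv 𝓘(ℂ, E) 𝓘(ℂ, E) (fun h : G => (a * b) * h * (a * b)⁻¹) 1 : E → E) v
    = (mfderiv 𝓘(ℂ, E) 𝓘(ℂ, E) (fun h : G => a * h * a⁻¹) 1 : E → E)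
      ((mfderiv 𝓘(ℂ, E) 𝓘(ℂ, E) (fun h : G => b * h * b⁻¹) 1 : E → E) v)
  rw [h, mfderiv_comp (I' := 𝓘(ℂ, E)) (1 : G) (ha _) (hb _)]
  change (mfderiv 𝓘(ℂ, E) 𝓘(ℂ, E) (fun h : G => a * h * a⁻¹) (b * 1 * b⁻¹) : E → E) _ = _
  rw [h1]
  rfl

variable (E G) in
/-- The adjoint representation of `G` on its Lie algebra. -/
def Ad : Representation ℂ G (GroupLieAlgebra 𝓘(ℂ, E) G) where
  toFun := AdMap
  map_one' := AdMap_one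
  map_mul' := AdMap_mul

/-- The stabilizer of a linear subspace of the Lie algebra under the adjoint representation. -/
def adStabilizer (S : Submodule ℂ (GroupLieAlgebra 𝓘(ℂ, E) G)) : Subgroup G where
  carrier := {g | S.map (Ad E G g) = S}
  one_mem' := by
    change S.map (Ad E G 1) = S
    rw [map_one]; exact Submodule.map_id S
  mul_mem' {a b} ha hb := by
    change S.map (Ad E G (a * b)) = S
    have ha' : S.map (Ad E G a) = S := ha
    have hb' : S.map (Ad E G b) = S := hb
    rw [map_mul, Module.End.mul_eq_comp, Submodule.map_comp, hb', ha']
  inv_mem' {a} ha := by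
    change S.map (Ad E G a⁻¹) = S
    have ha' : S.map (Ad E G a) = S := ha
    conv_lhs => rw [← ha']
    rw [← Submodule.map_comp, ← Module.End.mul_eq_comp, ← map_mul, inv_mul_cancel, map_one]
    exact Submodule.map_id S

variable [LieAlgebra.IsKilling ℂ (GroupLieAlgebra 𝓘(ℂ, E) G)]
  {D : ParabolicData (GroupLieAlgebra 𝓘(ℂ, E) G)}

/-- The parabolic subgroup `P` with Lie algebra `𝔭`. The connected subgroup with Lie algebra `𝔭`
and the stabilizer of `𝔭` in `G` are the same subgroup; membership in both is recorded. -/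
def parabolicSubgroup (D : ParabolicData (GroupLieAlgebra 𝓘(ℂ, E) G)) : Subgroup G :=
  analyticSubgroup (D.parabolic : Set (GroupLieAlgebra 𝓘(ℂ, E) G)) ⊓ adStabilizer D.parabolic

/-- The connected subgroup `U` with Lie algebra `𝔲`. -/
def compactSubgroup (X : D.RootVectors) : Subgroup G :=
  analyticSubgroup (X.compactForm : Set (GroupLieAlgebra 𝓘(ℂ, E) G))

/-- The fiber `𝔤/𝔭` of the holomorphic tangent bundle at the base point. -/
abbrev TangentFiber (D : ParabolicData (GroupLieAlgebra 𝓘(ℂ, E) G)) :=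
  GroupLieAlgebra 𝓘(ℂ, E) G ⧸ D.parabolic

variable (D) in
/-- The action of `P` on `𝔤/𝔭` induced by the adjoint representation. -/
def tangentRep : Representation ℂ (parabolicSubgroup D) (TangentFiber D) :=
  Representation.quotient ((Ad E G).comp (parabolicSubgroup D).subtype) D.parabolic
    (fun p => Submodule.map_le_iff_le_comap.mp p.2.2.le)

variable (D) in
/-- The action of `P` on `(𝔤/𝔭)^{⊗m}`. -/
def tangentPowRep (m : ℕ) :
    Representation ℂ (parabolicSubgroup D) (⨂[ℂ]^m (TangentFiber D)) where
  toFun p := PiTensorProduct.map fun _ => tangentRep D p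
  map_one' := by
    simp only [map_one]
    exact PiTensorProduct.map_one
  map_mul' p q := by
    simp only [map_mul]
    exact PiTensorProduct.map_mul _ _

/-! ### Sections of homogeneous bundles -/

section Sections

variable {W : Type*} [AddCommGroup W] [Module ℂ W] [FiniteDimensional ℂ W]

/-- A representation of `P` is holomorphic: its matrix coefficients are locally restrictions to
`P` of holomorphic functions on open subsets of `G`. -/
def IsHolomorphicRep (ρ : Representation ℂ (parabolicSubgroup D) W) : Prop :=
  ∀ (w : W) (l : Module.Dual ℂ W) (p : parabolicSubgroup D), ∃ O : Set G, IsOpen O ∧ (p : G) ∈ O ∧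
    ∃ φ : G → ℂ, MDifferentiableOn 𝓘(ℂ, E) 𝓘(ℂ, ℂ) φ O ∧
      ∀ q : parabolicSubgroup D, (q : G) ∈ O → l (ρ q w) = φ q

/-- The smooth sections of `G ×^P W` over `G/P`: smooth maps `F : G → W` with
`F(gp) = p⁻¹.F(g)`. -/
structure IsSmoothSection (ρ : Representation ℂ (parabolicSubgroup D) W) (F : G → W) : Prop where
  smooth : ∀ l : Module.Dual ℂ W, ContMDiff 𝓘(ℝ, E) 𝓘(ℝ, ℂ) ∞ (fun g => l (F g))
  equivariant : ∀ (g : G) (p : parabolicSubgroup D), F (g * p) = ρ p⁻¹ (F g)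

/-- The derivative of `F : G → W` at `g` in the direction of the left invariant vector field
given by `v`. -/
def leftInvDeriv (v : GroupLieAlgebra 𝓘(ℂ, E) G) (F : G → W) (g : G) : W :=
  curveDeriv fun t : ℝ => F (g * lieExp ((t : ℂ) • v))

/-- The `∂̄`-operator. The pull-back of `G ×^P W` to `G` is the trivial holomorphic bundle with
fiber `W`, and the pull-back of `∂̄F` to `G` is the conjugate linear part
`½ (dF(v) + i dF(iv))` of the differential of `F`. -/
def dbar (F : G → W) (g : G) (v : GroupLieAlgebra 𝓘(ℂ, E) G) : W :=
  (1 / 2 : ℂ) • (leftInvDeriv v F g + Complex.I • leftInvDeriv (Complex.I • v) F g)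

/-- The value at `uP`, `u ∈ U`, of the image of `∂̄F` under the isomorphism
`(T^{0,1})^* ≅ T^{1,0}` given by the metric: the element `τ ∈ W ⊗ 𝔫⁻` with
`(id ⊗ h_o(x, ·)) τ = ∂̄F(u)(θ x)` for `x ∈ 𝔫⁺`. Here `T^{0,1}` has fiber `𝔫⁺ ≅ 𝔤/θ𝔭` and
`x ∈ 𝔫⁺` is the antiholomorphic tangent vector conjugate to the class of `θ x` in `𝔤/𝔭`, so that
the conjugate linear form `∂̄F(u)` on `𝔤/𝔭` is the linear form `x ↦ ∂̄F(u)(θ x)` on `𝔫⁺`. -/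
def crValue (X : D.RootVectors) (C : D.t) (F : G → W) (u : G) : W ⊗[ℂ] D.nNeg :=
  Classical.epsilon fun τ =>
    ∀ x ∈ D.nPos,
      TensorProduct.rid ℂ W (LinearMap.lTensor W (D.metricForm C x) τ) = dbar F u (X.θ x)

/-- The isomorphism `𝔫⁻ ≅ 𝔤/𝔭`, as a map. -/
def nNegToFiber (D : ParabolicData (GroupLieAlgebra 𝓘(ℂ, E) G)) :
    D.nNeg →ₗ[ℂ] TangentFiber D :=
  D.parabolic.mkQ ∘ₗ D.nNeg.subtype

open Classical in
/-- The Cauchy-Riemann operator `D̄` from sections of `G ×^P W` to sections of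
`G ×^P (W ⊗ 𝔤/𝔭)`. On `U` it is given by `crValue`, and it extends from `U` to `G = UP` by
`P`-equivariance (which expresses that the metric is `U`-invariant). -/
def cauchyRiemann (X : D.RootVectors) (C : D.t) (ρ : Representation ℂ (parabolicSubgroup D) W)
    (F : G → W) (g : G) : W ⊗[ℂ] TangentFiber D :=
  if h : ∃ (u : compactSubgroup X) (p : parabolicSubgroup D), g = u * p then
    (ρ.tprod (tangentRep D)) h.choose_spec.choose⁻¹
      (LinearMap.lTensor W (nNegToFiber D) (crValue X C F h.choose))
  else 0

end Sections

section Iterates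

variable {V : Type*} [AddCommGroup V] [Module ℂ V] [FiniteDimensional ℂ V]

variable (V) in
/-- The isomorphism `(V ⊗ T^{⊗m}) ⊗ T ≅ V ⊗ T^{⊗(m+1)}`, the new factor being the last one. -/
def appendFactor (T : Type*) [AddCommGroup T] [Module ℂ T] (m : ℕ) :
    (V ⊗[ℂ] ⨂[ℂ]^m T) ⊗[ℂ] T ≃ₗ[ℂ] V ⊗[ℂ] ⨂[ℂ]^(m + 1) T :=
  (TensorProduct.assoc ℂ V (⨂[ℂ]^m T) T).trans <|
    TensorProduct.congr (LinearEquiv.refl ℂ V) <|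
      (TensorProduct.congr (LinearEquiv.refl ℂ (⨂[ℂ]^m T))
        (PiTensorProduct.subsingletonEquiv (R := ℂ) (s := fun _ : Fin 1 => T) 0).symm).trans
        TensorPower.mulEquiv

theorem appendFactor_tmul (T : Type*) [AddCommGroup T] [Module ℂ T] (m : ℕ) (v : V)
    (a : Fin m → T) (b : T) :
    appendFactor V T m ((v ⊗ₜ PiTensorProduct.tprod ℂ a) ⊗ₜ b)
      = v ⊗ₜ PiTensorProduct.tprod ℂ (Fin.snoc a b) := by
  have h : (PiTensorProduct.subsingletonEquiv (R := ℂ) (s := fun _ : Fin 1 => T) 0).symm b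
      = PiTensorProduct.tprod ℂ (fun _ => b) := by
    rw [LinearEquiv.symm_apply_eq]; simp
  simp only [appendFactor, LinearEquiv.trans_apply, TensorProduct.assoc_tmul,
    TensorProduct.congr_tmul, LinearEquiv.refl_apply, h]
  rw [← TensorPower.gMul_def, TensorPower.tprod_mul_tprod, Fin.append_right_eq_snoc]

/-- The iterated Cauchy-Riemann operator `D̄^m`, from sections of `G ×^P V` to sections of
`G ×^P (V ⊗ (𝔤/𝔭)^{⊗m})`. -/
def iteratedCR (X : D.RootVectors) (C : D.t) (ρ : Representation ℂ (parabolicSubgroup D) V)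
    (F : G → V) : (m : ℕ) → G → V ⊗[ℂ] ⨂[ℂ]^m (TangentFiber D)
  | 0 => fun g => F g ⊗ₜ PiTensorProduct.tprod ℂ Fin.elim0
  | m + 1 => fun g => appendFactor V (TangentFiber D) m
      (cauchyRiemann X C (ρ.tprod (tangentPowRep D m)) (iteratedCR X C ρ F m) g)

/-! ### The compact picture -/

/-- The right derivative `R_v f` of `f : U → V` along `v ∈ 𝔲`. -/
def rightDeriv (X : D.RootVectors) (v : X.compactForm) (f : compactSubgroup (E := E) X → V) :
    compactSubgroup (E := E) X → V :=
  fun u => curveDeriv fun t : ℝ =>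
    f (u * ⟨lieExp ((t • v : X.compactForm) : GroupLieAlgebra 𝓘(ℂ, E) G),
      lieExp_mem (t • v : X.compactForm).2⟩)

open Classical in
/-- The complexified right derivative `R_{v₁} f + i R_{v₂} f` along `x = v₁ + i v₂`, with
`v₁, v₂ ∈ 𝔲`. (Every `x` has exactly one such decomposition.) -/
def rightDerivC (X : D.RootVectors) (x : GroupLieAlgebra 𝓘(ℂ, E) G)
    (f : compactSubgroup (E := E) X → V) : compactSubgroup (E := E) X → V :=
  if h : ∃ v : X.compactForm × X.compactForm,
      x = (v.1 : GroupLieAlgebra 𝓘(ℂ, E) G) + Complex.I • (v.2 : GroupLieAlgebra 𝓘(ℂ, E) G) then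
    fun u => rightDeriv X h.choose.1 f u + Complex.I • rightDeriv X h.choose.2 f u
  else 0

/-- `R_β = R_{β_m} ⋯ R_{β_1}` for a tuple `β ∈ Ξ₊^m`, where `R_α` is the complexified right
derivative along `x_α`; `R_{β_1}` is applied first. -/
def rightDerivTuple (X : D.RootVectors) {m : ℕ} (β : Fin m → D.XiPos)
    (f : compactSubgroup (E := E) X → V) : compactSubgroup (E := E) X → V :=
  (List.ofFn β).foldl (fun h α => rightDerivC X (X.x α) h) f

/-- `y_α = y_{α₁} ⊗ ⋯ ⊗ y_{α_m}`, as an element of `(𝔤/𝔭)^{⊗m} ≅ (𝔫⁻)^{⊗m}`. -/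
def ytuple (X : D.RootVectors) {m : ℕ} (α : Fin m → D.XiPos) : ⨂[ℂ]^m (TangentFiber D) :=
  PiTensorProduct.tprod ℂ fun i => D.parabolic.mkQ (X.y (α i))

end Iterates

end Group

end

end FlagCR

/-! The proof is an induction on m with an analytic and an algebraic half.

Analytic half. Let F be a P-equivariant W-valued function on G that agrees on U with a smooth
function Φ, and let δ be the derivative of the P-action on W. For x = v + iw in 𝔭 with v, w ∈ 𝔲 one
has θx = 2v − x and iθx = 2w + ix. Differentiating along 𝔲 through Φ and along 𝔭 through
equivariance gives (∂̄F)(u)(θx) = R_x Φ(u) + δ(x)F(u), see `IsCompactlySmooth.dbar_eq`. The metric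
is diagonal in the vectors x_α, y_α with entries c_α, so D̄F(u) = Σ_α c_α⁻¹ (R_α Φ(u) + δ(x_α)F(u))
⊗ y_α, see `IsCompactlySmooth.cauchyRiemann_apply`.

In the induction step W = E_o ⊗ (𝔤/𝔭)^{⊗m}. The nilradical 𝔫⁺ kills the simple module E_o
(`RepDeriv.eq_zero_of_isIrreducible`), and modulo 𝔭 the bracket [x_γ, y_β] is N_{β−γ,γ} y_{β−γ} if β
− γ ∈ Ξ₊ and 0 otherwise (`mkQ_lie_x_y`). Comparing coefficients gives the recursion D̄_{(α,γ)} =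
c_γ⁻¹ (R_γ D̄_α + Σ_i N_{α_i,γ} D̄_{α(i)}), where α(i) is α with α_i replaced by α_i + γ.

Algebraic half. The symmetrized sum satisfies the same recursion (`symProd_snoc`). A permutation of
(α,γ) is a permutation of α with γ inserted somewhere, and the sum over the insertion places is
computed in `sum_insertNth` by induction on the length, from the commutation relations of the R_α
and the partial fractions 1/(a(a+b)) + 1/(b(a+b)) = 1/(ab).

U and P are abstract subgroups generated by exponentials, without a manifold structure of their own.
What is needed of Lie theory is therefore derived on G: commutators of left invariant derivatives
(`LD_bracket`), the derivative of Ad (`LD_adc_one`), and the splitting of a curve into curves in U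
and P (`exists_factorization`). That D̄F does not depend on the factorization g = up rests on Ad(U ∩
P) fixing C (`AdMap_C`). The equality G = UP is never used, because D̄F is 0 off UP by definition.
-/

set_option linter.unusedSectionVars false

/-! ### Complex manifolds as real manifolds. -/

section RestrictScalars

variable {E₁ E₂ M N : Type*} [NormedAddCommGroup E₁] [NormedSpace ℂ E₁]
  [NormedAddCommGroup E₂] [NormedSpace ℂ E₂] [TopologicalSpace M] [ChartedSpace E₁ M]
  [TopologicalSpace N] [ChartedSpace E₂ N] {f : M → N} {x : M}

theorem HasMFDerivAt.restrictScalarsReal {f' : E₁ →L[ℂ] E₂}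
    (h : HasMFDerivAt 𝓘(ℂ, E₁) 𝓘(ℂ, E₂) f x f') :
    HasMFDerivAt 𝓘(ℝ, E₁) 𝓘(ℝ, E₂) f x (f'.restrictScalars ℝ) :=
  ⟨h.1, h.2.restrictScalars ℝ⟩

theorem ContMDiffAt.restrictScalarsReal {n : ℕ∞ω} (h : ContMDiffAt 𝓘(ℂ, E₁) 𝓘(ℂ, E₂) n f x) :
    ContMDiffAt 𝓘(ℝ, E₁) 𝓘(ℝ, E₂) n f x := by
  rw [contMDiffAt_iff] at h ⊢
  exact ⟨h.1, h.2.restrict_scalars ℝ⟩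

theorem MDifferentiableAt.restrictScalarsReal (h : MDifferentiableAt 𝓘(ℂ, E₁) 𝓘(ℂ, E₂) f x) :
    MDifferentiableAt 𝓘(ℝ, E₁) 𝓘(ℝ, E₂) f x :=
  h.hasMFDerivAt.restrictScalarsReal.mdifferentiableAt

theorem MDifferentiableAt.mfderiv_real_apply (h : MDifferentiableAt 𝓘(ℂ, E₁) 𝓘(ℂ, E₂) f x)
    (v : E₁) : (mfderiv 𝓘(ℝ, E₁) 𝓘(ℝ, E₂) f x : E₁ → E₂) v =
      (mfderiv 𝓘(ℂ, E₁) 𝓘(ℂ, E₂) f x : E₁ → E₂) v := by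
  rw [h.hasMFDerivAt.restrictScalarsReal.mfderiv]
  rfl

theorem isManifold_restrictScalarsReal {n : ℕ∞ω} [IsManifold 𝓘(ℂ, E₁) n M] :
    IsManifold 𝓘(ℝ, E₁) n M := by
  apply isManifold_of_contDiffOn
  intro e e' he he'
  have h := HasGroupoid.compatible (G := contDiffGroupoid n 𝓘(ℂ, E₁)) he he'
  rw [contDiffGroupoid, mem_groupoid_of_pregroupoid] at h
  exact h.1.restrict_scalars ℝ

end RestrictScalars

/-! ### Real differentials, and G as a real Lie group. -/

namespace FlagCR

section HasD

variable {E₁ E₂ E₃ M N K : Type*} [NormedAddCommGroup E₁] [NormedSpace ℝ E₁]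
  [NormedAddCommGroup E₂] [NormedSpace ℝ E₂] [NormedAddCommGroup E₃] [NormedSpace ℝ E₃]
  [TopologicalSpace M] [ChartedSpace E₁ M] [TopologicalSpace N] [ChartedSpace E₂ N]
  [TopologicalSpace K] [ChartedSpace E₃ K]

/-- `f` has real differential `f'` at `x`; the tangent spaces are identified with the model
spaces. -/
def HasD (f : M → N) (x : M) (f' : E₁ →L[ℝ] E₂) : Prop :=
  HasMFDerivAt 𝓘(ℝ, E₁) 𝓘(ℝ, E₂) f x f'

variable {f : M → N} {g : N → K} {x : M} {f' f'' : E₁ →L[ℝ] E₂} {g' : E₂ →L[ℝ] E₃}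

theorem HasD.comp {y : N} (hg : HasD g y g') (hf : HasD f x f') (hy : f x = y) :
    HasD (fun z => g (f z)) x (g' ∘L f') := by
  subst hy
  exact HasMFDerivAt.comp x hg hf

theorem HasD.unique (h : HasD f x f') (h' : HasD f x f'') : f' = f'' :=
  hasMFDerivAt_unique h h'

theorem HasD.congr {f₁ : M → N} (h : HasD f x f') (h' : f₁ =ᶠ[nhds x] f) : HasD f₁ x f' :=
  HasMFDerivAt.congr_of_eventuallyEq h h'

theorem HasD.congr_deriv (h : HasD f x f') (h' : f' = f'') : HasD f x f'' := h' ▸ h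

theorem HasD.continuousAt (h : HasD f x f') : ContinuousAt f x := HasMFDerivAt.continuousAt h

theorem hasD_iff_hasFDerivAt {f : E₁ → E₂} {x : E₁} : HasD f x f' ↔ HasFDerivAt f f' x :=
  hasMFDerivAt_iff_hasFDerivAt

theorem hasD_const (y : N) : HasD (fun _ : M => y) x (0 : E₁ →L[ℝ] E₂) :=
  hasMFDerivAt_const y x

theorem hasD_id : HasD (fun y : M => y) x (ContinuousLinearMap.id ℝ E₁) :=
  hasMFDerivAt_id x

theorem _root_.MDifferentiableAt.exists_hasD (h : MDifferentiableAt 𝓘(ℝ, E₁) 𝓘(ℝ, E₂) f x) :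
    ∃ f' : E₁ →L[ℝ] E₂, HasD f x f' :=
  ⟨_, h.hasMFDerivAt⟩

end HasD

variable {E : Type*} [NormedAddCommGroup E] [NormedSpace ℂ E]
  {G : Type*} [TopologicalSpace G] [ChartedSpace E G] [Group G] [LieGroup 𝓘(ℂ, E) ω G]

instance realLieGroup : LieGroup 𝓘(ℝ, E) ω G := by
  have : IsManifold 𝓘(ℝ, E) ω G := isManifold_restrictScalarsReal
  refine { contMDiff_mul := fun x => ?_, contMDiff_inv := ?_ }
  · have h := contMDiff_mul 𝓘(ℂ, E) ω (G := G) x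
    rw [contMDiffAt_iff] at h ⊢
    exact ⟨h.1, h.2.restrict_scalars ℝ⟩
  · exact fun x => (contMDiff_inv 𝓘(ℂ, E) ω (G := G) x).restrictScalarsReal

end FlagCR

/-! ### Left trivialized velocities and one-parameter subgroups. -/

namespace FlagCR

variable {E : Type*} [NormedAddCommGroup E] [NormedSpace ℂ E]
  {G : Type*} [TopologicalSpace G] [ChartedSpace E G] [Group G] [LieGroup 𝓘(ℂ, E) ω G]

/-- The differential at `1` of left translation by `g`. -/
noncomputable def lmap (g : G) : E →L[ℝ] E :=
  mfderiv 𝓘(ℝ, E) 𝓘(ℝ, E) (fun x : G => g * x) 1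

theorem hasD_mul_left (g h : G) : ∃ f' : E →L[ℝ] E, HasD (fun x : G => g * x) h f' :=
  ((contMDiff_mul_left (I := 𝓘(ℝ, E)) (n := ω) (a := g)).mdifferentiable (by simp) h).exists_hasD

theorem hasD_lmap (g : G) : HasD (fun x : G => g * x) 1 (lmap (E := E) g) :=
  ((contMDiff_mul_left (I := 𝓘(ℝ, E)) (n := ω) (a := g)).mdifferentiable (by simp) 1).hasMFDerivAt

theorem lmap_one : lmap (E := E) (1 : G) = ContinuousLinearMap.id ℝ E := by
  refine (hasD_lmap (1 : G)).unique ?_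
  simpa using (hasD_id (x := (1 : G)))

/-- `c` is differentiable at `t` with velocity the left translate of `v`. -/
def HasVelAt (c : ℝ → G) (t : ℝ) (v : E) : Prop :=
  HasD c t ((lmap (c t)).comp (ContinuousLinearMap.toSpanSingleton ℝ v))

theorem lmap_mul (g h : G) {f' : E →L[ℝ] E} (hf : HasD (fun x : G => g * x) h f') :
    f' ∘L lmap h = lmap (E := E) (g * h) := by
  refine HasD.unique (f := fun x : G => g * h * x) ?_ (hasD_lmap (g * h))
  simp only [mul_assoc]
  exact hf.comp (hasD_lmap h) (mul_one h)

/-- Velocities are measured after translation back to the identity, so left translations do not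
change them. -/
theorem HasVelAt.mul_left {c : ℝ → G} {t : ℝ} {v : E} (hc : HasVelAt c t v) (g : G) :
    HasVelAt (fun s => g * c s) t v := by
  obtain ⟨f', hf⟩ := hasD_mul_left (E := E) g (c t)
  have := hf.comp hc rfl
  rwa [← ContinuousLinearMap.comp_assoc, lmap_mul g _ hf] at this

theorem contMDiff_invariantField (v : E) : ContMDiff 𝓘(ℝ, E) 𝓘(ℝ, E).tangent 1 (fun g : G =>
    (⟨g, mulInvariantVectorField (I := 𝓘(ℝ, E)) v g⟩ : TangentBundle 𝓘(ℝ, E) G)) :=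
  (contMDiff_mulInvariantVectorField (I := 𝓘(ℝ, E)) (G := G) v).of_le (by simp)

theorem hasVelAt_iff {c : ℝ → G} {t : ℝ} {v : E} : HasVelAt c t v ↔
    HasMFDerivAt 𝓘(ℝ, ℝ) 𝓘(ℝ, E) c t ((1 : ℝ →L[ℝ] ℝ).smulRight
      (mulInvariantVectorField (I := 𝓘(ℝ, E)) (G := G) v (c t))) := by
  have : ((1 : ℝ →L[ℝ] ℝ).smulRight (lmap (c t) v : E)) =
      ((lmap (E := E) (c t)).comp (ContinuousLinearMap.toSpanSingleton ℝ v)) := by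
    ext; simp
  rw [HasVelAt, ← this]
  rfl

theorem isMIntegralCurve_iff_hasVelAt {c : ℝ → G} {v : E} :
    IsMIntegralCurve (I := 𝓘(ℝ, E)) c (mulInvariantVectorField (I := 𝓘(ℝ, E)) v) ↔
      ∀ t, HasVelAt c t v :=
  forall_congr' fun _ => hasVelAt_iff.symm

theorem hasVelAt_comp_add {c : ℝ → G} {v : E} {t s : ℝ} (h : HasVelAt c (s + t) v) :
    HasVelAt (fun r => c (s + r)) t v := by
  have h2 : HasD (fun r : ℝ => s + r) t (ContinuousLinearMap.id ℝ ℝ) :=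
    hasD_iff_hasFDerivAt.2 ((hasFDerivAt_id t).const_add s)
  exact h.comp h2 rfl

theorem hasVelAt_comp_mul {c : ℝ → G} {v : E} {t s : ℝ} (h : HasVelAt c (s * t) v) :
    HasVelAt (fun r => c (s * r)) t (s • v) := by
  have h2 : HasD (fun r : ℝ => s * r) t (s • ContinuousLinearMap.id ℝ ℝ) :=
    hasD_iff_hasFDerivAt.2 ((hasFDerivAt_id t).const_mul s)
  refine (h.comp h2 rfl).congr_deriv ?_
  ext; simp

theorem isOneParameterSubgroup_iff {γ : ℝ → G} {v : E} :
    IsOneParameterSubgroup (E := E) γ v ↔ (∀ s t, γ (s + t) = γ s * γ t) ∧ HasVelAt γ 0 v := by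
  refine and_congr_right fun h => ?_
  have h0 : γ 0 = 1 := by simpa using h 0 0
  rw [HasVelAt, h0, lmap_one]
  exact Iff.rfl

theorem IsOneParameterSubgroup.hasVelAt {γ : ℝ → G} {v : E}
    (h : IsOneParameterSubgroup (E := E) γ v) (t : ℝ) : HasVelAt γ t v := by
  obtain ⟨h1, h2⟩ := isOneParameterSubgroup_iff.1 h
  have h3 : HasVelAt (fun r => γ t * γ (-t + r)) t v :=
    HasVelAt.mul_left (hasVelAt_comp_add (by simpa using h2)) _
  simpa [← h1] using h3

section

variable [T2Space G]

theorem hasVelAt_unique {c c' : ℝ → G} {v : E} (h : ∀ t, HasVelAt c t v) (h' : ∀ t, HasVelAt c' t v)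
    (h0 : c 0 = c' 0) : c = c' :=
  isMIntegralCurve_Ioo_eq_of_contMDiff_boundaryless (I := 𝓘(ℝ, E)) (t₀ := 0)
    (contMDiff_invariantField v) (isMIntegralCurve_iff_hasVelAt.2 h)
    (isMIntegralCurve_iff_hasVelAt.2 h') h0

variable [CompleteSpace E]

/-- Left invariant fields are complete: the left translates of one local integral curve through 1
are integral curves through every point with the same lifetime ε, which allows indefinite
continuation. -/
theorem exists_hasVelAt (v : E) : ∃ c : ℝ → G, c 0 = 1 ∧ ∀ t, HasVelAt c t v := by
  obtain ⟨γ, h0, h⟩ := exists_isMIntegralCurveAt_of_contMDiffAt_boundaryless (I := 𝓘(ℝ, E)) 0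
    (contMDiff_invariantField v (1 : G))
  obtain ⟨ε, hε, h⟩ := isMIntegralCurveAt_iff'.1 h
  have key := exists_isMIntegralCurve_of_isMIntegralCurveOn (I := 𝓘(ℝ, E)) (M := G)
    (contMDiff_invariantField v) hε ?_ 1
  · obtain ⟨c, hc, hc'⟩ := key
    exact ⟨c, hc, isMIntegralCurve_iff_hasVelAt.1 hc'⟩
  · intro x
    refine ⟨fun t => x * γ t, by simp [h0], fun t ht => ?_⟩
    have ht' : t ∈ Metric.ball (0 : ℝ) ε := by simpa [Real.ball_eq_Ioo] using ht
    have h1 := (h t ht').hasMFDerivAt (Metric.isOpen_ball.mem_nhds ht')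
    exact (hasVelAt_iff.1 ((hasVelAt_iff.2 h1).mul_left x)).hasMFDerivWithinAt

/-- For the integral curve c through 1, both t ↦ c(s + t) and t ↦ c(s)c(t) are integral curves that
start at c(s). -/
theorem exists_isOneParameterSubgroup (v : E) : ∃ γ : ℝ → G, IsOneParameterSubgroup (E := E) γ v := by
  obtain ⟨c, h0, h⟩ := exists_hasVelAt (G := G) v
  refine ⟨c, isOneParameterSubgroup_iff.2 ⟨fun s t => ?_, h 0⟩⟩
  exact congrFun (hasVelAt_unique (fun t => hasVelAt_comp_add (h (s + t)))
    (fun t => (h t).mul_left (c s)) (by simp [h0])) t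

/-- By uniqueness of integral curves the choice made in `lieExp` is immaterial, and rescaling time
rescales the velocity. -/
theorem lieExp_smul_eq {γ : ℝ → G} {v : E} (h : IsOneParameterSubgroup (E := E) γ v) (t : ℝ) :
    lieExp (E := E) (G := G) (t • v : E) = γ t := by
  have key : ∀ w, ∀ γ' : ℝ → G, IsOneParameterSubgroup (E := E) γ' w → lieExp (E := E) (G := G) w = γ' 1 := by
    intro w γ' hγ'
    have hex : ∃ γ : ℝ → G, IsOneParameterSubgroup (E := E) γ w := ⟨γ', hγ'⟩
    rw [lieExp, dif_pos hex]
    have h1 := hex.choose_spec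
    refine congrFun (hasVelAt_unique h1.hasVelAt hγ'.hasVelAt ?_) 1
    have e1 := h1.1 0 0
    have e2 := hγ'.1 0 0
    simp only [add_zero, left_eq_mul] at e1 e2
    rw [e1, e2]
  rw [key (t • v : E) (fun r => γ (t * r)), mul_one]
  refine isOneParameterSubgroup_iff.2 ⟨fun s r => by rw [mul_add, h.1], ?_⟩
  exact hasVelAt_comp_mul (h.hasVelAt _)

theorem isOneParameterSubgroup_lieExp (v : E) :
    IsOneParameterSubgroup (E := E) (fun t : ℝ => lieExp (E := E) (G := G) (t • v : E)) v := by
  obtain ⟨γ, h⟩ := exists_isOneParameterSubgroup (G := G) v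
  have : (fun t : ℝ => lieExp (E := E) (G := G) (t • v : E)) = γ := funext (lieExp_smul_eq h)
  rwa [this]

end
end FlagCR

/-! ### Differentials that depend on a parameter, and left invariant derivatives. -/

namespace FlagCR

section ParametricDerivative

variable {𝕜 : Type*} [NontriviallyNormedField 𝕜] {E₁ E₂ E₃ N M M' : Type*}
  [NormedAddCommGroup E₁] [NormedSpace 𝕜 E₁] [NormedAddCommGroup E₂] [NormedSpace 𝕜 E₂]
  [NormedAddCommGroup E₃] [NormedSpace 𝕜 E₃]
  [TopologicalSpace N] [ChartedSpace E₁ N] [TopologicalSpace M] [ChartedSpace E₂ M]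
  [TopologicalSpace M'] [ChartedSpace E₃ M'] {m n : ℕ∞ω}

/-- The differential, as a map between the model spaces. -/
noncomputable def mfd (𝕜 : Type*) [NontriviallyNormedField 𝕜] {E₁ E₂ M N : Type*}
    [NormedAddCommGroup E₁] [NormedSpace 𝕜 E₁] [NormedAddCommGroup E₂] [NormedSpace 𝕜 E₂]
    [TopologicalSpace M] [ChartedSpace E₁ M] [TopologicalSpace N] [ChartedSpace E₂ N]
    (f : M → N) (x : M) : E₁ →L[𝕜] E₂ :=
  mfderiv 𝓘(𝕜, E₁) 𝓘(𝕜, E₂) f x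

/-- Smooth dependence of a differential is in general a statement in tangent coordinates. The
hypothesis `hch` says that all the values at `y₀` use the same preferred chart; then the coordinate
changes are identities and the plain differential is smooth. -/
theorem contMDiffAt_mfderiv_param [IsManifold 𝓘(𝕜, E₁) 1 N] [IsManifold 𝓘(𝕜, E₂) 1 M]
    [IsManifold 𝓘(𝕜, E₃) 1 M']
    {f : N → M → M'} {x₀ : N} {y₀ : M}
    (hf : ContMDiffAt (𝓘(𝕜, E₁).prod 𝓘(𝕜, E₂)) 𝓘(𝕜, E₃) n (Function.uncurry f) (x₀, y₀))
    (hmn : m + 1 ≤ n) (hch : ∀ x, chartAt E₃ (f x y₀) = chartAt E₃ (f x₀ y₀)) :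
    ContMDiffAt 𝓘(𝕜, E₁) 𝓘(𝕜, E₂ →L[𝕜] E₃) m
      (fun x => (mfd 𝕜 (f x) y₀ : E₂ →L[𝕜] E₃)) x₀ := by
  have h := ContMDiffAt.mfderiv (I := 𝓘(𝕜, E₂)) f (fun _ => y₀) hf contMDiffAt_const hmn
  refine h.congr_of_eventuallyEq (Filter.Eventually.of_forall fun x => Eq.symm ?_)
  have hs : f x y₀ ∈ (chartAt E₃ (f x₀ y₀)).source := by
    rw [← hch x]; exact mem_chart_source E₃ _
  refine (inTangentCoordinates_eq (I := 𝓘(𝕜, E₂)) (I' := 𝓘(𝕜, E₃)) (fun _ => y₀) (fun x => f x y₀)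
    (fun x => (mfd 𝕜 (f x) y₀ : E₂ →L[𝕜] E₃)) (x₀ := x₀) (x := x)
    (mem_chart_source E₂ _) hs).trans ?_
  have ha : achart E₃ (f x y₀) = achart E₃ (f x₀ y₀) := Subtype.ext (hch x)
  rw [ha]
  ext v
  simp only [ContinuousLinearMap.comp_apply]
  rw [(tangentBundleCore 𝓘(𝕜, E₂) M).coordChange_self _ _ (mem_chart_source E₂ y₀),
    (tangentBundleCore 𝓘(𝕜, E₃) M').coordChange_self _ _ hs]

end ParametricDerivative

variable {E : Type*} [NormedAddCommGroup E] [NormedSpace ℂ E]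
  {G : Type*} [TopologicalSpace G] [ChartedSpace E G] [Group G] [LieGroup 𝓘(ℂ, E) ω G]
  {E' : Type*} [NormedAddCommGroup E'] [NormedSpace ℝ E'] {F F₁ F₂ : G → E'} {g : G} {v w : E}

/-- The derivative of `F` along the left invariant vector field given by `v`. -/
noncomputable def LD (v : E) (F : G → E') (g : G) : E' :=
  mfd ℝ (fun h : G => F (g * h)) 1 v

theorem LD_eq {F' : E →L[ℝ] E'} (hF : HasD F g F') (v : E) : LD v F g = F' (lmap g v) := by
  have h := hF.comp (hasD_lmap g) (mul_one g)
  exact congrArg (fun A : E →L[ℝ] E' => A v) (HasMFDerivAt.mfderiv h)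

theorem HasVelAt.hasDerivAt {c : ℝ → G} {t : ℝ} (hc : HasVelAt c t v)
    (hF : MDifferentiableAt 𝓘(ℝ, E) 𝓘(ℝ, E') F (c t)) :
    HasDerivAt (fun s => F (c s)) (LD v F (c t)) t := by
  obtain ⟨F', hF'⟩ := hF.exists_hasD
  have := hasD_iff_hasFDerivAt.1 (hF'.comp hc rfl)
  rw [LD_eq hF']
  simpa using this.hasDerivAt

theorem contMDiff_LD (hF : ContMDiff 𝓘(ℝ, E) 𝓘(ℝ, E') ∞ F) (v : E) :
    ContMDiff 𝓘(ℝ, E) 𝓘(ℝ, E') ∞ (LD v F) := by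
  intro g
  have h1 : ContMDiff (𝓘(ℝ, E).prod 𝓘(ℝ, E)) 𝓘(ℝ, E) ∞ (fun p : G × G => p.1 * p.2) :=
    contMDiff_mul 𝓘(ℝ, E) ∞
  have h := contMDiffAt_mfderiv_param (m := ∞) (n := ∞) (f := fun g h : G => F (g * h))
    (x₀ := g) (y₀ := 1) ((hF.comp h1) (g, 1)) (by simp) (fun x => rfl)
  exact ((ContinuousLinearMap.apply ℝ E' v).contMDiff (n := ∞)).contMDiffAt.comp g h

theorem LD_add_left (v w : E) (F : G → E') : LD (v + w) F = LD v F + LD w F := by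
  ext g; simp [LD]

theorem LD_smul_left (r : ℝ) (v : E) (F : G → E') : LD (r • v) F = r • LD v F := by
  ext g; simp [LD]

theorem LD_zero_left (F : G → E') : LD (0 : E) F = 0 := by
  ext g; simp [LD]

theorem LD_comp_clm {E'' : Type*} [NormedAddCommGroup E''] [NormedSpace ℝ E''] (A : E' →L[ℝ] E'')
    (hF : MDifferentiableAt 𝓘(ℝ, E) 𝓘(ℝ, E') F g) : LD v (fun h => A (F h)) g = A (LD v F g) := by
  obtain ⟨F', hF'⟩ := hF.exists_hasD
  rw [LD_eq hF', LD_eq ((hasD_iff_hasFDerivAt.2 A.hasFDerivAt).comp hF' rfl)]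
  rfl

theorem LD_mul_left (g h : G) : LD v (fun x => F (g * x)) h = LD v F (g * h) := by
  simp [LD, mul_assoc]

/-! ### Commutators of left invariant derivatives. -/

section Commutator

variable [CompleteSpace E]

variable (G) in
/-- The Lie bracket of the Lie algebra of `G`, on the model space. -/
noncomputable def gbr (v w : E) : E :=
  (⁅(show GroupLieAlgebra 𝓘(ℂ, E) G from v), (show GroupLieAlgebra 𝓘(ℂ, E) G from w)⁆ :
    GroupLieAlgebra 𝓘(ℂ, E) G)

theorem mulInvariantVectorField_eq_lmap (v : E) (g : G) :
    mulInvariantVectorField (I := 𝓘(ℂ, E)) (G := G) v g = lmap (E := E) g v :=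
  (MDifferentiableAt.mfderiv_real_apply
    ((contMDiff_mul_left (I := 𝓘(ℂ, E)) (n := ω) (a := g)).mdifferentiable (by simp) 1) v).symm

variable (G) in
/-- The left invariant vector field of `v` in the chart at `1`. -/
noncomputable def chartField (v : E) (z : E) : E :=
  VectorField.mpullback 𝓘(ℂ, E) 𝓘(ℂ, E) (extChartAt 𝓘(ℂ, E) (1 : G)).symm
    (mulInvariantVectorField (I := 𝓘(ℂ, E)) (G := G) v) z

theorem differentiableAt_chartField (v : E) :
    DifferentiableAt ℂ (chartField G v) (extChartAt 𝓘(ℂ, E) (1 : G) 1) := by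
  have h := MDifferentiableWithinAt.differentiableWithinAt_mpullbackWithin_vectorField
    (I := 𝓘(ℂ, E)) (s := Set.univ)
    (mdifferentiableAt_mulInvariantVectorField (I := 𝓘(ℂ, E)) (G := G) v (g := 1)).mdifferentiableWithinAt
  rw [ModelWithCorners.range_eq_univ, VectorField.mpullbackWithin_univ, Set.preimage_univ,
    Set.univ_inter] at h
  exact differentiableWithinAt_univ.1 h

theorem exists_hasD_chart_symm {z : E} (hz : z ∈ (extChartAt 𝓘(ℂ, E) (1 : G)).target) :
    ∃ A : E →L[ℝ] E, HasD (extChartAt 𝓘(ℂ, E) (1 : G)).symm z A ∧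
      ∀ v, A (chartField G v z) = lmap ((extChartAt 𝓘(ℂ, E) (1 : G)).symm z) v := by
  have h1 := (mdifferentiableOn_extChartAt_symm (I := 𝓘(ℂ, E)) (x := (1 : G)) z hz)
  have h2 : MDifferentiableAt 𝓘(ℂ, E) 𝓘(ℂ, E) (extChartAt 𝓘(ℂ, E) (1 : G)).symm z :=
    h1.mdifferentiableAt ((isOpen_extChartAt_target (I := 𝓘(ℂ, E)) (1 : G)).mem_nhds hz)
  refine ⟨_, h2.hasMFDerivAt.restrictScalarsReal, fun v => ?_⟩
  have h3 := isInvertible_mfderivWithin_extChartAt_symm (I := 𝓘(ℂ, E)) hz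
  rw [← mulInvariantVectorField_eq_lmap]
  have h4 := h3.self_comp_inverse
  rw [ModelWithCorners.range_eq_univ, mfderivWithin_univ] at h4
  exact congrArg (fun A => A (mulInvariantVectorField (I := 𝓘(ℂ, E)) (G := G) v
    ((extChartAt 𝓘(ℂ, E) (1 : G)).symm z))) h4

/-- The bracket of the Lie algebra is by definition the bracket at 1 of the invariant vector fields,
and that one is computed in the chart at 1. -/
theorem hasD_chart_symm_lieBracket {A : E →L[ℝ] E}
    (hA : HasD (extChartAt 𝓘(ℂ, E) (1 : G)).symm (extChartAt 𝓘(ℂ, E) (1 : G) 1) A) (v w : E) :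
    A (VectorField.lieBracket ℂ (chartField G v) (chartField G w) (extChartAt 𝓘(ℂ, E) (1 : G) 1))
      = gbr G v w := by
  set φ := extChartAt 𝓘(ℂ, E) (1 : G) with hφ
  have hz : φ 1 ∈ φ.target := mem_extChartAt_target (I := 𝓘(ℂ, E)) (1 : G)
  have h1 := mfderivWithin_extChartAt_symm_comp_mfderiv_extChartAt (I := 𝓘(ℂ, E)) hz
  have h2 := mfderiv_extChartAt_comp_mfderivWithin_extChartAt_symm (I := 𝓘(ℂ, E)) hz
  have h0 : φ.symm (φ 1) = 1 := extChartAt_to_inv (I := 𝓘(ℂ, E)) (1 : G)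
  have h3 : MDifferentiableAt 𝓘(ℂ, E) 𝓘(ℂ, E) φ.symm (φ 1) :=
    (mdifferentiableOn_extChartAt_symm (I := 𝓘(ℂ, E)) (x := (1 : G)) _ hz).mdifferentiableAt
      ((isOpen_extChartAt_target (I := 𝓘(ℂ, E)) (1 : G)).mem_nhds hz)
  have hA' : A = (mfd ℂ φ.symm (φ 1)).restrictScalars ℝ :=
    hA.unique h3.hasMFDerivAt.restrictScalarsReal
  rw [ModelWithCorners.range_eq_univ, mfderivWithin_univ] at h1 h2
  rw [← hφ, h0] at h1 h2
  have h1' : (mfd ℂ φ.symm (φ 1) : E →L[ℂ] E) ∘L mfd ℂ φ 1 = ContinuousLinearMap.id ℂ E := h1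
  have h2' : (mfd ℂ φ 1 : E →L[ℂ] E) ∘L mfd ℂ φ.symm (φ 1) = ContinuousLinearMap.id ℂ E := h2
  have h4 := ContinuousLinearMap.inverse_eq h2' h1'
  rw [hA', ← h4]
  have h5 : gbr G v w = VectorField.mlieBracket 𝓘(ℂ, E)
    (mulInvariantVectorField (I := 𝓘(ℂ, E)) (G := G) v)
    (mulInvariantVectorField (I := 𝓘(ℂ, E)) (G := G) w) (1 : G) := rfl
  rw [h5, ← VectorField.mlieBracketWithin_univ, VectorField.mlieBracketWithin_apply,
    ModelWithCorners.range_eq_univ, VectorField.mpullbackWithin_univ,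
    VectorField.mpullbackWithin_univ, Set.preimage_univ, Set.univ_inter,
    ← VectorField.lieBracketWithin_univ]
  rfl

theorem two_le_infty : (1 + 1 : ℕ∞ω) ≤ ∞ := by
  have : ((2 : ℕ∞) : ℕ∞ω) ≤ ((⊤ : ℕ∞) : ℕ∞ω) := WithTop.coe_le_coe.2 le_top
  simpa [one_add_one_eq_two] using this

/-- In the chart at 1 the second derivative of F is symmetric and cancels in the commutator. The
remaining first order terms are the differential of F on the bracket of the two vector fields. -/
theorem LD_bracket_one (hF : ContMDiff 𝓘(ℝ, E) 𝓘(ℝ, E') ∞ F) (v w : E) :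
    LD v (LD w F) (1 : G) - LD w (LD v F) 1 = LD (gbr G v w) F 1 := by
  set φ := extChartAt 𝓘(ℂ, E) (1 : G) with hφ
  have hz : φ 1 ∈ φ.target := mem_extChartAt_target (I := 𝓘(ℂ, E)) (1 : G)
  have h0 : φ.symm (φ 1) = 1 := extChartAt_to_inv (I := 𝓘(ℂ, E)) (1 : G)
  have htop : φ.target ∈ nhds (φ 1) := (isOpen_extChartAt_target (I := 𝓘(ℂ, E)) (1 : G)).mem_nhds hz
  set F₀ : E → E' := fun z => F (φ.symm z) with hF₀
  have hsm : ContDiffAt ℝ ∞ F₀ (φ 1) := by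
    rw [← contMDiffAt_iff_contDiffAt]
    refine ContMDiffAt.comp (φ 1) (hF _) ?_
    exact (((contMDiffOn_extChartAt_symm (I := 𝓘(ℂ, E)) (n := ω) (1 : G)) _ hz).contMDiffAt
      htop).restrictScalarsReal.of_le le_top
  have key : ∀ (F : G → E') (v : E) (z : E), MDifferentiable 𝓘(ℝ, E) 𝓘(ℝ, E') F → z ∈ φ.target →
      LD v F (φ.symm z) = fderiv ℝ (fun z => F (φ.symm z)) z (chartField G v z) := by
    intro F v z hF hz
    obtain ⟨A, hA, hA'⟩ := exists_hasD_chart_symm hz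
    obtain ⟨F', hF'⟩ := (hF (φ.symm z)).exists_hasD
    rw [LD_eq hF', (hasD_iff_hasFDerivAt.1 (hF'.comp hA rfl)).fderiv, ContinuousLinearMap.comp_apply, hA']
  have hd : ∀ v, MDifferentiable 𝓘(ℝ, E) 𝓘(ℝ, E') (LD v F) := fun v =>
    (contMDiff_LD hF v).mdifferentiable (by simp)
  have hF1 := hF.mdifferentiable (by simp)
  have hc : ∀ v, HasFDerivAt (chartField G v)
      ((fderiv ℂ (chartField G v) (φ 1)).restrictScalars ℝ) (φ 1) := fun v =>
    (differentiableAt_chartField (G := G) v).hasFDerivAt.restrictScalars ℝ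
  have hsm' : HasFDerivAt (fderiv ℝ F₀) (fderiv ℝ (fderiv ℝ F₀) (φ 1)) (φ 1) :=
    ((hsm.fderiv_right (m := 1) two_le_infty).differentiableAt (by simp)).hasFDerivAt
  -- Product rule for z ↦ dF₀(z)(Y(z)), where Y is the chart expression of the field of w,
  -- differentiated along the field of v.
  have second : ∀ v w : E, LD v (LD w F) (1 : G) =
      fderiv ℝ (fderiv ℝ F₀) (φ 1) (chartField G v (φ 1)) (chartField G w (φ 1)) +
        fderiv ℝ F₀ (φ 1) (fderiv ℂ (chartField G w) (φ 1) (chartField G v (φ 1))) := by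
    intro v w
    have h1 := key (LD w F) v (φ 1) (hd w) hz
    rw [h0] at h1
    rw [h1]
    have h2 : (fun z => LD w F (φ.symm z)) =ᶠ[nhds (φ 1)]
        fun z => fderiv ℝ F₀ z (chartField G w z) := by
      filter_upwards [htop] with z hz using key F w z hF1 hz
    rw [h2.fderiv_eq, (hsm'.clm_apply (hc w)).fderiv]
    simp [add_comm]
  obtain ⟨A, hA, hA'⟩ := exists_hasD_chart_symm hz
  have hbr := hasD_chart_symm_lieBracket hA v w
  obtain ⟨F', hF'⟩ := (hF1 (φ.symm (φ 1))).exists_hasD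
  have h3 : fderiv ℝ F₀ (φ 1) = F' ∘L A := (hasD_iff_hasFDerivAt.1 (hF'.comp hA rfl)).fderiv
  have h4 : LD (gbr G v w) F 1 = F' (gbr G v w) := by
    rw [h0] at hF'
    rw [LD_eq hF', lmap_one]; rfl
  have hsymm : IsSymmSndFDerivAt ℝ F₀ (φ 1) := hsm.isSymmSndFDerivAt (by simpa [one_add_one_eq_two] using two_le_infty)
  rw [second v w, second w v, h4, ← hbr, VectorField.lieBracket, map_sub, map_sub, h3, hsymm.eq]
  simp only [ContinuousLinearMap.comp_apply]
  abel

/-- Left translation commutes with left invariant derivatives, so the point g can be moved to 1. -/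
theorem LD_bracket (hF : ContMDiff 𝓘(ℝ, E) 𝓘(ℝ, E') ∞ F) (v w : E) (g : G) :
    LD v (LD w F) g - LD w (LD v F) g = LD (gbr G v w) F g := by
  have h := LD_bracket_one (F := fun x => F (g * x)) (hF.comp contMDiff_mul_left) v w
  have e : ∀ v : E, LD v (fun x => F (g * x)) = fun x => LD v F (g * x) :=
    fun v => funext fun h => LD_mul_left g h
  simp only [e] at h
  simpa only [LD_mul_left (F := LD _ F), LD_mul_left, mul_one] using h

end Commutator
end FlagCR

namespace FlagCR

variable {E : Type*} [NormedAddCommGroup E] [NormedSpace ℂ E]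
  {G : Type*} [TopologicalSpace G] [ChartedSpace E G] [Group G] [LieGroup 𝓘(ℂ, E) ω G]
  {E' : Type*} [NormedAddCommGroup E'] [NormedSpace ℝ E'] {F F₁ F₂ : G → E'} {g : G} {v w : E}

/-! ### Velocities -/

/-- `c` is a curve through `1` with velocity `v` there. -/
def HasVel (c : ℝ → G) (v : E) : Prop := c 0 = 1 ∧ HasVelAt c 0 v

theorem HasVelAt.mul {a b : ℝ → G} {t : ℝ} (ha : HasVelAt a t v) (hb : HasVelAt b t w)
    (h1 : b t = 1) : HasVelAt (fun s => a s * b s) t (v + w) := by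
  have hm : MDifferentiableAt (𝓘(ℝ, E).prod 𝓘(ℝ, E)) 𝓘(ℝ, E) (fun p : G × G => p.1 * p.2) (a t, b t) :=
    (contMDiff_mul 𝓘(ℝ, E) ω).mdifferentiable (by simp) _
  have h := HasMFDerivAt.comp t hm.hasMFDerivAt (HasMFDerivAt.prodMk ha hb)
  have h' : HasD (fun s => a s * b s) t _ := h
  refine h'.congr_deriv (ContinuousLinearMap.ext fun (r : ℝ) => ?_)
  refine (mfderiv_prod_eq_add_apply hm).trans ?_
  have e1 : HasD (fun z : G => z * b t) (a t) (ContinuousLinearMap.id ℝ E) := by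
    simpa [h1] using hasD_id (x := a t)
  have e2 := hasD_lmap (E := E) (a t)
  rw [← h1] at e2
  have e3 : mfderiv 𝓘(ℝ, E) 𝓘(ℝ, E) (fun z : G => z * b t) (a t) = ContinuousLinearMap.id ℝ E :=
    HasMFDerivAt.mfderiv e1
  have e4 : mfderiv 𝓘(ℝ, E) 𝓘(ℝ, E) (fun z : G => a t * z) (b t) = lmap (E := E) (a t) :=
    HasMFDerivAt.mfderiv e2
  refine (congrArg₂ (fun (A B : E →L[ℝ] E) =>
    A ((lmap (E := E) (a t)) ((ContinuousLinearMap.toSpanSingleton ℝ v) r)) +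
    B ((lmap (E := E) (b t)) ((ContinuousLinearMap.toSpanSingleton ℝ w) r))) e3 e4).trans ?_
  have e5 : lmap (E := E) (a t * b t) = lmap (a t) := by rw [h1, mul_one]
  change _ = lmap (E := E) (a t * b t) (r • (v + w))
  rw [e5]
  simp [h1, lmap_one]

theorem HasVel.mul {a b : ℝ → G} (ha : HasVel a v) (hb : HasVel b w) :
    HasVel (fun s => a s * b s) (v + w) :=
  ⟨by simp [ha.1, hb.1], ha.2.mul hb.2 hb.1⟩

theorem HasVel.hasDerivAt {c : ℝ → G} (hc : HasVel c v) (g : G)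
    (hF : MDifferentiableAt 𝓘(ℝ, E) 𝓘(ℝ, E') F g) :
    HasDerivAt (fun s => F (g * c s)) (LD v F g) 0 := by
  have := (hc.2.mul_left g).hasDerivAt (F := F) (by simpa [hc.1] using hF)
  simpa [hc.1] using this

theorem HasVelAt.unique {c : ℝ → G} {t : ℝ} (h : HasVelAt c t v) (h' : HasVelAt c t w) : v = w := by
  have e : lmap (E := E) ((c t)⁻¹ * c t) = ContinuousLinearMap.id ℝ E := by
    rw [inv_mul_cancel, lmap_one]
  have h1 : (lmap (E := E) ((c t)⁻¹ * c t)).comp (ContinuousLinearMap.toSpanSingleton ℝ v) =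
      (lmap (E := E) ((c t)⁻¹ * c t)).comp (ContinuousLinearMap.toSpanSingleton ℝ w) :=
    HasD.unique (h.mul_left (c t)⁻¹) (h'.mul_left (c t)⁻¹)
  rw [e] at h1
  simpa using congrArg (fun A : ℝ →L[ℝ] E => A 1) h1

theorem hasVel_const : HasVel (fun _ : ℝ => (1 : G)) (0 : E) := by
  refine ⟨rfl, (hasD_const (1 : G)).congr_deriv ?_⟩
  ext; simp

/-- Inversion is differentiable, so the inverse curve has some velocity at 0; the constant product
a(s)a(s)⁻¹ forces it to be −v. -/
theorem HasVel.inv {a : ℝ → G} (ha : HasVel a v) : HasVel (fun s => (a s)⁻¹) (-v) := by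
  have h1 : MDifferentiableAt 𝓘(ℝ, E) 𝓘(ℝ, E) (fun x : G => x⁻¹) (a 0) :=
    (contMDiff_inv 𝓘(ℝ, E) ω).mdifferentiable (by simp) _
  obtain ⟨I, hI⟩ := h1.exists_hasD
  have h2 := hI.comp ha.2 rfl
  rw [ha.1, lmap_one] at h2
  have h3 : HasVel (fun s => (a s)⁻¹) (I v) := by
    refine ⟨by simp [ha.1], HasD.congr_deriv h2 ?_⟩
    have e : lmap (E := E) (a 0)⁻¹ = ContinuousLinearMap.id ℝ E := by
      rw [ha.1, inv_one, lmap_one]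
    change _ = (lmap (E := E) (a 0)⁻¹).comp _
    rw [e]
    ext; simp
  have h4 := ha.mul h3
  simp only [mul_inv_cancel] at h4
  rwa [← eq_neg_of_add_eq_zero_right (h4.2.unique hasVel_const.2)]

section Exp

variable [T2Space G] [CompleteSpace E]

theorem hasVel_lieExp (v : E) : HasVel (fun t : ℝ => lieExp (E := E) (G := G) (t • v : E)) v := by
  obtain ⟨h1, h2⟩ := isOneParameterSubgroup_iff.1 (isOneParameterSubgroup_lieExp (G := G) v)
  exact ⟨by simpa using h1 0 0, h2⟩

theorem lieExp_zero : lieExp (E := E) (G := G) (0 : E) = 1 := by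
  simpa using (hasVel_lieExp (G := G) (0 : E)).1

theorem lieExp_add_smul (v : E) (s t : ℝ) : lieExp (E := E) (G := G) ((s + t) • v : E) =
    lieExp (E := E) (G := G) (s • v : E) * lieExp (E := E) (G := G) (t • v : E) :=
  (isOneParameterSubgroup_lieExp (G := G) v).1 s t

theorem lieExp_neg (v : E) : lieExp (E := E) (G := G) (-v : E) = (lieExp (E := E) (G := G) v)⁻¹ := by
  have := lieExp_add_smul (G := G) v (-1) 1
  simp only [neg_add_cancel, zero_smul, lieExp_zero, neg_smul, one_smul] at this
  exact eq_inv_of_mul_eq_one_left this.symm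

theorem lieExp_eq_of_isOneParameterSubgroup {γ : ℝ → G} (h : ∀ s t, γ (s + t) = γ s * γ t)
    (h' : HasVel γ v) : lieExp (E := E) (G := G) v = γ 1 := by
  have := lieExp_smul_eq (isOneParameterSubgroup_iff.2 ⟨h, h'.2⟩) 1
  rwa [one_smul] at this

end Exp

/-! ### The adjoint representation -/

theorem hasD_conj (g : G) : HasD (fun h : G => g * h * g⁻¹) 1
    ((mfd ℂ (fun h : G => g * h * g⁻¹) 1 : E →L[ℂ] E).restrictScalars ℝ) :=
  (((contMDiff_mul_right (a := g⁻¹)).comp (contMDiff_mul_left (I := 𝓘(ℂ, E)) (n := ω) (a := g))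
    |>.mdifferentiable (by simp) 1).hasMFDerivAt).restrictScalarsReal

/-- The adjoint action as a continuous linear map of the model space. -/
noncomputable def adc (g : G) : E →L[ℂ] E := mfd ℂ (fun h : G => g * h * g⁻¹) 1

theorem HasVel.conj {c : ℝ → G} (hc : HasVel c v) (g : G) :
    HasVel (fun s => g * c s * g⁻¹) (adc g v) := by
  refine ⟨by simp [hc.1], ?_⟩
  have := (hasD_conj (E := E) g).comp hc.2 hc.1
  refine HasD.congr_deriv this ?_
  simp only [hc.1, mul_one, mul_inv_cancel, lmap_one]
  ext; simp [adc]

/-- All conjugations fix 1, so their differentials at 1 are compared in one and the same chart. -/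
theorem contMDiff_adc : ContMDiff 𝓘(ℂ, E) 𝓘(ℂ, E →L[ℂ] E) ω (fun g : G => adc (E := E) g) := by
  intro g
  have h1 : ContMDiff (𝓘(ℂ, E).prod 𝓘(ℂ, E)) 𝓘(ℂ, E) ω (fun p : G × G => p.1 * p.2 * p.1⁻¹) :=
    (contMDiff_fst.mul contMDiff_snd).mul (contMDiff_inv 𝓘(ℂ, E) ω |>.comp contMDiff_fst)
  exact contMDiffAt_mfderiv_param (m := ω) (n := ω) (f := fun g h : G => g * h * g⁻¹)
    (x₀ := g) (y₀ := 1) (h1 (g, 1)) (by simp) (fun x => by simp)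

section Ad

variable [T2Space G] [CompleteSpace E]

theorem lieExp_adc (g : G) (v : E) :
    lieExp (E := E) (G := G) (adc g v : E) = g * lieExp (E := E) (G := G) v * g⁻¹ := by
  have h := (hasVel_lieExp (G := G) v).conj g
  rw [lieExp_eq_of_isOneParameterSubgroup (fun s t => ?_) h, one_smul]
  rw [lieExp_add_smul]; group

end Ad

end FlagCR

/-! ### The derivative of the adjoint representation is the bracket. -/

namespace FlagCR

variable {E : Type*} [NormedAddCommGroup E] [NormedSpace ℂ E] [CompleteSpace E]
  {G : Type*} [TopologicalSpace G] [ChartedSpace E G] [Group G] [LieGroup 𝓘(ℂ, E) ω G]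
  {E' : Type*} [NormedAddCommGroup E'] [NormedSpace ℝ E'] {F F₁ F₂ : G → E'} {g : G} {v w : E}

theorem contMDiffAt_chart_symm {z : E} (hz : z ∈ (extChartAt 𝓘(ℂ, E) (1 : G)).target) :
    ContMDiffAt 𝓘(ℝ, E) 𝓘(ℝ, E) ∞ (extChartAt 𝓘(ℂ, E) (1 : G)).symm z :=
  (((contMDiffOn_extChartAt_symm (I := 𝓘(ℂ, E)) (n := ω) (1 : G)) _ hz).contMDiffAt
      ((isOpen_extChartAt_target (I := 𝓘(ℂ, E)) (1 : G)).mem_nhds hz)).restrictScalarsReal.of_le le_top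

theorem exists_rightInverse_chart_symm {A : E →L[ℝ] E}
    (hA : HasD (extChartAt 𝓘(ℂ, E) (1 : G)).symm (extChartAt 𝓘(ℂ, E) (1 : G) 1) A) :
    ∃ B : E →L[ℝ] E, HasD (extChartAt 𝓘(ℂ, E) (1 : G)) 1 B ∧ A ∘L B = ContinuousLinearMap.id ℝ E := by
  have h1 : MDifferentiableAt 𝓘(ℂ, E) 𝓘(ℂ, E) (extChartAt 𝓘(ℂ, E) (1 : G)) 1 :=
    mdifferentiableAt_extChartAt (mem_chart_source E (1 : G))
  refine ⟨_, h1.hasMFDerivAt.restrictScalarsReal, ?_⟩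
  have h2 := hA.comp h1.hasMFDerivAt.restrictScalarsReal rfl
  refine h2.unique (hasD_id.congr ?_)
  filter_upwards [extChartAt_source_mem_nhds (I := 𝓘(ℂ, E)) (1 : G)] with x hx
  exact (extChartAt 𝓘(ℂ, E) (1 : G)).left_inv hx

/-- Both sides are mixed second derivatives at (1, 1) of (h, a) ↦ F(ha), taken in the two possible
orders. -/
theorem LD_mul_right_comm (hF : ContMDiff 𝓘(ℝ, E) 𝓘(ℝ, E') ∞ F) (v w : E) :
    LD v (fun a : G => LD w (fun h : G => F (h * a)) 1) 1 = LD w (LD v F) 1 := by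
  set φ := extChartAt 𝓘(ℂ, E) (1 : G) with hφ
  set z := φ 1 with hzdef
  have hz : z ∈ φ.target := mem_extChartAt_target (I := 𝓘(ℂ, E)) (1 : G)
  have h0 : φ.symm z = 1 := extChartAt_to_inv (I := 𝓘(ℂ, E)) (1 : G)
  have htop : φ.target ∈ nhds z := (isOpen_extChartAt_target (I := 𝓘(ℂ, E)) (1 : G)).mem_nhds hz
  set q : E × E → E' := fun p => F (φ.symm p.1 * φ.symm p.2) with hq
  have hqs : ∀ p : E × E, p.1 ∈ φ.target → p.2 ∈ φ.target → ContDiffAt ℝ ∞ q p := by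
    intro p h1 h2
    rw [← contMDiffAt_iff_contDiffAt]
    refine (hF _).comp p (ContMDiffAt.mul ?_ ?_)
    · exact (contMDiffAt_chart_symm h1).comp p (contMDiffAt_iff_contDiffAt.2 contDiffAt_fst)
    · exact (contMDiffAt_chart_symm h2).comp p (contMDiffAt_iff_contDiffAt.2 contDiffAt_snd)
  have hqd : ∀ p : E × E, p.1 ∈ φ.target → p.2 ∈ φ.target → HasFDerivAt q (fderiv ℝ q p) p :=
    fun p h1 h2 => ((hqs p h1 h2).differentiableAt (by simp)).hasFDerivAt
  have hq2 : HasFDerivAt (fderiv ℝ q) (fderiv ℝ (fderiv ℝ q) (z, z)) (z, z) :=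
    (((hqs (z, z) hz hz).fderiv_right (m := 1) two_le_infty).differentiableAt (by simp)).hasFDerivAt
  have hsymm : IsSymmSndFDerivAt ℝ q (z, z) :=
    (hqs (z, z) hz hz).isSymmSndFDerivAt (by simpa [one_add_one_eq_two] using two_le_infty)
  obtain ⟨A, hA, -⟩ := exists_hasD_chart_symm hz
  obtain ⟨B, hB, hAB⟩ := exists_rightInverse_chart_symm hA
  have hAB' : ∀ x, A (B x) = x := fun x => congrArg (fun C : E →L[ℝ] E => C x) hAB
  -- a directional derivative of a function at `1`, computed in the chart
  have key : ∀ (Φ : G → E') (Ψ : E → E') (v : E) (Ψ' : E →L[ℝ] E'), MDifferentiableAt 𝓘(ℝ, E) 𝓘(ℝ, E') Φ 1 →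
      (Ψ =ᶠ[nhds z] fun y => Φ (φ.symm y)) → HasFDerivAt Ψ Ψ' z → LD v Φ 1 = Ψ' (B v) := by
    intro Φ Ψ v Ψ' hΦ hΨ hΨ'
    obtain ⟨Φ', hΦ'⟩ := hΦ.exists_hasD
    have h1 := hasD_iff_hasFDerivAt.1 ((HasD.comp hΦ' hA h0))
    have h2 := (hΨ'.congr_of_eventuallyEq hΨ.symm).unique h1
    rw [LD_eq hΦ', lmap_one, h2, ContinuousLinearMap.comp_apply, hAB']
    rfl
  have hFm : ContMDiff (𝓘(ℝ, E).prod 𝓘(ℝ, E)) 𝓘(ℝ, E') ∞ (fun p : G × G => F (p.1 * p.2)) :=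
    hF.comp (contMDiff_mul 𝓘(ℝ, E) ∞)
  have hL : ∀ a y, y ∈ φ.target → φ.symm y = a → LD w (fun h : G => F (h * a)) 1 = fderiv ℝ q (z, y) (B w, 0) := by
    intro a y hy hya
    refine (key (fun h : G => F (h * a)) (fun b => q (b, y)) w
      ((fderiv ℝ q (z, y)) ∘L ContinuousLinearMap.inl ℝ E E) ?_ ?_ ?_).trans rfl
    · exact (hF.comp (contMDiff_mul_right (a := a))).mdifferentiable (by simp) _
    · exact Filter.Eventually.of_forall fun b => by simp [hq, hya]
    · exact HasFDerivAt.comp (f := fun e : E => (e, y)) z (hqd (z, y) hz hy) (hasFDerivAt_prodMk_left z y)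
  have hR : ∀ y, y ∈ φ.target → LD v F (φ.symm y) = fderiv ℝ q (y, z) (0, B v) := by
    intro y hy
    have e : LD v F (φ.symm y) = LD v (fun h => F (φ.symm y * h)) 1 := by
      rw [LD_mul_left, mul_one]
    rw [e]
    refine (key (fun h : G => F (φ.symm y * h)) (fun b => q (y, b)) v
      ((fderiv ℝ q (y, z)) ∘L ContinuousLinearMap.inr ℝ E E) ?_ ?_ ?_).trans rfl
    · exact (hF.comp (contMDiff_mul_left (a := φ.symm y))).mdifferentiable (by simp) _
    · exact Filter.Eventually.of_forall fun b => by simp [hq]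
    · exact (hqd (y, z) hy hz).comp z (hasFDerivAt_prodMk_right y z)
  have h1 : LD v (fun a : G => LD w (fun h : G => F (h * a)) 1) 1 =
      fderiv ℝ (fderiv ℝ q) (z, z) (0, B v) (B w, 0) := by
    refine (key _ (fun y => fderiv ℝ q (z, y) (B w, 0)) v
      (((ContinuousLinearMap.apply ℝ E' (B w, (0 : E))) ∘L fderiv ℝ (fderiv ℝ q) (z, z)) ∘L
        ContinuousLinearMap.inr ℝ E E) ?_ ?_ ?_).trans rfl
    · have h2 : ContMDiffAt 𝓘(ℝ, E) 𝓘(ℝ, E →L[ℝ] E') ∞ (fun a : G => (mfd ℝ (fun h : G => F (1 * h * a)) 1 : E →L[ℝ] E')) 1 := by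
        refine contMDiffAt_mfderiv_param (m := ∞) (n := ∞) (f := fun a h : G => F (1 * h * a)) ?_ (by simp) (fun x => rfl)
        simp only [one_mul]
        exact (hF.comp ((contMDiff_snd).mul contMDiff_fst)) _
      exact (((ContinuousLinearMap.apply ℝ E' w).contMDiff (n := ∞)).contMDiffAt.comp _ h2).mdifferentiableAt (by simp)
    · filter_upwards [htop] with y hy using (hL _ y hy rfl).symm
    · exact (((ContinuousLinearMap.apply ℝ E' (B w, (0 : E))).hasFDerivAt.comp (z, z) hq2).comp z
        (hasFDerivAt_prodMk_right z z))
  have h2 : LD w (LD v F) 1 = fderiv ℝ (fderiv ℝ q) (z, z) (B w, 0) (0, B v) := by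
    refine (key _ (fun y => fderiv ℝ q (y, z) (0, B v)) w
      (((ContinuousLinearMap.apply ℝ E' ((0 : E), B v)) ∘L fderiv ℝ (fderiv ℝ q) (z, z)) ∘L
        ContinuousLinearMap.inl ℝ E E) ?_ ?_ ?_).trans rfl
    · exact (contMDiff_LD hF v).mdifferentiable (by simp) _
    · filter_upwards [htop] with y hy using (hR y hy).symm
    · exact HasFDerivAt.comp (f := fun e : E => (e, z)) z
        ((ContinuousLinearMap.apply ℝ E' ((0 : E), B v)).hasFDerivAt.comp (z, z) hq2)
        (hasFDerivAt_prodMk_left z z)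
  rw [h1, h2, hsymm.eq]

/-- A bump function times the chart at 1. Its use is to reduce statements about tangent vectors and
curves at 1 to a globally smooth function with values in a vector space. -/
theorem exists_contMDiff_injective [FiniteDimensional ℂ E] [T2Space G] :
    ∃ F : G → E, ContMDiff 𝓘(ℝ, E) 𝓘(ℝ, E) ∞ F ∧ F =ᶠ[nhds 1] extChartAt 𝓘(ℂ, E) (1 : G) ∧
      ∃ F' : E →L[ℝ] E, HasD F 1 F' ∧ Function.Injective F' := by
  have hz := mem_extChartAt_target (I := 𝓘(ℂ, E)) (1 : G)
  obtain ⟨A, hA, -⟩ := exists_hasD_chart_symm hz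
  obtain ⟨B, hB, hAB⟩ := exists_rightInverse_chart_symm hA
  have : FiniteDimensional ℝ E := FiniteDimensional.complexToReal E
  obtain ⟨f⟩ : Nonempty (SmoothBumpFunction 𝓘(ℝ, E) (1 : G)) := inferInstance
  have he : (fun x => f x • extChartAt 𝓘(ℂ, E) (1 : G) x) =ᶠ[nhds 1]
      extChartAt 𝓘(ℂ, E) (1 : G) := by
    filter_upwards [f.eventuallyEq_one] with x hx
    simp [hx]
  refine ⟨fun x => f x • extChartAt 𝓘(ℂ, E) (1 : G) x, ?_, he, B, hB.congr he, ?_⟩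
  · refine f.contMDiff_smul ?_
    intro x hx
    have h1 := (contMDiffOn_extChartAt (I := 𝓘(ℂ, E)) (n := ω) (x := (1 : G))) x hx
    have h2 := (h1.contMDiffAt ((chartAt E (1 : G)).open_source.mem_nhds hx)).restrictScalarsReal
    exact (h2.of_le le_top).contMDiffWithinAt
  · intro x y hxy
    have h := congrArg A hxy
    have e : ∀ x, A (B x) = x := fun x => congrArg (fun C : E →L[ℝ] E => C x) hAB
    rwa [e, e] at h

/-- Write F(ha) = F(a · a⁻¹ha) and use the chain rule for the conjugation by a⁻¹. -/
theorem LD_adc_inv (hF : ContMDiff 𝓘(ℝ, E) 𝓘(ℝ, E') ∞ F) (w : E) (a : G) :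
    LD w (fun h : G => F (h * a)) 1 = LD (adc a⁻¹ w) F a := by
  have h1 : HasD (fun h : G => F (a * h)) 1 (mfd ℝ (fun h : G => F (a * h)) 1 : E →L[ℝ] E') :=
    (((hF.comp (contMDiff_mul_left (a := a))).mdifferentiable (by simp) 1).hasMFDerivAt)
  have h2 := h1.comp (hasD_conj (E := E) a⁻¹) (by simp)
  have e : (fun h : G => F (a * (a⁻¹ * h * a⁻¹⁻¹))) = fun h => F (h * a) := by
    ext h; congr 1; group
  rw [e] at h2
  rw [LD_eq h2, lmap_one]
  rfl

theorem mdifferentiableAt_adc_apply (w : E) (g : G) :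
    MDifferentiableAt 𝓘(ℝ, E) 𝓘(ℝ, E) (fun g : G => adc g w) g := by
  have h1 := (contMDiff_adc (E := E) (G := G)).mdifferentiable (by simp) g
  exact (((ContinuousLinearMap.apply ℂ E w).contMDiff (n := ω)).mdifferentiable (by simp) _ |>.comp g h1).restrictScalarsReal

theorem adc_one : adc (E := E) (1 : G) = ContinuousLinearMap.id ℂ E := by
  have h : (fun h : G => (1 : G) * h * (1 : G)⁻¹) = id := by ext; simp
  have h2 : adc (E := E) (1 : G) = mfd ℂ (id : G → G) 1 := by rw [adc, h]
  rw [h2]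
  exact mfderiv_id (I := 𝓘(ℂ, E)) (x := (1 : G))

/-- Differentiate the identity of `LD_adc_inv` in a along exp(tv). The left side gives wvF, by
symmetry of mixed derivatives. The right side gives vwF − dF(ad'), where ad' is the derivative of
Ad(a)w along v. Hence dF(ad') = vwF − wvF = dF([v, w]), and F is chosen with injective differential
at 1. -/
theorem LD_adc_one [FiniteDimensional ℂ E] [T2Space G] (v w : E) :
    LD v (fun g : G => adc g w) 1 = gbr G v w := by
  obtain ⟨F, hF, -, F', hF', hinj⟩ := exists_contMDiff_injective (E := E) (G := G)
  have hc := hasVel_lieExp (G := G) v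
  set c : ℝ → G := fun t => lieExp (E := E) (G := G) (t • v : E) with hcdef
  have h1 : HasDerivAt (fun s => (mfd ℝ (fun h : G => F (c s * h)) 1 : E →L[ℝ] E))
      (LD v (fun a : G => (mfd ℝ (fun h : G => F (a * h)) 1 : E →L[ℝ] E)) 1) 0 := by
    have h2 : ContMDiffAt 𝓘(ℝ, E) 𝓘(ℝ, E →L[ℝ] E) ∞ (fun a : G => (mfd ℝ (fun h : G => F (a * h)) 1 : E →L[ℝ] E)) 1 :=
      contMDiffAt_mfderiv_param (m := ∞) (n := ∞) (f := fun a h : G => F (a * h))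
        ((hF.comp (contMDiff_mul 𝓘(ℝ, E) ∞)) _) (by simp) (fun x => rfl)
    simpa using hc.hasDerivAt 1 (h2.mdifferentiableAt (by simp))
  -- The inverse curve has velocity −v; this is the source of the minus sign in vwF − dF(ad').
  have h2 : HasDerivAt (fun s => adc (E := E) (c s)⁻¹ w) (LD (-v) (fun g : G => adc g w) 1) 0 := by
    simpa using hc.inv.hasDerivAt 1 (mdifferentiableAt_adc_apply (G := G) w 1)
  have h3 := h1.clm_apply h2
  have h4 : (fun s => (mfd ℝ (fun h : G => F (c s * h)) 1 : E →L[ℝ] E) (adc (E := E) (c s)⁻¹ w)) =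
      fun s => LD w (fun h : G => F (h * c s)) 1 :=
    funext fun s => (LD_adc_inv hF w (c s)).symm
  rw [h4] at h3
  have h5 : HasDerivAt (fun s => LD w (fun h : G => F (h * c s)) 1)
      (LD v (fun a : G => LD w (fun h : G => F (h * a)) 1) 1) 0 := by
    have h2 : ContMDiffAt 𝓘(ℝ, E) 𝓘(ℝ, E →L[ℝ] E) ∞ (fun a : G => (mfd ℝ (fun h : G => F (1 * h * a)) 1 : E →L[ℝ] E)) 1 := by
      refine contMDiffAt_mfderiv_param (m := ∞) (n := ∞) (f := fun a h : G => F (1 * h * a)) ?_ (by simp) (fun x => rfl)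
      simp only [one_mul]
      exact (hF.comp ((contMDiff_snd).mul contMDiff_fst)) _
    have h3 : MDifferentiableAt 𝓘(ℝ, E) 𝓘(ℝ, E) (fun a : G => LD w (fun h : G => F (h * a)) 1) 1 :=
      (((ContinuousLinearMap.apply ℝ E w).contMDiff (n := ∞)).contMDiffAt.comp _ h2).mdifferentiableAt
        (by simp)
    simpa only [one_mul] using hc.hasDerivAt 1 h3
  have h6 := h3.unique h5
  rw [LD_mul_right_comm hF] at h6
  have h7 : (LD v (fun a : G => (mfd ℝ (fun h : G => F (a * h)) 1 : E →L[ℝ] E)) 1) w = LD v (LD w F) 1 := by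
    have h2 : ContMDiffAt 𝓘(ℝ, E) 𝓘(ℝ, E →L[ℝ] E) ∞ (fun a : G => (mfd ℝ (fun h : G => F (a * h)) 1 : E →L[ℝ] E)) 1 :=
      contMDiffAt_mfderiv_param (m := ∞) (n := ∞) (f := fun a h : G => F (a * h))
        ((hF.comp (contMDiff_mul 𝓘(ℝ, E) ∞)) _) (by simp) (fun x => rfl)
    exact (LD_comp_clm (ContinuousLinearMap.apply ℝ E w) (h2.mdifferentiableAt (by simp))).symm
  have hadc : adc (E := E) (c 0)⁻¹ w = w := by rw [hc.1, inv_one, adc_one]; rfl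
  have h8 : LD (-v) (fun g : G => adc g w) 1 = - LD v (fun g : G => adc g w) 1 := by
    rw [← neg_one_smul ℝ v, LD_smul_left]; simp
  rw [hadc, h7, hc.1, h8, map_neg] at h6
  have h9 := LD_bracket hF v w 1
  have h10 : (mfd ℝ (fun h : G => F (1 * h)) 1 : E →L[ℝ] E) = F' := by
    simp only [one_mul]
    exact HasMFDerivAt.mfderiv hF'
  rw [LD_eq hF', lmap_one] at h9
  rw [h10] at h6
  apply hinj
  have h11 : F' (gbr G v w) = LD v (LD w F) 1 - LD w (LD v F) 1 := h9.symm
  rw [h11, ← h6]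
  abel

end FlagCR

/-! ### Linear differential equations and Ad(exp v) = exp(ad v). -/

namespace FlagCR

section LinearODE

variable {V : Type*} [NormedAddCommGroup V] [NormedSpace ℝ V] [FiniteDimensional ℝ V]

/-- The curve exp(−tT) y(t) has derivative zero. -/
theorem eq_exp_apply_of_hasDerivAt {T : V →L[ℝ] V} {y : ℝ → V}
    (h : ∀ t, HasDerivAt y (T (y t)) t) : y 1 = NormedSpace.exp T (y 0) := by
  have : CompleteSpace V := FiniteDimensional.complete ℝ V
  have h1 : ∀ t, HasDerivAt (fun t : ℝ => NormedSpace.exp (t • (-T)) (y t)) 0 t := by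
    intro t
    have h2 := (hasDerivAt_exp_smul_const (𝕂 := ℝ) (-T) t).clm_apply (h t)
    simpa using h2
  let _ : NormedAlgebra ℚ (V →L[ℝ] V) := NormedAlgebra.restrictScalars ℚ ℝ (V →L[ℝ] V)
  have h3 := is_const_of_deriv_eq_zero (fun t => (h1 t).differentiableAt)
    (fun t => (h1 t).deriv) 1 0
  simp only [one_smul, zero_smul, NormedSpace.exp_zero, one_apply_eq_self] at h3
  rw [← h3, ← mul_apply_eq_comp, ← NormedSpace.exp_add_of_commute (Commute.refl T).neg_right,
    add_neg_cancel, NormedSpace.exp_zero, one_apply_eq_self]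

/-- The difference is the series Σ_{n ≥ 1} Tⁿw/n!, and S is closed. Only T w needs to lie in S, not
w itself; this is what `killing_C_AdMap` exploits. -/
theorem exp_sub_mem {S : Submodule ℝ V} (T : V →L[ℝ] V) (hT : ∀ x ∈ S, T x ∈ S) {w : V}
    (hw : T w ∈ S) : NormedSpace.exp T w - w ∈ S := by
  have : CompleteSpace V := FiniteDimensional.complete ℝ V
  have h1 := NormedSpace.exp_series_hasSum_exp' (𝕂 := ℝ) T
  have h2 : HasSum (fun n : ℕ => (n.factorial⁻¹ : ℝ) • (T ^ n) w) (NormedSpace.exp T w) :=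
    by simpa using (ContinuousLinearMap.apply ℝ V w).hasSum h1
  have h3 := (hasSum_nat_add_iff' 1).2 h2
  simp only [Finset.sum_range_one, Nat.factorial_zero, Nat.cast_one, inv_one, one_smul, pow_zero] at h3
  have hp : ∀ n, (T ^ (n + 1)) w ∈ S := by
    intro n
    induction n with
    | zero => simpa using hw
    | succ n ih => rw [pow_succ']; exact hT _ ih
  refine S.closed_of_finiteDimensional.mem_of_tendsto h3 (Filter.Eventually.of_forall fun s => ?_)
  exact S.sum_mem fun i _ => S.smul_mem _ (hp i)

end LinearODE

variable {E : Type*} [NormedAddCommGroup E] [NormedSpace ℂ E] [CompleteSpace E]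
  [FiniteDimensional ℂ E]
  {G : Type*} [TopologicalSpace G] [ChartedSpace E G] [Group G] [LieGroup 𝓘(ℂ, E) ω G]
  [T2Space G]
  {E' : Type*} [NormedAddCommGroup E'] [NormedSpace ℝ E'] {g : G} {v w : E}

theorem adc_mul (a b : G) : adc (E := E) (a * b) = adc a ∘L adc b := by
  ext v
  exact congrArg (fun A => A v) (AdMap_mul (E := E) a b)

theorem adc_adc (a b : G) (v : E) : adc a (adc b v) = adc (a * b) v := by
  rw [adc_mul]; rfl

theorem HasVel.hasDerivAt_adc {c : ℝ → G} (hc : HasVel c v) (w : E) :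
    HasDerivAt (fun s => adc (c s) w) (gbr G v w) 0 := by
  simpa [LD_adc_one] using hc.hasDerivAt 1 (mdifferentiableAt_adc_apply (G := G) w 1)

/-- Compare the derivatives at 0 of Ad(g)Ad(c(s))w and Ad(g c(s) g⁻¹)Ad(g)w, where c(s) = exp(sv).
-/
theorem adc_gbr (g : G) (v w : E) : adc g (gbr G v w) = gbr G (adc g v) (adc g w) := by
  have hc := hasVel_lieExp (G := G) v
  have h1 := (hc.conj g).hasDerivAt_adc (adc g w)
  have h2 := ((adc (E := E) g).restrictScalars ℝ).hasFDerivAt.comp_hasDerivAt 0 (hc.hasDerivAt_adc w)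
  refine HasDerivAt.unique h2 (h1.congr_of_eventuallyEq (Filter.Eventually.of_forall fun s => ?_))
  change adc g (adc _ w) = adc _ (adc g w)
  simp [adc_adc]

theorem gbr_smul_left (r : ℝ) (v w : E) : gbr G (r • v) w = r • gbr G v w := by
  rw [← LD_adc_one, ← LD_adc_one, LD_smul_left]; rfl

theorem gbr_neg_swap (v w : E) : gbr G v w = - gbr G w v :=
  (lie_skew (show GroupLieAlgebra 𝓘(ℂ, E) G from v) (show GroupLieAlgebra 𝓘(ℂ, E) G from w)).symm

variable (G) in
/-- The bracket with `v` as a continuous real linear map. -/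
noncomputable def adv (v : E) : E →L[ℝ] E :=
  have : FiniteDimensional ℝ E := FiniteDimensional.complexToReal E
  LinearMap.toContinuousLinearMap (𝕜 := ℝ)
    { toFun := gbr G v
      map_add' := fun x y => by
        exact lie_add (show GroupLieAlgebra 𝓘(ℂ, E) G from v) (show GroupLieAlgebra 𝓘(ℂ, E) G from x)
          (show GroupLieAlgebra 𝓘(ℂ, E) G from y)
      map_smul' := fun r x => by
        rw [gbr_neg_swap, gbr_smul_left, gbr_neg_swap x v]; simp }

theorem adv_apply (v w : E) : adv G v w = gbr G v w := rfl

/-- The curve t ↦ Ad(exp(tv))w solves y' = [v, y], because Ad is multiplicative and its derivative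
at 1 is the bracket. -/
theorem adc_lieExp_apply (v w : E) : adc (lieExp (E := E) (G := G) v) w =
    NormedSpace.exp (adv G v) w := by
  have : FiniteDimensional ℝ E := FiniteDimensional.complexToReal E
  have key : ∀ t : ℝ, HasDerivAt (fun t : ℝ => adc (lieExp (E := E) (G := G) (t • v : E)) w)
      (adv G v (adc (lieExp (E := E) (G := G) (t • v : E)) w)) t := by
    intro t
    have h1 := (hasVel_lieExp (G := G) v).hasDerivAt_adc (adc (lieExp (E := E) (G := G) (t • v : E)) w)
    have h2 : HasDerivAt (fun s : ℝ => adc (lieExp (E := E) (G := G) ((s - t) • v : E))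
        (adc (lieExp (E := E) (G := G) (t • v : E)) w)) _ t :=
      HasDerivAt.comp_sub_const (f := fun s : ℝ => adc (lieExp (E := E) (G := G) (s • v : E))
        (adc (lieExp (E := E) (G := G) (t • v : E)) w)) t t (by simpa using h1)
    rw [adv_apply]
    simpa [adc_adc, ← lieExp_add_smul] using h2
  have := eq_exp_apply_of_hasDerivAt key
  simpa [lieExp_zero, adc_one] using this

theorem adc_lieExp_sub_mem {S : Submodule ℝ E} {v : E} (hT : ∀ x ∈ S, gbr G v x ∈ S) {w : E}
    (hw : gbr G v w ∈ S) : adc (lieExp (E := E) (G := G) v) w - w ∈ S := by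
  have : FiniteDimensional ℝ E := FiniteDimensional.complexToReal E
  rw [adc_lieExp_apply]
  exact exp_sub_mem (adv G v) hT hw

end FlagCR

namespace FlagCR

variable {E : Type*} [NormedAddCommGroup E] [NormedSpace ℂ E] [CompleteSpace E]
  [FiniteDimensional ℂ E]
  {G : Type*} [TopologicalSpace G] [ChartedSpace E G] [Group G] [LieGroup 𝓘(ℂ, E) ω G]
  [T2Space G]
  {E' : Type*} [NormedAddCommGroup E'] [NormedSpace ℝ E'] {g : G} {v w : E}

/-! ### Local factorization of curves -/

/-- In the chart at 1 the velocity of the curve is an invariant derivative evaluated along the curve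
itself, hence continuous. Class C¹ is enough for the inverse function theorem. -/
theorem contMDiffAt_lieExp_smul (v : E) :
    ContMDiffAt 𝓘(ℝ, ℝ) 𝓘(ℝ, E) 1 (fun t : ℝ => lieExp (E := E) (G := G) (t • v : E)) 0 := by
  obtain ⟨F, hF, he, -⟩ := exists_contMDiff_injective (E := E) (G := G)
  set γ : ℝ → G := fun t => lieExp (E := E) (G := G) (t • v : E) with hγ
  have hv : ∀ t, HasVelAt γ t v := (isOneParameterSubgroup_lieExp (G := G) v).hasVelAt
  have h0 : γ 0 = 1 := (hasVel_lieExp (G := G) v).1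
  have hc : Continuous γ := continuous_iff_continuousAt.2 fun t => HasD.continuousAt (hv t)
  have h1 : ∀ t, HasDerivAt (fun t => F (γ t)) (LD v F (γ t)) t := fun t =>
    (hv t).hasDerivAt (hF.mdifferentiable (by simp) _)
  have h2 : ContDiff ℝ 1 (fun t => F (γ t)) := by
    rw [contDiff_one_iff_deriv]
    refine ⟨fun t => (h1 t).differentiableAt, ?_⟩
    rw [show deriv (fun t => F (γ t)) = fun t => LD v F (γ t) from funext fun t => (h1 t).deriv]
    exact (contMDiff_LD hF v).continuous.comp hc
  rw [contMDiffAt_iff]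
  refine ⟨hc.continuousAt, ?_⟩
  rw [h0]
  refine (h2.contDiffAt.congr_of_eventuallyEq ?_).contDiffWithinAt
  have h3 : Filter.Tendsto γ (nhds 0) (nhds 1) := h0 ▸ hc.continuousAt
  filter_upwards [h3.eventually he] with t ht using ht.symm

theorem HasD.mul_of_eq_one {V : Type*} [NormedAddCommGroup V] [NormedSpace ℝ V] {a b : V → G} {x : V}
    {a' b' : V →L[ℝ] E} (ha : HasD a x a') (hb : HasD b x b') (ha1 : a x = 1) (hb1 : b x = 1) :
    HasD (fun s => a s * b s) x (a' + b') := by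
  have hm : MDifferentiableAt (𝓘(ℝ, E).prod 𝓘(ℝ, E)) 𝓘(ℝ, E) (fun p : G × G => p.1 * p.2) (a x, b x) :=
    (contMDiff_mul 𝓘(ℝ, E) ω).mdifferentiable (by simp) _
  have h := HasMFDerivAt.comp x hm.hasMFDerivAt (HasMFDerivAt.prodMk ha hb)
  have h' : HasD (fun s => a s * b s) x _ := h
  refine h'.congr_deriv (ContinuousLinearMap.ext fun (r : V) => ?_)
  refine (mfderiv_prod_eq_add_apply hm).trans ?_
  have e1 : HasD (fun z : G => z * b x) (a x) (ContinuousLinearMap.id ℝ E) := by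
    simpa [hb1] using hasD_id (x := a x)
  have e2 : HasD (fun z : G => a x * z) (b x) (ContinuousLinearMap.id ℝ E) := by
    simpa [ha1] using hasD_id (x := b x)
  exact congrArg₂ (fun (A B : E →L[ℝ] E) => A (a' r) + B (b' r)) (HasMFDerivAt.mfderiv e1)
    (HasMFDerivAt.mfderiv e2)

variable (G) in
/-- The product of the exponentials of the multiples of the vectors of a family. -/
noncomputable def expProd : {k : ℕ} → (Fin k → E) → (Fin k → ℝ) → G
  | 0, _, _ => 1
  | _ + 1, w, x => lieExp (E := E) (G := G) (x 0 • w 0 : E) * expProd (Fin.tail w) (Fin.tail x)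

theorem expProd_mem {k : ℕ} (w : Fin k → E) (x : Fin k → ℝ) (S : Submodule ℝ E) (H : Subgroup G)
    (hS : ∀ v ∈ S, lieExp (E := E) (G := G) v ∈ H) (hw : ∀ i, w i ∈ S) : expProd G w x ∈ H := by
  induction k with
  | zero => exact H.one_mem
  | succ k ih =>
    exact H.mul_mem (hS _ (S.smul_mem _ (hw 0))) (ih _ _ fun i => hw i.succ)

theorem expProd_zero {k : ℕ} (w : Fin k → E) : expProd G w 0 = 1 := by
  induction k with
  | zero => rfl
  | succ k ih =>
    have : Fin.tail (0 : Fin (k + 1) → ℝ) = 0 := rfl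
    simp [expProd, this, ih, lieExp_zero]

theorem contMDiffAt_expProd {k : ℕ} (w : Fin k → E) :
    ContMDiffAt 𝓘(ℝ, Fin k → ℝ) 𝓘(ℝ, E) 1 (expProd G w) 0 := by
  induction k with
  | zero => exact contMDiffAt_const
  | succ k ih =>
    let p : (Fin (k + 1) → ℝ) →L[ℝ] (Fin k → ℝ) := ContinuousLinearMap.pi fun i => ContinuousLinearMap.proj i.succ
    have h1 := (contMDiffAt_lieExp_smul (G := G) (w 0)).comp_of_eq (x := (0 : Fin (k + 1) → ℝ))
      ((ContinuousLinearMap.proj (R := ℝ) (φ := fun _ : Fin (k + 1) => ℝ) 0).contMDiff.contMDiffAt) (by simp)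
    have h2 := (ih (Fin.tail w)).comp_of_eq (x := (0 : Fin (k + 1) → ℝ)) (p.contMDiff.contMDiffAt) (by simp)
    exact h1.mul h2

theorem hasD_expProd {k : ℕ} (w : Fin k → E) :
    HasD (expProd G w) 0 (∑ i, (ContinuousLinearMap.proj i : (Fin k → ℝ) →L[ℝ] ℝ).smulRight (w i)) := by
  induction k with
  | zero => exact (hasD_const (x := (0 : Fin 0 → ℝ)) (1 : G)).congr_deriv (by simp)
  | succ k ih =>
    let p : (Fin (k + 1) → ℝ) →L[ℝ] (Fin k → ℝ) := ContinuousLinearMap.pi fun i => ContinuousLinearMap.proj i.succ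
    have hv := (hasVel_lieExp (G := G) (w 0))
    have h1 := HasD.comp hv.2 (hasD_iff_hasFDerivAt.2
      ((ContinuousLinearMap.proj (R := ℝ) (φ := fun _ : Fin (k + 1) => ℝ) 0).hasFDerivAt (x := 0)))
      (by simp)
    have h2 := HasD.comp (ih (Fin.tail w)) (hasD_iff_hasFDerivAt.2 (p.hasFDerivAt (x := 0))) (by simp)
    have h3 := h1.mul_of_eq_one h2 (by simp [lieExp_zero]) (by simp [expProd_zero])
    refine HasD.congr_deriv h3 ?_
    rw [hv.1, lmap_one, Fin.sum_univ_succ]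
    ext x
    simp [p, Fin.tail]

/-- Inverse function theorem for the map that multiplies exponentials of a basis of S₁ with
exponentials of a basis of a complement of S₁ inside S₂. The factors lie in H₁ and H₂ by
construction, so these subgroups need no manifold structure. Since ε has velocity 0, its coordinates
have derivative 0, and so do both factors. -/
theorem exists_factorization {S₁ S₂ : Submodule ℝ E} (hS : S₁ ⊔ S₂ = ⊤) {H₁ H₂ : Subgroup G}
    (h₁ : ∀ v ∈ S₁, lieExp (E := E) (G := G) v ∈ H₁)
    (h₂ : ∀ v ∈ S₂, lieExp (E := E) (G := G) v ∈ H₂) {ε : ℝ → G} (hε : HasVel ε (0 : E)) :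
    ∃ a : ℝ → H₁, ∃ b : ℝ → H₂, HasVel (fun t => (a t : G)) (0 : E) ∧
      HasVel (fun t => (b t : G)) (0 : E) ∧ ∀ᶠ t in nhds 0, ε t = a t * b t := by
  have : FiniteDimensional ℝ E := FiniteDimensional.complexToReal E
  obtain ⟨F, hF, he, F', hF', hinj⟩ := exists_contMDiff_injective (E := E) (G := G)
  -- S₁ and S₂ may intersect, so S₂ is first cut down to a complement of S₁.
  obtain ⟨S₃, hS₃, hcompl⟩ : ∃ S₃ ≤ S₂, IsCompl S₁ S₃ := by
    obtain ⟨T, hT⟩ := (S₁.submoduleOf S₂).exists_isCompl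
    refine ⟨T.map S₂.subtype, S₂.map_subtype_le T, ?_, ?_⟩
    · rw [disjoint_iff, eq_bot_iff]
      rintro x ⟨hx1, y, hy, rfl⟩
      have : y ∈ S₁.submoduleOf S₂ ⊓ T := ⟨hx1, hy⟩
      rw [hT.inf_eq_bot] at this
      simpa using this
    · rw [codisjoint_iff, eq_top_iff, ← hS]
      refine sup_le le_sup_left fun x hx => ?_
      have : (⟨x, hx⟩ : S₂) ∈ S₁.submoduleOf S₂ ⊔ T := by rw [hT.sup_eq_top]; trivial
      obtain ⟨y, hy, z, hz, hyz⟩ := Submodule.mem_sup.1 this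
      refine Submodule.mem_sup.2 ⟨y, hy, z, ⟨z, hz, rfl⟩, congrArg Subtype.val hyz⟩
  let b₁ := Module.finBasis ℝ S₁
  let b₃ := Module.finBasis ℝ S₃
  let w₁ : Fin _ → E := fun i => (b₁ i : E)
  let w₃ : Fin _ → E := fun i => (b₃ i : E)
  let Ψ : (Fin (Module.finrank ℝ S₁) → ℝ) × (Fin (Module.finrank ℝ S₃) → ℝ) → G :=
    fun x => expProd G w₁ x.1 * expProd G w₃ x.2
  let e : ((Fin (Module.finrank ℝ S₁) → ℝ) × (Fin (Module.finrank ℝ S₃) → ℝ)) ≃L[ℝ] E :=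
    ((b₁.equivFun.symm.prodCongr b₃.equivFun.symm).trans
      (Submodule.prodEquivOfIsCompl S₁ S₃ hcompl)).toContinuousLinearEquiv
  have hΨ : HasD Ψ 0 e.toContinuousLinearMap := by
    have h1 := HasD.comp (hasD_expProd (G := G) w₁) (hasD_iff_hasFDerivAt.2 (hasFDerivAt_fst (𝕜 := ℝ)
      (p := (0 : (Fin (Module.finrank ℝ S₁) → ℝ) × (Fin (Module.finrank ℝ S₃) → ℝ))))) rfl
    have h2 := HasD.comp (hasD_expProd (G := G) w₃) (hasD_iff_hasFDerivAt.2 (hasFDerivAt_snd (𝕜 := ℝ)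
      (p := (0 : (Fin (Module.finrank ℝ S₁) → ℝ) × (Fin (Module.finrank ℝ S₃) → ℝ))))) rfl
    refine (h1.mul_of_eq_one h2 (expProd_zero w₁) (expProd_zero w₃)).congr_deriv ?_
    refine ContinuousLinearMap.ext fun x => ?_
    simp [e, w₁, w₃, Module.Basis.equivFun_symm_apply]
  have hΨs : ContMDiffAt 𝓘(ℝ, (Fin (Module.finrank ℝ S₁) → ℝ) × (Fin (Module.finrank ℝ S₃) → ℝ)) 𝓘(ℝ, E) 1 Ψ 0 := by
    refine ContMDiffAt.mul ?_ ?_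
    · exact (contMDiffAt_expProd (G := G) w₁).comp_of_eq
        (contMDiffAt_iff_contDiffAt.2 contDiffAt_fst) rfl
    · exact (contMDiffAt_expProd (G := G) w₃).comp_of_eq
        (contMDiffAt_iff_contDiffAt.2 contDiffAt_snd) rfl
  have hΨ0 : Ψ 0 = 1 := by simp [Ψ, expProd_zero]
  -- An injective endomorphism in finite dimension is invertible, so F ∘ Ψ has an invertible
  -- differential at 0.
  let F'e : E ≃L[ℝ] E := (LinearEquiv.ofInjectiveEndo (F' : E →ₗ[ℝ] E) hinj).toContinuousLinearEquiv
  have hF'e : F'e.toContinuousLinearMap = F' := by ext; rfl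
  have hFΨ : ContDiffAt ℝ 1 (fun x => F (Ψ x)) 0 := by
    rw [← contMDiffAt_iff_contDiffAt]
    exact ((hF.of_le (by exact_mod_cast le_top)) (Ψ 0)).comp 0 hΨs
  have hFΨ' : HasFDerivAt (fun x => F (Ψ x)) (e.trans F'e).toContinuousLinearMap 0 := by
    have := hasD_iff_hasFDerivAt.1 (hF'.comp hΨ hΨ0)
    rw [← hF'e] at this
    exact this
  have hst := hFΨ.hasStrictFDerivAt' hFΨ' (by simp)
  have hF0 : F (Ψ 0) = F (ε 0) := by rw [hΨ0, hε.1]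
  -- The coordinates of ε(t): the local inverse of F ∘ Ψ applied to F(ε(t)).
  let s : ℝ → (Fin (Module.finrank ℝ S₁) → ℝ) × (Fin (Module.finrank ℝ S₃) → ℝ) := fun t => hst.localInverse _ _ _ (F (ε t))
  have hs0 : s 0 = 0 := by
    have := hst.localInverse_apply_image
    rwa [hF0] at this
  have hFε : HasDerivAt (fun t => F (ε t)) 0 0 := by
    have h1 := hε.hasDerivAt (F := F) 1 (hF.mdifferentiable (by simp) _)
    rw [LD_zero_left] at h1
    simpa using h1
  have hs : HasD s 0 (0 : ℝ →L[ℝ] (Fin (Module.finrank ℝ S₁) → ℝ) × (Fin (Module.finrank ℝ S₃) → ℝ)) := by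
    have h1 := hst.to_localInverse.hasFDerivAt
    rw [hF0] at h1
    have h2 := h1.comp (0 : ℝ) hFε.hasFDerivAt
    refine hasD_iff_hasFDerivAt.2 (h2.congr_fderiv ?_)
    ext <;> simp
  have hev : ∀ᶠ t in nhds 0, F (Ψ (s t)) = F (ε t) := by
    have h1 := hst.eventually_right_inverse
    rw [hF0] at h1
    exact hFε.continuousAt.eventually h1
  have hεc : Filter.Tendsto ε (nhds 0) (nhds 1) := by
    have := HasD.continuousAt hε.2
    rwa [ContinuousAt, hε.1] at this
  have hΨc : Filter.Tendsto (fun t => Ψ (s t)) (nhds 0) (nhds 1) := by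
    have h1 := (HasD.continuousAt hΨ).comp_of_eq (HasD.continuousAt hs) hs0
    have h2 : Ψ (s 0) = 1 := by rw [hs0, hΨ0]
    have h3 : Filter.Tendsto (Ψ ∘ s) (nhds 0) (nhds (Ψ (s 0))) := h1
    rwa [h2] at h3
  have hsrc := extChartAt_source_mem_nhds (I := 𝓘(ℂ, E)) (1 : G)
  refine ⟨fun t => ⟨expProd G w₁ (s t).1, expProd_mem _ _ S₁ H₁ h₁ fun i => (b₁ i).2⟩,
    fun t => ⟨expProd G w₃ (s t).2, expProd_mem _ _ S₂ H₂ h₂ fun i => hS₃ (b₃ i).2⟩, ?_, ?_, ?_⟩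
  · refine ⟨by simp [hs0, expProd_zero], ?_⟩
    have h1 := HasD.comp (hasD_expProd (G := G) w₁) (HasD.comp (hasD_iff_hasFDerivAt.2 (hasFDerivAt_fst (𝕜 := ℝ)
      (p := (0 : (Fin (Module.finrank ℝ S₁) → ℝ) × (Fin (Module.finrank ℝ S₃) → ℝ))))) hs hs0) (by simp [hs0])
    refine HasD.congr_deriv h1 ?_
    ext; simp
  · refine ⟨by simp [hs0, expProd_zero], ?_⟩
    have h1 := HasD.comp (hasD_expProd (G := G) w₃) (HasD.comp (hasD_iff_hasFDerivAt.2 (hasFDerivAt_snd (𝕜 := ℝ)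
      (p := (0 : (Fin (Module.finrank ℝ S₁) → ℝ) × (Fin (Module.finrank ℝ S₃) → ℝ))))) hs hs0) (by simp [hs0])
    refine HasD.congr_deriv h1 ?_
    ext; simp
  -- Near 1 the function F is the chart, and the chart is injective there, so F(Ψ(s t)) = F(ε t)
  -- implies Ψ(s t) = ε t.
  · filter_upwards [hev, hεc.eventually he, hΨc.eventually he, hεc.eventually hsrc,
      hΨc.eventually hsrc] with t h1 h2 h3 h4 h5
    rw [h2, h3] at h1
    exact ((extChartAt 𝓘(ℂ, E) (1 : G)).injOn h5 h4 h1).symm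

end FlagCR

namespace FlagCR

/-! ### Derivatives of curves in finite dimensional complex vector spaces -/

section HasCDeriv

variable {W W₁ W₂ : Type*} [AddCommGroup W] [Module ℂ W] [FiniteDimensional ℂ W]
  [AddCommGroup W₁] [Module ℂ W₁] [FiniteDimensional ℂ W₁]
  [AddCommGroup W₂] [Module ℂ W₂] [FiniteDimensional ℂ W₂]

/-- The curve `c` in `W` has derivative `w` at `0`, tested against linear forms. -/
def HasCDeriv (c : ℝ → W) (w : W) : Prop :=
  ∀ l : Module.Dual ℂ W, HasDerivAt (fun t => l (c t)) (l w) 0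

theorem ext_dual {w w' : W} (h : ∀ l : Module.Dual ℂ W, l w = l w') : w = w' := by
  rw [← sub_eq_zero, ← Module.forall_dual_apply_eq_zero_iff ℂ]
  intro l; rw [map_sub, h, sub_self]

variable {c : ℝ → W} {w w' : W}

theorem HasCDeriv.unique (h : HasCDeriv c w) (h' : HasCDeriv c w') : w = w' :=
  ext_dual fun l => (h l).unique (h' l)

theorem HasCDeriv.curveDeriv_eq (h : HasCDeriv c w) : curveDeriv c = w := by
  conv_rhs => rw [← (Module.finBasis ℂ W).sum_repr w]
  refine Finset.sum_congr rfl fun i _ => ?_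
  congr 1
  exact (h ((Module.finBasis ℂ W).coord i)).deriv

theorem HasCDeriv.congr {c' : ℝ → W} (h : HasCDeriv c w) (h' : c' =ᶠ[nhds 0] c) : HasCDeriv c' w :=
  fun l => (h l).congr_of_eventuallyEq (h'.fun_comp l)

theorem HasCDeriv.map (h : HasCDeriv c w) (A : W →ₗ[ℂ] W₁) : HasCDeriv (fun t => A (c t)) (A w) :=
  fun l => h (l ∘ₗ A)

theorem hasCDeriv_const (w : W) : HasCDeriv (fun _ => w) 0 := fun l => by
  simpa using hasDerivAt_const (0 : ℝ) (l w)

theorem HasCDeriv.add {c' : ℝ → W} (h : HasCDeriv c w) (h' : HasCDeriv c' w') :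
    HasCDeriv (fun t => c t + c' t) (w + w') := fun l => by
  simpa only [map_add] using (h l).fun_add (h' l)

theorem hasCDeriv_of_coord {ι : Type*} [Finite ι] (b : Module.Basis ι ℂ W)
    (h : ∀ i, HasDerivAt (fun t => b.coord i (c t)) (b.coord i w) 0) : HasCDeriv c w := by
  have := Fintype.ofFinite ι
  intro l
  have e : ∀ x, l x = ∑ i, b.coord i x * l (b i) := by
    intro x
    conv_lhs => rw [← b.sum_repr x]
    simp only [map_sum, map_smul, smul_eq_mul]
    rfl
  rw [e, funext fun t => e (c t)]
  exact HasDerivAt.fun_sum fun i _ => (h i).mul_const _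

theorem HasCDeriv.bilin {c₁ : ℝ → W₁} {w₁ : W₁} (h : HasCDeriv c w) (h₁ : HasCDeriv c₁ w₁)
    (B : W →ₗ[ℂ] W₁ →ₗ[ℂ] W₂) :
    HasCDeriv (fun t => B (c t) (c₁ t)) (B w (c₁ 0) + B (c 0) w₁) := by
  intro l
  let b := Module.finBasis ℂ W
  have e : ∀ x y, l (B x y) = ∑ i, b.coord i x * l (B (b i) y) := by
    intro x y
    conv_lhs => rw [← b.sum_repr x]
    simp only [map_sum, map_smul, smul_eq_mul, LinearMap.sum_apply, LinearMap.smul_apply]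
    rfl
  rw [map_add, e, e, funext fun t => e (c t) (c₁ t), ← Finset.sum_add_distrib]
  exact HasDerivAt.fun_sum fun i _ => (h (b.coord i)).mul (h₁ (l ∘ₗ B (b i)))

end HasCDeriv

variable {E : Type*} [NormedAddCommGroup E] [NormedSpace ℂ E] [CompleteSpace E]
  [FiniteDimensional ℂ E]
  {G : Type*} [TopologicalSpace G] [ChartedSpace E G] [Group G] [LieGroup 𝓘(ℂ, E) ω G]
  [T2Space G] {W W₁ : Type*} [AddCommGroup W] [Module ℂ W] [FiniteDimensional ℂ W]
  [AddCommGroup W₁] [Module ℂ W₁] [FiniteDimensional ℂ W₁]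
  {F F₁ : G → W} {g : G} {v w : GroupLieAlgebra 𝓘(ℂ, E) G}

variable (E) in
/-- `F` is smooth, tested against linear forms. -/
def VSmooth (F : G → W) : Prop :=
  ∀ l : Module.Dual ℂ W, ContMDiff 𝓘(ℝ, E) 𝓘(ℝ, ℂ) ∞ (fun g => l (F g))

theorem VSmooth.map (hF : VSmooth E F) (A : W →ₗ[ℂ] W₁) : VSmooth E (fun g => A (F g)) :=
  fun l => hF (l ∘ₗ A)

theorem VSmooth.add (hF : VSmooth E F) (hF₁ : VSmooth E F₁) : VSmooth E (F + F₁) := fun l => by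
  simp only [Pi.add_apply, map_add]
  exact (hF l).add (hF₁ l)

theorem vSmooth_zero : VSmooth E (0 : G → W) := fun l => by
  simpa using (contMDiff_const : ContMDiff 𝓘(ℝ, E) 𝓘(ℝ, ℂ) ∞ (fun _ : G => (0 : ℂ)))

theorem VSmooth.smul (hF : VSmooth E F) (a : ℂ) : VSmooth E (a • F) :=
  hF.map (a • LinearMap.id)

theorem vSmooth_sum {ι : Type*} (s : Finset ι) {F : ι → G → W} (hF : ∀ i ∈ s, VSmooth E (F i)) :
    VSmooth E (∑ i ∈ s, F i) :=
  Finset.sum_induction _ _ (fun _ _ => VSmooth.add) vSmooth_zero hF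

/-- The derivative depends on the curve only through its velocity. This allows the exponential curve
in `leftInvDeriv` to be replaced by any curve with the same velocity at 0. -/
theorem VSmooth.exists_hasCDeriv (hF : VSmooth E F) (v : E) (g : G) :
    ∃ w : W, (∀ l : Module.Dual ℂ W, l w = LD v (fun g => l (F g)) g) ∧
      ∀ c : ℝ → G, HasVel c v → HasCDeriv (fun t => F (g * c t)) w := by
  let b := Module.finBasis ℂ W
  have h0 : ∀ c : ℝ → G, HasVel c v → HasCDeriv (fun t => F (g * c t))
      (∑ i, LD v (fun g => b.coord i (F g)) g • b i) := by
    intro c hc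
    refine hasCDeriv_of_coord b fun i => ?_
    have := hc.hasDerivAt g ((hF (b.coord i)).mdifferentiable (by simp) g)
    have e : b.coord i (∑ i, LD v (fun g => b.coord i (F g)) g • b i) =
        LD v (fun g => b.coord i (F g)) g :=
      congrFun (b.repr_sum_self fun i => LD v (fun g => b.coord i (F g)) g) i
    rwa [e]
  refine ⟨_, fun l => ?_, h0⟩
  have hc := hasVel_lieExp (G := G) v
  exact (h0 _ hc l).unique (hc.hasDerivAt g ((hF l).mdifferentiable (by simp) g))

theorem VSmooth.hasCDeriv (hF : VSmooth E F) {c : ℝ → G} (hc : HasVel (E := E) c v) (g : G) :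
    HasCDeriv (fun t => F (g * c t)) (leftInvDeriv v F g) := by
  obtain ⟨w, -, h⟩ := hF.exists_hasCDeriv v g
  have h1 := (h _ (hasVel_lieExp (E := E) v)).curveDeriv_eq
  have h2 : leftInvDeriv v F g = w := by
    rw [leftInvDeriv, ← h1]
    congr 1
  rw [h2]
  exact h c hc

theorem VSmooth.apply_leftInvDeriv (hF : VSmooth E F) (l : Module.Dual ℂ W) (v) (g : G) :
    l (leftInvDeriv v F g) = LD (E := E) v (fun g => l (F g)) g := by
  obtain ⟨w, h, h'⟩ := hF.exists_hasCDeriv v g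
  rw [← h, (hF.hasCDeriv (hasVel_lieExp (E := E) v) g).unique (h' _ (hasVel_lieExp (E := E) v))]

theorem VSmooth.deriv (hF : VSmooth E F) (v : GroupLieAlgebra 𝓘(ℂ, E) G) :
    VSmooth E (leftInvDeriv v F) := fun l => by
  simp only [hF.apply_leftInvDeriv]
  exact contMDiff_LD (hF l) v

theorem VSmooth.deriv_add_left (hF : VSmooth E F) (v w : GroupLieAlgebra 𝓘(ℂ, E) G) :
    leftInvDeriv (v + w) F = leftInvDeriv v F + leftInvDeriv w F := by
  refine funext fun g => ext_dual fun l => ?_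
  rw [hF.apply_leftInvDeriv, Pi.add_apply, map_add, hF.apply_leftInvDeriv, hF.apply_leftInvDeriv]
  exact congrFun (LD_add_left (E := E) v w _) g

theorem VSmooth.deriv_smul_left (hF : VSmooth E F) (r : ℝ) (v : GroupLieAlgebra 𝓘(ℂ, E) G) :
    leftInvDeriv (r • v) F = (r : ℂ) • leftInvDeriv v F := by
  refine funext fun g => ext_dual fun l => ?_
  rw [hF.apply_leftInvDeriv, Pi.smul_apply, map_smul, hF.apply_leftInvDeriv]
  exact (congrFun (LD_smul_left (E := E) r v _) g).trans (Complex.real_smul)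

theorem VSmooth.deriv_map (hF : VSmooth E F) (v : GroupLieAlgebra 𝓘(ℂ, E) G)
    (A : W →ₗ[ℂ] W₁) (g : G) :
    leftInvDeriv v (fun g => A (F g)) g = A (leftInvDeriv v F g) := by
  exact ((hF.map A).hasCDeriv (hasVel_lieExp (E := E) v) g).unique ((hF.hasCDeriv (hasVel_lieExp (E := E) v) g).map A)

theorem VSmooth.deriv_add (hF : VSmooth E F) (hF₁ : VSmooth E F₁)
    (v : GroupLieAlgebra 𝓘(ℂ, E) G) :
    leftInvDeriv v (F + F₁) = leftInvDeriv v F + leftInvDeriv v F₁ := by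
  refine funext fun g => ?_
  have h1 := (hF.add hF₁).hasCDeriv (hasVel_lieExp (E := E) v) g
  have h2 := (hF.hasCDeriv (hasVel_lieExp (E := E) v) g).add
    (hF₁.hasCDeriv (hasVel_lieExp (E := E) v) g)
  exact h1.unique h2

theorem VSmooth.deriv_smul (hF : VSmooth E F) (a : ℂ) (v : GroupLieAlgebra 𝓘(ℂ, E) G) :
    leftInvDeriv v (a • F) = a • leftInvDeriv v F := by
  refine funext fun g => ?_
  have h := hF.deriv_map v (a • (LinearMap.id : W →ₗ[ℂ] W)) g
  simp only [LinearMap.smul_apply, LinearMap.id_apply] at h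
  exact h

theorem VSmooth.deriv_bracket (hF : VSmooth E F) (v w : GroupLieAlgebra 𝓘(ℂ, E) G) :
    leftInvDeriv v (leftInvDeriv w F) - leftInvDeriv w (leftInvDeriv v F)
      = leftInvDeriv ⁅v, w⁆ F := by
  refine funext fun g => ext_dual fun l => ?_
  rw [hF.apply_leftInvDeriv, Pi.sub_apply, map_sub, (hF.deriv w).apply_leftInvDeriv,
    (hF.deriv v).apply_leftInvDeriv]
  simp only [hF.apply_leftInvDeriv]
  exact LD_bracket (hF l) (E := E) v w g

end FlagCR

namespace FlagCR

/-! ### Roots and the Killing form -/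

namespace ParabolicData

open LieAlgebra LieAlgebra.IsKilling

variable {L : Type*} [LieRing L] [LieAlgebra ℂ L] [FiniteDimensional ℂ L]
  [LieAlgebra.IsKilling ℂ L] (D : ParabolicData L) {α β : Module.Dual ℂ D.t} {x y : L}

theorem finite_roots : D.roots.Finite := Set.finite_range _

noncomputable instance : Fintype D.roots := D.finite_roots.fintype

variable {D}

theorem neg_mem_roots (hα : α ∈ D.roots) : -α ∈ D.roots := by
  obtain ⟨i, rfl⟩ := hα
  exact ⟨⟨-i.1, by simpa using (LieSubalgebra.isNonZero_coe_root i)⟩, rfl⟩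

theorem ne_zero_of_mem_roots (hα : α ∈ D.roots) : α ≠ 0 := by
  obtain ⟨i, rfl⟩ := hα
  exact (rootSystem D.t).ne_zero i

theorem mem_roots_of_ne_zero (hα : α ≠ 0) (hx : x ∈ D.rootSubspace α) (hx0 : x ≠ 0) :
    α ∈ D.roots := by
  have h : LieModule.genWeightSpace L (α : D.t → ℂ) ≠ ⊥ := by
    intro h
    have hx' : x ∈ LieModule.genWeightSpace L (α : D.t → ℂ) := hx
    rw [h] at hx'
    exact hx0 hx'
  let χ : LieModule.Weight ℂ D.t L := ⟨α, h⟩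
  have hχ : χ.IsNonZero := fun h0 => hα (LinearMap.ext fun H => congrFun h0 H)
  exact ⟨⟨χ, by simpa using hχ⟩, LinearMap.ext fun H => rfl⟩

theorem lie_cartan (hx : x ∈ D.rootSubspace α) (H : D.t) : ⁅(H : L), x⁆ = α H • x :=
  lie_eq_smul_of_mem_rootSpace (α := α) hx H

theorem lie_mem_rootSubspace (hx : x ∈ D.rootSubspace α) (hy : y ∈ D.rootSubspace β) :
    ⁅x, y⁆ ∈ D.rootSubspace (α + β) := by
  have hy' : y ∈ LieModule.genWeightSpace L (β : D.t → ℂ) := hy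
  exact lie_mem_genWeightSpace_of_mem_genWeightSpace (χ₁ := α) hx hy'

theorem rootSubspace_zero : D.rootSubspace 0 = D.t.toSubmodule := by
  have := rootSpace_zero_eq ℂ L D.t
  exact congrArg LieSubmodule.toSubmodule this

theorem killing_eq_zero (hx : x ∈ D.rootSubspace α) (hy : y ∈ D.rootSubspace β)
    (h : α + β ≠ 0) : killingForm ℂ L x y = 0 := by
  refine killingForm_apply_eq_zero_of_mem_rootSpace_of_add_ne_zero ℂ L D.t (α := α) (β := β)
    hx hy fun h' => h (LinearMap.ext fun H => congrFun h' H)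

theorem killing_cartan_eq_zero (H : D.t) (hα : α ∈ D.roots) (hx : x ∈ D.rootSubspace α) :
    killingForm ℂ L (H : L) x = 0 :=
  killing_eq_zero (α := 0) (by rw [rootSubspace_zero]; exact H.2) hx
    (by rw [zero_add]; exact ne_zero_of_mem_roots hα)

theorem killing_comm (x y : L) : killingForm ℂ L x y = killingForm ℂ L y x :=
  LieModule.traceForm_comm ℂ L L x y

theorem killing_lie (x y z : L) : killingForm ℂ L ⁅x, y⁆ z = killingForm ℂ L x ⁅y, z⁆ :=
  LieModule.traceForm_apply_lie_apply ℂ L L x y z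

theorem killing_Hvec (α : Module.Dual ℂ D.t) (H : D.t) :
    killingForm ℂ L (D.Hvec α) (H : L) = α H := by
  have h : LieModule.traceForm ℂ D.t L ((cartanEquivDual D.t).symm α) H = α H :=
    congrArg (fun l : Module.Dual ℂ D.t => l H) ((cartanEquivDual D.t).apply_symm_apply α)
  rw [← restrict_killingForm] at h
  exact h

variable (D) in
/-- `H_α` as an element of `𝔱`. -/
noncomputable def hvec (α : Module.Dual ℂ D.t) : D.t := (cartanEquivDual D.t).symm α

theorem coe_hvec (α : Module.Dual ℂ D.t) : (D.hvec α : L) = D.Hvec α := rfl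

theorem killing_cartan (H H' : D.t) :
    killingForm ℂ L (H : L) (H' : L) = ∑ α : D.roots, α.1 H * α.1 H' := by
  have h := congrArg (fun B => B H H') (restrict_killingForm_eq_sum (K := ℂ) (H := D.t))
  change killingForm ℂ L (H : L) (H' : L) = _ at h
  rw [h, LinearMap.sum_apply, LinearMap.sum_apply, ← Finset.sum_coe_sort]
  let e : (LieSubalgebra.root (H := D.t)) ≃ D.roots :=
    Equiv.ofInjective _ (rootSystem D.t).root.injective
  exact Fintype.sum_equiv e _ _ fun i => by simp [e]; rfl

/-- Both sides have the same pairing with every H', because the Killing form on 𝔱 is Σ_α α(H)α(H').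
-/
theorem cartan_expansion (H : D.t) : H = ∑ α : D.roots, α.1 H • D.hvec α := by
  refine (cartanEquivDual D.t).injective (LinearMap.ext fun H' => ?_)
  have h : ∀ H, cartanEquivDual D.t H H' = killingForm ℂ L (H : L) (H' : L) := by
    intro H
    have := congrArg (fun B => B H H') (restrict_killingForm ℂ L D.t)
    exact this.symm
  rw [h, killing_cartan, map_sum, LinearMap.sum_apply]
  refine Finset.sum_congr rfl fun α _ => ?_
  rw [map_smul, LinearMap.smul_apply, h, coe_hvec, killing_Hvec, smul_eq_mul]

theorem coe_cartan_expansion (H : D.t) : (H : L) = ∑ α : D.roots, α.1 H • D.Hvec α.1 := by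
  have h := congrArg D.t.toSubmodule.subtype (cartan_expansion H)
  rw [map_sum] at h
  exact h

theorem apply_hvec_self_ne_zero (hα : α ∈ D.roots) : α (D.hvec α) ≠ 0 := by
  obtain ⟨i, rfl⟩ := hα
  exact root_apply_cartanEquivDual_symm_ne_zero (LieSubalgebra.isNonZero_coe_root i)

theorem exists_int_apply_hvec (hα : α ∈ D.roots) (hβ : β ∈ D.roots) :
    ∃ n : ℤ, 2 * β (D.hvec α) = n * α (D.hvec α) := by
  have h0 := apply_hvec_self_ne_zero hα
  obtain ⟨i, rfl⟩ := hα
  obtain ⟨j, rfl⟩ := hβ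
  obtain ⟨n, h⟩ : ∃ n : ℤ, (rootSystem D.t).root j (coroot i.1) = n :=
    ⟨_, apply_coroot_eq_cast i.1 j.1⟩
  rw [coroot, map_nsmul, map_smul] at h
  change 2 • ((rootSystem D.t).root i (D.hvec ((rootSystem D.t).root i)))⁻¹ •
    ((rootSystem D.t).root j (D.hvec ((rootSystem D.t).root i))) = _ at h
  refine ⟨n, ?_⟩
  rw [← h, nsmul_eq_mul, smul_eq_mul]
  field_simp
  push_cast
  ring

/-- Write 2γ(H_α) = n_γ α(H_α) with integers n_γ. The trace formula for α(H_α) = B(H_α, H_α) gives 4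
= (Σ_γ n_γ²) α(H_α), so α(H_α) and every β(H_α) are rational. -/
theorem apply_hvec_im (hα : α ∈ D.roots) (hβ : β ∈ D.roots) : (β (D.hvec α)).im = 0 := by
  have h0 := apply_hvec_self_ne_zero hα
  choose n hn using fun γ : D.roots => exists_int_apply_hvec hα γ.2
  have h1 : α (D.hvec α) = ∑ γ : D.roots, γ.1 (D.hvec α) * γ.1 (D.hvec α) := by
    rw [← killing_Hvec, ← coe_hvec, killing_cartan]
  have h2 : 4 * α (D.hvec α) =
      ((∑ γ : D.roots, n γ ^ 2 : ℤ) : ℂ) * α (D.hvec α) * α (D.hvec α) := by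
    conv_lhs => rw [h1]
    push_cast
    rw [Finset.mul_sum, Finset.sum_mul, Finset.sum_mul]
    refine Finset.sum_congr rfl fun γ _ => ?_
    linear_combination (2 * γ.1 (D.hvec α) + n γ * α (D.hvec α)) * hn γ
  have h3 : (4 : ℂ) = ((∑ γ : D.roots, n γ ^ 2 : ℤ) : ℂ) * α (D.hvec α) :=
    mul_right_cancel₀ h0 h2
  have h4 : (((∑ γ : D.roots, n γ ^ 2 : ℤ) : ℝ) : ℂ) ≠ 0 := fun h => by
    simp only [Complex.ofReal_intCast] at h
    rw [h, zero_mul] at h3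
    norm_num at h3
  have h5 : β (D.hvec α) =
      (((n ⟨β, hβ⟩ : ℝ) * 2 * ((∑ γ : D.roots, n γ ^ 2 : ℤ) : ℝ)⁻¹ : ℝ) : ℂ) := by
    have h6 := hn ⟨β, hβ⟩
    simp only at h6
    rw [Complex.ofReal_mul, Complex.ofReal_inv, eq_mul_inv_iff_mul_eq₀ h4]
    push_cast at h3 h6 ⊢
    linear_combination (∑ γ : D.roots, (n γ : ℂ) ^ 2) / 2 * h6 - (n ⟨β, hβ⟩ : ℂ) / 2 * h3
  rw [h5, Complex.ofReal_im]

/-! ### Normalized root vectors and the conjugation `θ` -/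

variable (X : D.RootVectors)

namespace RootVectors

theorem x_ne_zero (hα : α ∈ D.roots) : X.x α ≠ 0 := fun h => by
  have h1 := X.lie_neg α hα
  rw [h, zero_lie] at h1
  have h2 := killing_Hvec α (D.hvec α)
  rw [← h1, map_zero, LinearMap.zero_apply] at h2
  exact apply_hvec_self_ne_zero hα h2.symm

theorem mem_neg (hα : α ∈ D.roots) : X.x (-α) ∈ D.rootSubspace (-α) :=
  X.mem _ (neg_mem_roots hα)

theorem killing_neg (hα : α ∈ D.roots) : killingForm ℂ L (X.x α) (X.x (-α)) = 1 := by
  have h := killing_lie (D.hvec α : L) (X.x α) (X.x (-α))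
  rw [lie_cartan (X.mem α hα), X.lie_neg α hα, map_smul, LinearMap.smul_apply,
    smul_eq_mul] at h
  have h1 := killing_Hvec α (D.hvec α)
  rw [coe_hvec] at h h1
  rw [h1] at h
  exact mul_left_cancel₀ (apply_hvec_self_ne_zero hα) (h.trans (mul_one _).symm)

theorem killing_ne (hα : α ∈ D.roots) (hβ : β ∈ D.roots) (h : α ≠ β) :
    killingForm ℂ L (X.x α) (X.x (-β)) = 0 :=
  killing_eq_zero (X.mem α hα) (X.mem_neg hβ) fun h' => h (add_neg_eq_zero.mp h')

theorem rootSubspace_eq (hα : α ∈ D.roots) : D.rootSubspace α = ℂ ∙ X.x α := by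
  refine le_antisymm (fun x hx => ?_)
    ((Submodule.span_singleton_le_iff_mem _ _).mpr (X.mem α hα))
  have h1 : Module.finrank ℂ (D.rootSubspace α) = 1 := by
    obtain ⟨i, rfl⟩ := hα
    exact finrank_rootSpace_eq_one i.1 (LieSubalgebra.isNonZero_coe_root i)
  have h2 := (finrank_eq_one_iff_of_nonzero' (⟨X.x α, X.mem α hα⟩ : D.rootSubspace α)
    (fun h => X.x_ne_zero hα (congrArg Subtype.val h))).mp h1 ⟨x, hx⟩
  obtain ⟨c, hc⟩ := h2
  exact Submodule.mem_span_singleton.mpr ⟨c, congrArg Subtype.val hc⟩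

theorem eq_top_of_mem (S : Submodule ℂ L) (h : ∀ α ∈ D.roots, D.Hvec α ∈ S)
    (h' : ∀ α ∈ D.roots, X.x α ∈ S) : S = ⊤ := by
  have ht : D.t.toSubmodule ≤ S := fun H hH => by
    rw [show H = _ from coe_cartan_expansion (⟨H, hH⟩ : D.t)]
    exact S.sum_mem fun α _ => S.smul_mem _ (h _ α.2)
  have h1 := congrArg LieSubmodule.toSubmodule (LieModule.iSup_genWeightSpace_eq_top' ℂ D.t L)
  rw [LieSubmodule.iSup_toSubmodule] at h1
  rw [eq_top_iff, ← LieSubmodule.top_toSubmodule (R := ℂ) (L := D.t) (M := L), ← h1]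
  refine iSup_le fun χ => ?_
  by_cases hχ : χ.IsZero
  · have e : (LieModule.genWeightSpace L χ).toSubmodule = D.rootSubspace 0 := by
      rw [show (χ : D.t → ℂ) = 0 from hχ]; rfl
    rw [e, rootSubspace_zero]
    exact ht
  · have hr : LieModule.Weight.toLinear ℂ D.t L χ ∈ D.roots := ⟨⟨χ, by simpa using hχ⟩, rfl⟩
    have e : (LieModule.genWeightSpace L χ).toSubmodule =
      D.rootSubspace (LieModule.Weight.toLinear ℂ D.t L χ) := rfl
    rw [e, X.rootSubspace_eq hr]
    exact (Submodule.span_singleton_le_iff_mem _ _).mpr (h' _ hr)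

/-- A (semi)linear map is determined by its values on the `H_α` and `x_α`. -/
theorem ext_map {M : Type*} [AddCommGroup M] [Module ℂ M] {σ : ℂ →+* ℂ} {f g : L →ₛₗ[σ] M}
    (h : ∀ α ∈ D.roots, f (D.Hvec α) = g (D.Hvec α))
    (h' : ∀ α ∈ D.roots, f (X.x α) = g (X.x α)) : f = g := by
  have := X.eq_top_of_mem (LinearMap.eqLocus f g) h h'
  exact LinearMap.ext fun x => by
    have hx : x ∈ LinearMap.eqLocus f g := this ▸ Submodule.mem_top
    exact hx

theorem killing_Hvec_x (hα : α ∈ D.roots) : killingForm ℂ L (D.Hvec β) (X.x α) = 0 :=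
  killing_cartan_eq_zero (D.hvec β) hα (X.mem α hα)

/-- The functionals B(x_{−α}, ·) are dual to the root vectors and vanish on 𝔱; on 𝔱 the formula is
`coe_cartan_expansion`. The H_α need not be independent, and independence is not used. -/
theorem expansion (x : L) : x = ∑ α : D.roots, (killingForm ℂ L (D.Hvec α.1) x • D.Hvec α.1
    + killingForm ℂ L (X.x (-α.1)) x • X.x α.1) := by
  have h : (LinearMap.id : L →ₗ[ℂ] L) = ∑ α : D.roots,
      ((killingForm ℂ L (D.Hvec α.1)).smulRight (D.Hvec α.1)
        + (killingForm ℂ L (X.x (-α.1))).smulRight (X.x α.1)) := by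
    refine X.ext_map (fun β hβ => ?_) (fun β hβ => ?_)
    · rw [LinearMap.id_apply, LinearMap.sum_apply]
      conv_lhs => rw [← coe_hvec, coe_cartan_expansion (D.hvec β)]
      refine Finset.sum_congr rfl fun α _ => ?_
      simp only [LinearMap.add_apply, LinearMap.smulRight_apply]
      rw [← coe_hvec β, killing_Hvec, killing_comm (X.x _), coe_hvec,
        X.killing_Hvec_x (neg_mem_roots α.2), zero_smul, add_zero]
    · rw [LinearMap.id_apply, LinearMap.sum_apply, Finset.sum_eq_single ⟨β, hβ⟩]
      · simp only [LinearMap.add_apply, LinearMap.smulRight_apply]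
        rw [X.killing_Hvec_x hβ, killing_comm, X.killing_neg hβ, zero_smul, one_smul, zero_add]
      · intro α _ hα
        simp only [LinearMap.add_apply, LinearMap.smulRight_apply]
        rw [X.killing_Hvec_x hβ, killing_comm, X.killing_ne hβ α.2 fun h => hα (Subtype.ext h.symm),
          zero_smul, zero_smul, zero_add]
      · simp
  conv_lhs => rw [← LinearMap.id_apply (R := ℂ) x, h]
  simp

/-- Existence of θ, so that the choice in its definition is meaningful. -/
theorem θ_spec : ∀ α ∈ D.roots, X.θ (D.Hvec α) = -D.Hvec α ∧ X.θ (X.x α) = -X.y α := by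
  refine Classical.epsilon_spec (p := fun θ : L →ₛₗ[starRingEnd ℂ] L =>
    ∀ α ∈ D.roots, θ (D.Hvec α) = -D.Hvec α ∧ θ (X.x α) = -X.y α) ?_
  let conjForm (f : L →ₗ[ℂ] ℂ) (v : L) : L →ₛₗ[starRingEnd ℂ] L :=
    { toFun := fun x => starRingEnd ℂ (f x) • v
      map_add' := fun x y => by rw [map_add, map_add, add_smul]
      map_smul' := fun c x => by rw [map_smul, smul_eq_mul, map_mul, mul_smul] }
  have hc : ∀ f v x, conjForm f v x = starRingEnd ℂ (f x) • v := fun _ _ _ => rfl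
  -- The expansion of x with conjugated coefficients, x_α replaced by x_{−α}, and a sign. The value
  -- at H_β is right because the numbers β(H_α) are real.
  refine ⟨-∑ α : D.roots, (conjForm (killingForm ℂ L (D.Hvec α.1)) (D.Hvec α.1)
        + conjForm (killingForm ℂ L (X.x (-α.1))) (X.x (-α.1))), fun β hβ => ⟨?_, ?_⟩⟩
  · rw [LinearMap.neg_apply, LinearMap.sum_apply]
    conv_rhs => rw [X.expansion (D.Hvec β)]
    congr 1
    refine Finset.sum_congr rfl fun α _ => ?_
    rw [LinearMap.add_apply, hc, hc, ← coe_hvec β, killing_Hvec, killing_comm (X.x _), coe_hvec,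
      X.killing_Hvec_x (neg_mem_roots α.2), zero_smul, map_zero, zero_smul,
      Complex.conj_eq_iff_im.mpr (apply_hvec_im hβ α.2)]
  · rw [LinearMap.neg_apply, LinearMap.sum_apply, Finset.sum_eq_single ⟨β, hβ⟩]
    · rw [LinearMap.add_apply, hc, hc, X.killing_Hvec_x hβ, killing_comm, X.killing_neg hβ,
        map_zero, zero_smul, map_one, one_smul, zero_add]
      rfl
    · intro α _ hα
      rw [LinearMap.add_apply, hc, hc, X.killing_Hvec_x hβ, killing_comm,
        X.killing_ne hβ α.2 fun h => hα (Subtype.ext h.symm), map_zero, zero_smul, zero_smul,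
        zero_add]
    · simp

theorem θ_x (hα : α ∈ D.roots) : X.θ (X.x α) = -X.x (-α) := (X.θ_spec α hα).2

theorem θ_Hvec (hα : α ∈ D.roots) : X.θ (D.Hvec α) = -D.Hvec α := (X.θ_spec α hα).1

theorem θ_θ (x : L) : X.θ (X.θ x) = x := by
  have h : X.θ.comp X.θ = (LinearMap.id : L →ₗ[ℂ] L) := X.ext_map (fun α hα => by
      rw [LinearMap.comp_apply, X.θ_Hvec hα, map_neg, X.θ_Hvec hα, neg_neg]; rfl)
    (fun α hα => by
      rw [LinearMap.comp_apply, X.θ_x hα, map_neg, X.θ_x (neg_mem_roots hα), neg_neg, neg_neg]; rfl)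
  exact congrArg (fun f : L →ₗ[ℂ] L => f x) h

/-- By semilinearity in each argument it suffices to check the H_α and x_α. The case of two root
vectors uses that N_{α,β} is real with N_{−α,−β} = −N_{α,β}. -/
theorem θ_lie (x y : L) : X.θ ⁅x, y⁆ = ⁅X.θ x, X.θ y⁆ := by
  let l : L → L →ₛₗ[starRingEnd ℂ] L := fun x => X.θ.comp (LieAlgebra.ad ℂ L x : L →ₗ[ℂ] L)
  let r : L → L →ₛₗ[starRingEnd ℂ] L := fun x => (LieAlgebra.ad ℂ L (X.θ x) : L →ₗ[ℂ] L).comp X.θ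
  have key : ∀ x, (∀ α ∈ D.roots, X.θ ⁅x, D.Hvec α⁆ = ⁅X.θ x, X.θ (D.Hvec α)⁆) →
      (∀ α ∈ D.roots, X.θ ⁅x, X.x α⁆ = ⁅X.θ x, X.θ (X.x α)⁆) → ∀ y, X.θ ⁅x, y⁆ = ⁅X.θ x, X.θ y⁆ := by
    intro x h h' y
    have : l x = r x := X.ext_map h h'
    exact congrArg (fun f : L →ₛₗ[starRingEnd ℂ] L => f y) this
  have hHx : ∀ α ∈ D.roots, ∀ β ∈ D.roots,
      X.θ ⁅D.Hvec α, X.x β⁆ = ⁅X.θ (D.Hvec α), X.θ (X.x β)⁆ := by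
    intro α hα β hβ
    rw [← coe_hvec, lie_cartan (X.mem β hβ), coe_hvec, X.θ_Hvec hα, map_smulₛₗ, X.θ_x hβ, neg_lie,
      _root_.lie_neg, neg_neg, ← coe_hvec, lie_cartan (X.mem_neg hβ), LinearMap.neg_apply,
      Complex.conj_eq_iff_im.mpr (apply_hvec_im hα hβ), smul_neg, neg_smul]
  have hxH : ∀ α ∈ D.roots, ∀ β ∈ D.roots,
      X.θ ⁅X.x α, D.Hvec β⁆ = ⁅X.θ (X.x α), X.θ (D.Hvec β)⁆ := by
    intro α hα β hβ
    rw [← lie_skew, map_neg, hHx β hβ α hα, lie_skew]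
  have hHH : ∀ α ∈ D.roots, ∀ β ∈ D.roots,
      X.θ ⁅D.Hvec α, D.Hvec β⁆ = ⁅X.θ (D.Hvec α), X.θ (D.Hvec β)⁆ := by
    intro α hα β hβ
    have h0 : ⁅D.Hvec α, D.Hvec β⁆ = 0 := by
      have h1 : D.Hvec β ∈ D.rootSubspace 0 := by rw [rootSubspace_zero]; exact (D.hvec β).2
      rw [← coe_hvec α, lie_cartan h1, LinearMap.zero_apply, zero_smul]
    rw [h0, map_zero, X.θ_Hvec hα, X.θ_Hvec hβ, neg_lie, _root_.lie_neg, neg_neg, h0]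
  have hxx : ∀ α ∈ D.roots, ∀ β ∈ D.roots,
      X.θ ⁅X.x α, X.x β⁆ = ⁅X.θ (X.x α), X.θ (X.x β)⁆ := by
    intro α hα β hβ
    rw [X.θ_x hα, X.θ_x hβ, neg_lie, _root_.lie_neg, neg_neg]
    by_cases h0 : α + β = 0
    · obtain rfl : β = -α := (neg_eq_of_add_eq_zero_right h0).symm
      have h1 := X.lie_neg α hα
      rw [h1, X.θ_Hvec hα, neg_neg, ← lie_skew, h1]
    by_cases h1 : α + β ∈ D.roots
    · obtain ⟨N, h2, h3⟩ := X.lie_add α hα β hβ h1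
      rw [h2, h3, map_smulₛₗ, X.θ_x h1, Complex.conj_ofReal, smul_neg, neg_smul]
    · have h2 : ⁅X.x α, X.x β⁆ = 0 := by
        by_contra h
        exact h1 (mem_roots_of_ne_zero h0 (lie_mem_rootSubspace (X.mem α hα) (X.mem β hβ)) h)
      have h3 : ⁅X.x (-α), X.x (-β)⁆ = 0 := by
        by_contra h
        have h4 := mem_roots_of_ne_zero (fun h => h0 ?_)
          (lie_mem_rootSubspace (X.mem_neg hα) (X.mem_neg hβ)) h
        · have := neg_mem_roots h4
          rw [neg_add, neg_neg, neg_neg] at this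
          exact h1 this
        · rw [← neg_eq_zero, neg_add, h]
      rw [h2, h3, map_zero]
  refine key x (fun α hα => ?_) (fun α hα => ?_) y
  · rw [← lie_skew, map_neg, key (D.Hvec α) (hHH α hα) (hHx α hα), lie_skew]
  · rw [← lie_skew, map_neg, key (X.x α) (hxH α hα) (hxx α hα), lie_skew]

end RootVectors

end ParabolicData
end FlagCR

namespace FlagCR

/-! ### The grading by the values of the roots on `C` -/

namespace ParabolicData

open LieAlgebra LieAlgebra.IsKilling

variable {L : Type*} [LieRing L] [LieAlgebra ℂ L] [FiniteDimensional ℂ L]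
  [LieAlgebra.IsKilling ℂ L] {D : ParabolicData L} {α β γ : Module.Dual ℂ D.t} {x y : L}
  (X : D.RootVectors) {C : D.t}

theorem eq_zero_of_mem_span_simpleLevi (hC : C ∈ D.kahlerCone)
    (hα : α ∈ Submodule.span ℝ D.simpleLevi) : α C = 0 := by
  induction hα using Submodule.span_induction with
  | mem α h => exact hC.1 α h
  | zero => rfl
  | add α β _ _ h h' => rw [LinearMap.add_apply, h, h', add_zero]
  | smul r α _ h => rw [LinearMap.smul_apply, h, smul_zero]

/-- Each simple root takes a nonnegative real value on C, which is 0 only on Π. Consequently Re α(C)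
detects whether a root lies in Ξ₀, in Ξ₊ or in −Ξ₊, and 𝔭 and 𝔫⁺ become pieces of the grading by
this number. -/
theorem cone_of_mem_closure (hC : C ∈ D.kahlerCone)
    (hα : α ∈ AddSubmonoid.closure D.simpleRoots) :
    (α C).im = 0 ∧ 0 ≤ (α C).re ∧ ((α C).re = 0 → α ∈ Submodule.span ℝ D.simpleLevi) := by
  induction hα using AddSubmonoid.closure_induction with
  | mem α h =>
    by_cases h' : α ∈ D.simpleLevi
    · exact ⟨by simp [hC.1 α h'], by simp [hC.1 α h'], fun _ => Submodule.subset_span h'⟩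
    · have := hC.2 α ⟨h, h'⟩
      exact ⟨this.1, this.2.le, fun h0 => absurd h0 this.2.ne'⟩
  | zero => exact ⟨by simp, by simp, fun _ => zero_mem _⟩
  | add α β _ _ h h' =>
    simp only [LinearMap.add_apply, Complex.add_re, Complex.add_im]
    refine ⟨by rw [h.1, h'.1, add_zero], add_nonneg h.2.1 h'.2.1, fun h0 => ?_⟩
    have h1 := h.2.1
    have h2 := h'.2.1
    exact add_mem (h.2.2 (by linarith)) (h'.2.2 (by linarith))

theorem mem_closure_or_neg_mem_closure (hα : α ∈ D.roots) :
    α ∈ AddSubmonoid.closure D.simpleRoots ∨ -α ∈ AddSubmonoid.closure D.simpleRoots := by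
  obtain ⟨i, rfl⟩ := hα
  exact D.base.root_mem_or_neg_mem i

theorem root_apply_im (hC : C ∈ D.kahlerCone) (hα : α ∈ D.roots) : (α C).im = 0 := by
  rcases mem_closure_or_neg_mem_closure hα with h | h
  · exact (cone_of_mem_closure hC h).1
  · simpa using (cone_of_mem_closure hC h).1

theorem mem_XiZero_iff (hC : C ∈ D.kahlerCone) : α ∈ D.XiZero ↔ α ∈ D.roots ∧ (α C).re = 0 := by
  refine and_congr_right fun hα => ⟨fun h => by rw [eq_zero_of_mem_span_simpleLevi hC h]; rfl,
    fun h => ?_⟩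
  rcases mem_closure_or_neg_mem_closure hα with h' | h'
  · exact (cone_of_mem_closure hC h').2.2 h
  · exact neg_mem_iff.mp ((cone_of_mem_closure hC h').2.2 (by simpa using h))

theorem mem_XiPos_iff (hC : C ∈ D.kahlerCone) : α ∈ D.XiPos ↔ α ∈ D.roots ∧ 0 < (α C).re := by
  constructor
  · rintro ⟨⟨hα, h⟩, h0⟩
    refine ⟨hα, lt_of_le_of_ne (cone_of_mem_closure hC h).2.1 fun h1 => h0 ?_⟩
    exact (mem_XiZero_iff hC).mpr ⟨hα, h1.symm⟩
  · rintro ⟨hα, h⟩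
    refine ⟨⟨hα, ?_⟩, fun h0 => h.ne' ((mem_XiZero_iff hC).mp h0).2⟩
    refine (mem_closure_or_neg_mem_closure hα).resolve_right fun h' => ?_
    have := (cone_of_mem_closure hC h').2.1
    rw [LinearMap.neg_apply, Complex.neg_re] at this
    linarith

theorem mem_roots_of_mem_XiPos (hα : α ∈ D.XiPos) : α ∈ D.roots := hα.1.1

theorem cval_ne_zero (hC : C ∈ D.kahlerCone) (hα : α ∈ D.XiPos) : cval C α ≠ 0 := fun h => by
  have := ((mem_XiPos_iff hC).mp hα).2
  rw [show α C = 0 from h] at this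
  exact lt_irrefl _ this

variable (D) in
/-- The sum of the root spaces for the linear forms in `S` (including `𝔱` if `0 ∈ S`). -/
def graded (S : Set (Module.Dual ℂ D.t)) : Submodule ℂ L := ⨆ α ∈ S, D.rootSubspace α

theorem mem_graded {S : Set (Module.Dual ℂ D.t)} (hα : α ∈ S) (hx : x ∈ D.rootSubspace α) :
    x ∈ D.graded S :=
  Submodule.mem_iSup_of_mem α (Submodule.mem_iSup_of_mem hα hx)

theorem graded_le {S : Set (Module.Dual ℂ D.t)} {M : Submodule ℂ L} :
    D.graded S ≤ M ↔ ∀ α ∈ S, D.rootSubspace α ≤ M := iSup₂_le_iff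

theorem lie_mem_graded {S T R : Set (Module.Dual ℂ D.t)}
    (h : ∀ α ∈ S, ∀ β ∈ T, α + β ∈ R) (hx : x ∈ D.graded S) (hy : y ∈ D.graded T) :
    ⁅x, y⁆ ∈ D.graded R := by
  have h1 : D.graded T ≤ (D.graded R).comap (LieAlgebra.ad ℂ L x : L →ₗ[ℂ] L) := by
    refine graded_le.mpr fun β hβ y hy => ?_
    have h2 : D.graded S ≤ (D.graded R).comap (LieAlgebra.ad ℂ L y : L →ₗ[ℂ] L) := by
      refine graded_le.mpr fun α hα x hx => ?_
      change ⁅y, x⁆ ∈ D.graded R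
      rw [← lie_skew]
      exact neg_mem (mem_graded (h α hα β hβ) (lie_mem_rootSubspace hx hy))
    change ⁅x, y⁆ ∈ D.graded R
    rw [← lie_skew]
    exact neg_mem (h2 hx)
  exact h1 hy

theorem killing_graded {S T : Set (Module.Dual ℂ D.t)}
    (h : ∀ α ∈ S, ∀ β ∈ T, α + β ≠ 0) (hx : x ∈ D.graded S) (hy : y ∈ D.graded T) :
    killingForm ℂ L x y = 0 := by
  have h1 : D.graded T ≤ LinearMap.ker (killingForm ℂ L x) := by
    refine graded_le.mpr fun β hβ y hy => ?_
    have h2 : D.graded S ≤ LinearMap.ker (killingForm ℂ L y) := by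
      refine graded_le.mpr fun α hα x hx => ?_
      rw [LinearMap.mem_ker, killing_comm]
      exact killing_eq_zero hx hy (h α hα β hβ)
    rw [LinearMap.mem_ker, killing_comm]
    exact h2 hx
  exact h1 hy

theorem rootSubspace_eq_bot (h0 : α ≠ 0) (hα : α ∉ D.roots) : D.rootSubspace α = ⊥ := by
  rw [eq_bot_iff]
  intro x hx
  by_contra h
  exact hα (mem_roots_of_ne_zero h0 hx h)

theorem nPos_eq (hC : C ∈ D.kahlerCone) : D.nPos = D.graded {α | 0 < (α C).re} := by
  refine le_antisymm (graded_le.mpr fun α hα x hx => mem_graded ((mem_XiPos_iff hC).mp hα).2 hx)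
    (graded_le.mpr fun α hα => ?_)
  by_cases h : α ∈ D.roots
  · exact fun x hx => mem_graded ((mem_XiPos_iff hC).mpr ⟨h, hα⟩) hx
  · rw [rootSubspace_eq_bot _ h]
    · exact bot_le
    · rintro rfl
      simp at hα

theorem parabolic_eq (hC : C ∈ D.kahlerCone) : D.parabolic = D.graded {α | 0 ≤ (α C).re} := by
  refine le_antisymm (sup_le (sup_le ?_ ?_) ?_) (graded_le.mpr fun α hα => ?_)
  · rw [← rootSubspace_zero]
    exact fun x hx => mem_graded (by simp) hx
  · exact graded_le.mpr fun α hα x hx => mem_graded ((mem_XiZero_iff hC).mp hα).2.ge hx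
  · exact graded_le.mpr fun α hα x hx => mem_graded ((mem_XiPos_iff hC).mp hα).2.le hx
  · by_cases h : α ∈ D.roots
    · rcases (show 0 ≤ (α C).re from hα).eq_or_lt with h' | h'
      · exact fun x hx => Submodule.mem_sup_left <| Submodule.mem_sup_right <|
          mem_graded ((mem_XiZero_iff hC).mpr ⟨h, h'.symm⟩) hx
      · exact fun x hx => Submodule.mem_sup_right <|
          mem_graded ((mem_XiPos_iff hC).mpr ⟨h, h'⟩) hx
    · by_cases h0 : α = 0
      · rw [h0, rootSubspace_zero]
        exact le_sup_left.trans le_sup_left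
      · rw [rootSubspace_eq_bot h0 h]
        exact bot_le

theorem nPos_le_parabolic : D.nPos ≤ D.parabolic := le_sup_right

theorem cartan_mem_parabolic (H : D.t) : (H : L) ∈ D.parabolic :=
  Submodule.mem_sup_left (Submodule.mem_sup_left H.2)

theorem lie_mem_parabolic (hC : C ∈ D.kahlerCone) (hx : x ∈ D.parabolic) (hy : y ∈ D.parabolic) :
    ⁅x, y⁆ ∈ D.parabolic := by
  rw [parabolic_eq hC] at hx hy ⊢
  refine lie_mem_graded (fun α hα β hβ => ?_) hx hy
  simp only [Set.mem_ofPred_eq, LinearMap.add_apply, Complex.add_re] at hα hβ ⊢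
  exact add_nonneg hα hβ

theorem killing_nPos_parabolic (hC : C ∈ D.kahlerCone) (hx : x ∈ D.nPos) (hy : y ∈ D.parabolic) :
    killingForm ℂ L x y = 0 := by
  rw [parabolic_eq hC] at hy
  rw [nPos_eq hC] at hx
  refine killing_graded (fun α hα β hβ h => ?_) hx hy
  simp only [Set.mem_ofPred_eq] at hα hβ
  have := congrArg (fun l : Module.Dual ℂ D.t => (l C).re) h
  simp only [LinearMap.add_apply, Complex.add_re, LinearMap.zero_apply, Complex.zero_re] at this
  linarith

/-- ad C acts on 𝔤_α by α(C), which vanishes on the Levi part. -/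
theorem lie_C_mem_nPos (hC : C ∈ D.kahlerCone) (hx : x ∈ D.parabolic) :
    ⁅(C : L), x⁆ ∈ D.nPos := by
  have h : D.parabolic ≤ D.nPos.comap (LieAlgebra.ad ℂ L (C : L) : L →ₗ[ℂ] L) := by
    rw [parabolic_eq hC]
    refine graded_le.mpr fun α hα x hx => ?_
    change ⁅(C : L), x⁆ ∈ D.nPos
    rw [lie_cartan hx C]
    by_cases h0 : α C = 0
    · rw [h0, zero_smul]
      exact zero_mem _
    by_cases hr : α ∈ D.roots
    · refine D.nPos.smul_mem _ (mem_graded ((mem_XiPos_iff hC).mpr ⟨hr, ?_⟩) hx)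
      exact lt_of_le_of_ne hα fun h => h0 (Complex.ext h.symm (root_apply_im hC hr))
    · rw [rootSubspace_eq_bot (fun h => h0 (by rw [h]; rfl)) hr, Submodule.mem_bot] at hx
      rw [hx, smul_zero]
      exact zero_mem _
  exact h hx

/-- B(C, [x, y]) = B([C, x], y) with [C, x] ∈ 𝔫⁺, which is orthogonal to 𝔭. This is the
infinitesimal form of `killing_C_AdMap`. -/
theorem killing_C_lie (hC : C ∈ D.kahlerCone) (hx : x ∈ D.parabolic) (hy : y ∈ D.parabolic) :
    killingForm ℂ L (C : L) ⁅x, y⁆ = 0 := by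
  rw [← killing_lie]
  exact killing_nPos_parabolic hC (lie_C_mem_nPos hC hx) hy

namespace RootVectors

theorem mem_nPos (hα : α ∈ D.XiPos) : X.x α ∈ D.nPos := mem_graded hα (X.mem α hα.1.1)

theorem y_mem_nNeg (hα : α ∈ D.XiPos) : X.y α ∈ D.nNeg :=
  Submodule.mem_iSup_of_mem α (Submodule.mem_iSup_of_mem hα (X.mem_neg hα.1.1))

theorem nPos_eq_span : D.nPos = Submodule.span ℂ (Set.range fun α : D.XiPos => X.x α) := by
  refine le_antisymm (graded_le.mpr fun α hα => ?_) (Submodule.span_le.mpr ?_)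
  · rw [X.rootSubspace_eq hα.1.1, Submodule.span_singleton_le_iff_mem]
    exact Submodule.subset_span ⟨⟨α, hα⟩, rfl⟩
  · rintro _ ⟨α, rfl⟩
    exact X.mem_nPos α.2

theorem nNeg_eq_span : D.nNeg = Submodule.span ℂ (Set.range fun α : D.XiPos => X.y α) := by
  refine le_antisymm (iSup₂_le fun α hα => ?_) (Submodule.span_le.mpr ?_)
  · rw [X.rootSubspace_eq (neg_mem_roots hα.1.1), Submodule.span_singleton_le_iff_mem]
    exact Submodule.subset_span ⟨⟨α, hα⟩, rfl⟩
  · rintro _ ⟨α, rfl⟩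
    exact X.y_mem_nNeg α.2

theorem θ_mem_nNeg (hx : x ∈ D.nPos) : X.θ x ∈ D.nNeg := by
  rw [X.nPos_eq_span] at hx
  have h : Submodule.span ℂ (Set.range fun α : D.XiPos => X.x α) ≤ D.nNeg.comap X.θ := by
    refine Submodule.span_le.mpr ?_
    rintro _ ⟨α, rfl⟩
    change X.θ _ ∈ D.nNeg
    rw [X.θ_x α.2.1.1]
    exact neg_mem (X.y_mem_nNeg α.2)
  exact h hx

theorem eq_zero_of_killing (h : ∀ α ∈ D.roots, killingForm ℂ L (D.Hvec α) x = 0)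
    (h' : ∀ α ∈ D.roots, killingForm ℂ L (X.x α) x = 0) : x = 0 := by
  rw [X.expansion x]
  refine Finset.sum_eq_zero fun α _ => ?_
  rw [h _ α.2, h' _ (neg_mem_roots α.2), zero_smul, zero_smul, add_zero]

theorem x_mem_parabolic_iff (hC : C ∈ D.kahlerCone) (hα : α ∈ D.roots) :
    -α ∈ D.XiPos ∨ X.x α ∈ D.parabolic := by
  by_cases h : 0 ≤ (α C).re
  · right
    rw [parabolic_eq hC]
    exact mem_graded h (X.mem α hα)
  · left
    refine (mem_XiPos_iff hC).mpr ⟨neg_mem_roots hα, ?_⟩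
    rw [LinearMap.neg_apply, Complex.neg_re]
    linarith

/-- `𝔫⁺` is the orthogonal complement of `𝔭` under the Killing form. -/
theorem mem_nPos_iff (X : D.RootVectors) (hC : C ∈ D.kahlerCone) :
    x ∈ D.nPos ↔ ∀ y ∈ D.parabolic, killingForm ℂ L x y = 0 := by
  refine ⟨fun h y hy => killing_nPos_parabolic hC h hy, fun h => ?_⟩
  rw [X.expansion x]
  refine Submodule.sum_mem _ fun α _ => ?_
  rw [killing_comm, ← coe_hvec, h _ (cartan_mem_parabolic _), zero_smul, zero_add]
  rcases X.x_mem_parabolic_iff hC (neg_mem_roots α.2) with h' | h'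
  · rw [neg_neg] at h'
    exact Submodule.smul_mem _ _ (X.mem_nPos h')
  · rw [killing_comm, h _ h', zero_smul]
    exact zero_mem _

theorem nNeg_killing_neg (hC : C ∈ D.kahlerCone) (hα : α ∈ D.XiPos) (hx : x ∈ D.nNeg) :
    killingForm ℂ L (X.x (-α)) x = 0 := by
  rw [X.nNeg_eq_span] at hx
  have h : Submodule.span ℂ (Set.range fun α : D.XiPos => X.y α) ≤
      LinearMap.ker (killingForm ℂ L (X.x (-α))) := by
    refine Submodule.span_le.mpr ?_
    rintro _ ⟨β, rfl⟩
    refine X.killing_ne (neg_mem_roots hα.1.1) β.2.1.1 fun h => ?_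
    have h1 := ((mem_XiPos_iff hC).mp hα).2
    have h2 := ((mem_XiPos_iff hC).mp β.2).2
    rw [← h, LinearMap.neg_apply, Complex.neg_re] at h2
    linarith
  exact h hx

/-- Such an element is orthogonal to 𝔱 and to every root vector: those in 𝔭 are orthogonal to 𝔫⁺,
the others are orthogonal to 𝔫⁻. -/
theorem eq_zero_of_mem_nPos_of_mem_nNeg (X : D.RootVectors) (hC : C ∈ D.kahlerCone) (hx : x ∈ D.nPos)
    (hx' : x ∈ D.nNeg) : x = 0 := by
  refine X.eq_zero_of_killing (fun α _ => ?_) (fun α hα => ?_)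
  · rw [killing_comm]
    exact killing_nPos_parabolic hC hx (cartan_mem_parabolic (D.hvec α))
  · rcases X.x_mem_parabolic_iff hC hα with h | h
    · have := X.nNeg_killing_neg hC h hx'
      rwa [neg_neg] at this
    · rw [killing_comm]
      exact killing_nPos_parabolic hC hx h

theorem θ_C (hC : C ∈ D.kahlerCone) : X.θ (C : L) = -(C : L) := by
  rw [coe_cartan_expansion C, map_sum, ← Finset.sum_neg_distrib]
  refine Finset.sum_congr rfl fun α _ => ?_
  rw [map_smulₛₗ, X.θ_Hvec α.2, Complex.conj_eq_iff_im.mpr (root_apply_im hC α.2), smul_neg]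

/-! ### The compact form -/

theorem conj_two : starRingEnd ℂ 2 = 2 := map_ofNat _ 2

theorem mem_compactForm : x ∈ X.compactForm ↔ X.θ x = x := Iff.rfl

theorem lie_mem_compactForm (hx : x ∈ X.compactForm) (hy : y ∈ X.compactForm) :
    ⁅x, y⁆ ∈ X.compactForm := by
  rw [mem_compactForm] at *
  rw [X.θ_lie, hx, hy]

/-- The component `v₁ ∈ 𝔲` in `x = v₁ + i v₂`. -/
noncomputable def rePart (x : L) : X.compactForm :=
  ⟨(1 / 2 : ℂ) • (x + X.θ x), by
    rw [mem_compactForm, map_smulₛₗ, map_add, X.θ_θ, add_comm (X.θ x) x]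
    simp [conj_two]⟩

/-- The component `v₂ ∈ 𝔲` in `x = v₁ + i v₂`. -/
noncomputable def imPart (x : L) : X.compactForm :=
  ⟨(-Complex.I / 2 : ℂ) • (x - X.θ x), by
    rw [mem_compactForm, map_smulₛₗ, map_sub, X.θ_θ, ← neg_sub x, smul_neg, ← neg_smul]
    simp [conj_two, neg_div]⟩

theorem rePart_add_imPart (x : L) : x = (X.rePart x : L) + Complex.I • (X.imPart x : L) := by
  simp only [rePart, imPart, smul_smul]
  rw [show Complex.I * (-Complex.I / 2) = 1 / 2 by
    linear_combination (-1 / 2 : ℂ) * Complex.I_mul_I]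
  module

theorem θ_add_I_smul (v w : X.compactForm) :
    X.θ ((v : L) + Complex.I • (w : L)) = (v : L) - Complex.I • (w : L) := by
  rw [map_add, map_smulₛₗ, X.mem_compactForm.mp v.2, X.mem_compactForm.mp w.2, Complex.conj_I,
    neg_smul, sub_eq_add_neg]

theorem eq_parts {v w : X.compactForm} (h : x = (v : L) + Complex.I • (w : L)) :
    v = X.rePart x ∧ w = X.imPart x := by
  have h' := X.θ_add_I_smul v w
  rw [← h] at h'
  constructor <;> apply Subtype.ext
  · simp only [rePart]
    rw [h', h]
    module
  · simp only [imPart]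
    rw [h', h, add_sub_sub_cancel, ← add_smul, smul_smul,
      show -Complex.I / 2 * (Complex.I + Complex.I) = 1 by
        linear_combination (-1 : ℂ) * Complex.I_mul_I, one_smul]

/-- If θz ∈ 𝔭, then z = (z + θz) − θz lies in 𝔲 + 𝔭. This covers the root vectors outside 𝔭, since θ
maps them into 𝔫⁺. -/
theorem compactForm_sup_parabolic (hC : C ∈ D.kahlerCone) :
    X.compactForm ⊔ D.parabolic.restrictScalars ℝ = ⊤ := by
  rw [eq_top_iff]
  intro x _
  let S : Submodule ℝ L := X.compactForm ⊔ D.parabolic.restrictScalars ℝ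
  have hp : ∀ {z}, z ∈ D.parabolic → z ∈ S := fun hz => Submodule.mem_sup_right hz
  have key : ∀ z, X.θ z ∈ D.parabolic → z ∈ S := fun z hz => by
    have h1 : (((2 : ℂ) • X.rePart z : L)) ∈ S := by
      refine Submodule.mem_sup_left ?_
      rw [mem_compactForm, map_smulₛₗ, X.mem_compactForm.mp (X.rePart z).2, conj_two]
    have h2 : z = (2 : ℂ) • (X.rePart z : L) - X.θ z := by
      simp only [rePart]
      module
    rw [h2]
    exact sub_mem h1 (hp hz)
  change x ∈ S
  rw [X.expansion x]
  refine Submodule.sum_mem _ fun α _ => add_mem (hp ?_) ?_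
  · exact Submodule.smul_mem _ _ (cartan_mem_parabolic (D.hvec α))
  · rcases X.x_mem_parabolic_iff hC α.2 with h | h
    · refine key _ ?_
      rw [map_smulₛₗ, X.θ_x α.2]
      exact Submodule.smul_mem _ _ (neg_mem (nPos_le_parabolic (X.mem_nPos h)))
    · exact hp (Submodule.smul_mem _ _ h)

/-! ### Structure constants -/

open Classical in
/-- The structure constant `N_{α,β}`, which is `0` if `α + β` is not a root. -/
noncomputable def N (α β : Module.Dual ℂ D.t) : ℂ :=
  if α + β ∈ D.roots then killingForm ℂ L ⁅X.x α, X.x β⁆ (X.x (-(α + β))) else 0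

theorem add_mem_XiPos (hC : C ∈ D.kahlerCone) (hα : α ∈ D.XiPos) (hβ : β ∈ D.XiPos)
    (h : X.N α β ≠ 0) : α + β ∈ D.XiPos := by
  refine (mem_XiPos_iff hC).mpr ⟨by_contra fun h' => h (if_neg h'), ?_⟩
  rw [LinearMap.add_apply, Complex.add_re]
  exact add_pos ((mem_XiPos_iff hC).mp hα).2 ((mem_XiPos_iff hC).mp hβ).2

theorem eq_killing_smul (hα : α ∈ D.roots) (hx : x ∈ D.rootSubspace α) :
    x = killingForm ℂ L x (X.x (-α)) • X.x α := by
  rw [X.rootSubspace_eq hα] at hx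
  obtain ⟨c, rfl⟩ := Submodule.mem_span_singleton.mp hx
  rw [map_smul, LinearMap.smul_apply, X.killing_neg hα, smul_eq_mul, mul_one]

theorem lie_x_x (hα : α ∈ D.roots) (hβ : β ∈ D.roots) (h0 : α + β ≠ 0) :
    ⁅X.x α, X.x β⁆ = X.N α β • X.x (α + β) := by
  have h1 := lie_mem_rootSubspace (X.mem α hα) (X.mem β hβ)
  by_cases h : α + β ∈ D.roots
  · rw [N, if_pos h]
    exact X.eq_killing_smul h h1
  · rw [rootSubspace_eq_bot h0 h, Submodule.mem_bot] at h1
    rw [h1, N, if_neg h, zero_smul]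

open Classical in
-- At most one summand is nonzero, the one with α = β − γ. If β − γ is not in Ξ₊, the bracket lies
-- in 𝔭 and both sides vanish.
theorem mkQ_lie_x_y (hC : C ∈ D.kahlerCone) (γ β : D.XiPos) :
    D.parabolic.mkQ ⁅X.x γ, X.y β⁆ =
      ∑ α : D.XiPos, if α.1 + γ.1 = β.1 then X.N α γ • D.parabolic.mkQ (X.y α) else 0 := by
  have hm := lie_mem_rootSubspace (X.mem γ γ.2.1.1) (X.mem_neg β.2.1.1)
  by_cases h : β.1 - γ.1 ∈ D.XiPos
  · rw [Finset.sum_eq_single ⟨β.1 - γ.1, h⟩]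
    · rw [if_pos (sub_add_cancel _ _), ← map_smul]
      congr 1
      have e : γ.1 + -β.1 = -(β.1 - γ.1) := by abel
      have hr := neg_mem_roots (mem_roots_of_mem_XiPos h)
      rw [e] at hm
      rw [N, if_pos (by rw [sub_add_cancel]; exact β.2.1.1), sub_add_cancel]
      refine (X.eq_killing_smul hr hm).trans ?_
      -- The coefficient of x_{−α} is B(x_α, [x_γ, x_{−β}]) = B([x_α, x_γ], x_{−β}) = N_{α,γ}, by
      -- invariance.
      rw [neg_neg, killing_comm, ← killing_lie]
      rfl
    · intro α _ hα
      exact if_neg fun h' => hα (Subtype.ext (eq_sub_of_add_eq h'))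
    · simp
  · rw [Finset.sum_eq_zero fun α _ => if_neg fun h' => h ?_]
    · rw [Submodule.mkQ_apply, Submodule.Quotient.mk_eq_zero]
      change ⁅X.x γ, X.x (-β)⁆ ∈ D.parabolic
      by_cases h0 : γ.1 + -β.1 = 0
      · rw [h0, rootSubspace_zero] at hm
        exact Submodule.mem_sup_left (Submodule.mem_sup_left hm)
      by_cases hr : γ.1 + -β.1 ∈ D.roots
      · rw [parabolic_eq hC]
        refine mem_graded ?_ hm
        by_contra h1
        refine h ((mem_XiPos_iff hC).mpr ⟨?_, ?_⟩)
        · have := neg_mem_roots hr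
          rwa [neg_add, neg_neg, add_comm, ← sub_eq_add_neg] at this
        · simp only [Set.mem_ofPred_eq, LinearMap.add_apply, LinearMap.neg_apply, Complex.add_re,
            Complex.neg_re, LinearMap.sub_apply, Complex.sub_re] at h1 ⊢
          linarith
      · rw [rootSubspace_eq_bot h0 hr, Submodule.mem_bot] at hm
        rw [hm]
        exact zero_mem _
    · rw [← h', add_sub_cancel_right]
      exact α.2

/-! ### The metric -/

/-- The element `y_α` of `𝔫⁻`. -/
def yNeg (α : D.XiPos) : D.nNeg := ⟨X.y α, X.y_mem_nNeg α.2⟩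

open Classical in
-- For α = β the bracket is H_α and B(C, H_α) = c_α; otherwise it lies in a root space or vanishes,
-- and is orthogonal to C.
theorem metricForm_x_y (α β : D.XiPos) :
    D.metricForm C (X.x α) (X.yNeg β) = if α = β then cval C α else 0 := by
  change killingForm ℂ L (C : L) ⁅X.x α, X.x (-β)⁆ = _
  split_ifs with h
  · subst h
    rw [X.lie_neg α α.2.1.1, killing_comm, killing_Hvec]
    rfl
  · have hm := lie_mem_rootSubspace (X.mem α α.2.1.1) (X.mem_neg β.2.1.1)
    have h0 : α.1 + -β.1 ≠ 0 := fun h' => h (Subtype.ext (add_neg_eq_zero.mp h'))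
    by_cases hr : α.1 + -β.1 ∈ D.roots
    · exact killing_cartan_eq_zero C hr hm
    · rw [rootSubspace_eq_bot h0 hr, Submodule.mem_bot] at hm
      rw [hm, map_zero]

theorem _root_.FlagCR.ParabolicData.metricForm_add (x y : L) :
    D.metricForm C (x + y) = D.metricForm C x + D.metricForm C y := by
  ext n
  change killingForm ℂ L (C : L) ⁅x + y, (n : L)⁆ = _
  rw [add_lie, map_add]
  rfl

theorem _root_.FlagCR.ParabolicData.metricForm_smul (a : ℂ) (x : L) :
    D.metricForm C (a • x) = a • D.metricForm C x := by
  ext n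
  change killingForm ℂ L (C : L) ⁅a • x, (n : L)⁆ = _
  rw [smul_lie, map_smul]
  rfl

theorem exists_sum_nNeg (n : D.nNeg) : ∃ a : D.XiPos → ℂ, n = ∑ α, a α • X.yNeg α := by
  have hn : ∀ z ∈ D.nNeg, ∃ a : D.XiPos → ℂ, ∑ α, a α • X.y α = z := fun z hz => by
    rwa [X.nNeg_eq_span, Submodule.mem_span_range_iff_exists_fun] at hz
  obtain ⟨a, h⟩ := hn n n.2
  refine ⟨a, Subtype.ext ?_⟩
  rw [← h, Submodule.coe_sum]
  rfl

variable {W : Type*} [AddCommGroup W] [Module ℂ W]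

theorem exists_sum_tmul (τ : W ⊗[ℂ] D.nNeg) :
    ∃ w : D.XiPos → W, τ = ∑ α, w α ⊗ₜ X.yNeg α := by
  induction τ using TensorProduct.induction_on with
  | zero => exact ⟨0, by simp⟩
  | tmul w n =>
    obtain ⟨a, rfl⟩ := X.exists_sum_nNeg n
    exact ⟨fun α => a α • w, by rw [TensorProduct.tmul_sum]; simp [TensorProduct.smul_tmul]⟩
  | add τ τ' h h' =>
    obtain ⟨w, rfl⟩ := h
    obtain ⟨w', rfl⟩ := h'
    exact ⟨w + w', by simp [TensorProduct.add_tmul, Finset.sum_add_distrib]⟩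

theorem metric_sum_tmul (w : D.XiPos → W) (α : D.XiPos) :
    TensorProduct.rid ℂ W (LinearMap.lTensor W (D.metricForm C (X.x α)) (∑ β, w β ⊗ₜ X.yNeg β))
      = cval C α • w α := by
  classical
  rw [map_sum, map_sum, Finset.sum_eq_single α]
  · rw [LinearMap.lTensor_tmul, X.metricForm_x_y, if_pos rfl, TensorProduct.rid_tmul]
  · intro β _ h
    rw [LinearMap.lTensor_tmul, X.metricForm_x_y, if_neg (Ne.symm h), TensorProduct.tmul_zero,
      map_zero]
  · simp

theorem metric_unique (X : D.RootVectors) (hC : C ∈ D.kahlerCone) {τ τ' : W ⊗[ℂ] D.nNeg}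
    (h : ∀ x ∈ D.nPos, TensorProduct.rid ℂ W (LinearMap.lTensor W (D.metricForm C x) τ) =
      TensorProduct.rid ℂ W (LinearMap.lTensor W (D.metricForm C x) τ')) : τ = τ' := by
  obtain ⟨w, rfl⟩ := X.exists_sum_tmul τ
  obtain ⟨w', rfl⟩ := X.exists_sum_tmul τ'
  refine Finset.sum_congr rfl fun α _ => ?_
  have := h _ (X.mem_nPos α.2)
  rw [X.metric_sum_tmul, X.metric_sum_tmul] at this
  rw [smul_right_injective W (cval_ne_zero hC α.2) this]

end RootVectors

end ParabolicData
end FlagCR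

namespace FlagCR

open ParabolicData

variable {E : Type*} [NormedAddCommGroup E] [NormedSpace ℂ E] [FiniteDimensional ℂ E]
  [CompleteSpace E]
  {G : Type*} [TopologicalSpace G] [ChartedSpace E G] [Group G] [LieGroup 𝓘(ℂ, E) ω G]
  [T2Space G]

/-! ### The adjoint action on subspaces -/

theorem AdMap_apply_mul (a b : G) (v : GroupLieAlgebra 𝓘(ℂ, E) G) :
    AdMap (a * b) v = AdMap a (AdMap b v) := by rw [AdMap_mul]; rfl

theorem AdMap_inv_apply (a : G) (v : GroupLieAlgebra 𝓘(ℂ, E) G) :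
    AdMap a⁻¹ (AdMap a v) = v := by
  rw [← AdMap_apply_mul, inv_mul_cancel, AdMap_one]; rfl

theorem AdMap_apply_inv (a : G) (v : GroupLieAlgebra 𝓘(ℂ, E) G) :
    AdMap a (AdMap a⁻¹ v) = v := by
  rw [← AdMap_apply_mul, mul_inv_cancel, AdMap_one]; rfl

theorem AdMap_lie (g : G) (v w : GroupLieAlgebra 𝓘(ℂ, E) G) :
    AdMap g ⁅v, w⁆ = ⁅AdMap g v, AdMap g w⁆ := adc_gbr (E := E) g v w

theorem lieExp_AdMap (g : G) (v : GroupLieAlgebra 𝓘(ℂ, E) G) :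
    lieExp (AdMap g v) = g * lieExp v * g⁻¹ := lieExp_adc (E := E) g v

theorem AdMap_lieExp_sub_mem {S : Submodule ℝ (GroupLieAlgebra 𝓘(ℂ, E) G)}
    {v w : GroupLieAlgebra 𝓘(ℂ, E) G} (hT : ∀ x ∈ S, ⁅v, x⁆ ∈ S) (hw : ⁅v, w⁆ ∈ S) :
    AdMap (lieExp v) w - w ∈ S := adc_lieExp_sub_mem (E := E) (S := S) (v := v) hT hw

theorem AdMap_lieExp_mem {S : Submodule ℝ (GroupLieAlgebra 𝓘(ℂ, E) G)}
    {v w : GroupLieAlgebra 𝓘(ℂ, E) G} (hT : ∀ x ∈ S, ⁅v, x⁆ ∈ S) (hw : w ∈ S) :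
    AdMap (lieExp v) w ∈ S := by
  have := S.add_mem (AdMap_lieExp_sub_mem hT (hT w hw)) hw
  rwa [sub_add_cancel] at this

theorem AdMap_mem_of_mem_adStabilizer {S : Submodule ℂ (GroupLieAlgebra 𝓘(ℂ, E) G)} {g : G}
    (hg : g ∈ adStabilizer S) {v : GroupLieAlgebra 𝓘(ℂ, E) G} (hv : v ∈ S) : AdMap g v ∈ S := by
  have h : S.map (Ad E G g) = S := hg
  rw [← h]
  exact Submodule.mem_map_of_mem hv

theorem lieExp_mem_adStabilizer {S : Submodule ℂ (GroupLieAlgebra 𝓘(ℂ, E) G)}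
    {v : GroupLieAlgebra 𝓘(ℂ, E) G} (hT : ∀ x ∈ S, ⁅v, x⁆ ∈ S) : lieExp v ∈ adStabilizer S := by
  refine le_antisymm (Submodule.map_le_iff_le_comap.mpr fun x hx =>
    AdMap_lieExp_mem (S := S.restrictScalars ℝ) hT hx) fun x hx => ?_
  refine ⟨AdMap (lieExp v)⁻¹ x, ?_, AdMap_apply_inv _ _⟩
  have h1 : (lieExp v : G)⁻¹ = lieExp (-v) := (lieExp_neg (E := E) v).symm
  rw [h1]
  refine AdMap_lieExp_mem (S := S.restrictScalars ℝ) (fun x hx => ?_) hx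
  rw [neg_lie]
  exact neg_mem (hT x hx)

/-! ### Invariance of the Killing form, of 𝔫⁺, of 𝔲 and of C. -/

section Killing

variable [LieAlgebra.IsKilling ℂ (GroupLieAlgebra 𝓘(ℂ, E) G)]

theorem killing_AdMap (g : G) (v w : GroupLieAlgebra 𝓘(ℂ, E) G) :
    killingForm ℂ _ (AdMap g v) (AdMap g w) = killingForm ℂ _ v w := by
  let e : GroupLieAlgebra 𝓘(ℂ, E) G ≃ₗ⁅ℂ⁆ GroupLieAlgebra 𝓘(ℂ, E) G :=
    { AdMap g with
      map_lie' := AdMap_lie g _ _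
      invFun := AdMap g⁻¹
      left_inv := AdMap_inv_apply g
      right_inv := AdMap_apply_inv g }
  exact LieAlgebra.killingForm_of_equiv_apply e v w

variable {D : ParabolicData (GroupLieAlgebra 𝓘(ℂ, E) G)} {C : D.t} (X : D.RootVectors)

theorem lieExp_mem_parabolicSubgroup (hC : C ∈ D.kahlerCone) {v : GroupLieAlgebra 𝓘(ℂ, E) G}
    (hv : v ∈ D.parabolic) : lieExp v ∈ parabolicSubgroup D :=
  ⟨lieExp_mem hv, lieExp_mem_adStabilizer fun _ hx => lie_mem_parabolic hC hv hx⟩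

theorem AdMap_mem_parabolic {p : G} (hp : p ∈ parabolicSubgroup D)
    {v : GroupLieAlgebra 𝓘(ℂ, E) G} (hv : v ∈ D.parabolic) : AdMap p v ∈ D.parabolic :=
  AdMap_mem_of_mem_adStabilizer hp.2 hv

theorem killing_AdMap_left (g : G) (v w : GroupLieAlgebra 𝓘(ℂ, E) G) :
    killingForm ℂ _ (AdMap g v) w = killingForm ℂ _ v (AdMap g⁻¹ w) := by
  rw [← killing_AdMap g v, AdMap_apply_inv]

/-- P preserves 𝔭 and the Killing form, hence also 𝔫⁺, the orthogonal complement of 𝔭. -/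
theorem AdMap_mem_nPos (X : D.RootVectors) (hC : C ∈ D.kahlerCone) {p : G} (hp : p ∈ parabolicSubgroup D)
    {v : GroupLieAlgebra 𝓘(ℂ, E) G} (hv : v ∈ D.nPos) : AdMap p v ∈ D.nPos := by
  rw [X.mem_nPos_iff hC] at hv ⊢
  intro y hy
  rw [killing_AdMap_left]
  exact hv _ (AdMap_mem_parabolic (inv_mem hp) hy)

/-- For p = exp x with x ∈ 𝔭, the difference Ad(p)v − v is a limit of combinations of iterated
brackets with x, on which B(C, ·) vanishes. The general case follows because P lies in the group
generated by exp 𝔭. -/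
theorem killing_C_AdMap (hC : C ∈ D.kahlerCone) {p : G} (hp : p ∈ parabolicSubgroup D)
    {v : GroupLieAlgebra 𝓘(ℂ, E) G} (hv : v ∈ D.parabolic) :
    killingForm ℂ _ (C : GroupLieAlgebra 𝓘(ℂ, E) G) (AdMap p v) =
      killingForm ℂ _ (C : GroupLieAlgebra 𝓘(ℂ, E) G) v := by
  -- The stabilizer property is carried along because the product and inverse cases apply the
  -- hypothesis to Ad(b)v, which must again lie in 𝔭.
  have key : p ∈ adStabilizer D.parabolic ∧ ∀ v ∈ D.parabolic,
      killingForm ℂ _ (C : GroupLieAlgebra 𝓘(ℂ, E) G) (AdMap p v) =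
        killingForm ℂ _ (C : GroupLieAlgebra 𝓘(ℂ, E) G) v := by
    have h1 := hp.1
    clear hp
    rw [analyticSubgroup] at h1
    induction h1 using Subgroup.closure_induction with
    | mem x hx =>
      obtain ⟨x, hx, rfl⟩ := hx
      refine ⟨lieExp_mem_adStabilizer fun _ hy => lie_mem_parabolic hC hx hy, fun v hv => ?_⟩
      have h2 := AdMap_lieExp_sub_mem (v := x) (w := v)
        (S := (D.parabolic ⊓ LinearMap.ker
          (killingForm ℂ _ (C : GroupLieAlgebra 𝓘(ℂ, E) G))).restrictScalars ℝ)
        (fun y hy => ⟨lie_mem_parabolic hC hx hy.1, killing_C_lie hC hx hy.1⟩)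
        ⟨lie_mem_parabolic hC hx hv, killing_C_lie hC hx hv⟩
      have h3 := LinearMap.mem_ker.mp h2.2
      rwa [map_sub, sub_eq_zero] at h3
    | one => exact ⟨one_mem _, fun v _ => by rw [AdMap_one]; rfl⟩
    | mul a b _ _ ha hb =>
      refine ⟨mul_mem ha.1 hb.1, fun v hv => ?_⟩
      rw [AdMap_apply_mul, ha.2 _ (AdMap_mem_of_mem_adStabilizer hb.1 hv), hb.2 v hv]
    | inv a _ ha =>
      have hi := inv_mem ha.1
      refine ⟨hi, fun v hv => ?_⟩
      rw [← ha.2 _ (AdMap_mem_of_mem_adStabilizer hi hv), AdMap_apply_inv]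
  exact key.2 v hv

theorem AdMap_mem_compactForm {k : G} (hk : k ∈ compactSubgroup X)
    {v : GroupLieAlgebra 𝓘(ℂ, E) G} (hv : v ∈ X.compactForm) : AdMap k v ∈ X.compactForm := by
  rw [compactSubgroup, analyticSubgroup] at hk
  have key : (∀ v ∈ X.compactForm, AdMap k v ∈ X.compactForm) ∧
      ∀ v ∈ X.compactForm, AdMap k⁻¹ v ∈ X.compactForm := by
    induction hk using Subgroup.closure_induction with
    | mem x hx =>
      obtain ⟨x, hx, rfl⟩ := hx
      refine ⟨fun v hv => AdMap_lieExp_mem (fun _ hy => X.lie_mem_compactForm hx hy) hv,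
        fun v hv => ?_⟩
      rw [show (lieExp x : G)⁻¹ = lieExp (-x) from (lieExp_neg (E := E) x).symm]
      exact AdMap_lieExp_mem (fun _ hy => X.lie_mem_compactForm (neg_mem hx) hy) hv
    | one =>
      rw [inv_one, AdMap_one]
      exact ⟨fun v hv => hv, fun v hv => hv⟩
    | mul a b _ _ ha hb =>
      refine ⟨fun v hv => ?_, fun v hv => ?_⟩
      · rw [AdMap_apply_mul]; exact ha.1 _ (hb.1 _ hv)
      · rw [mul_inv_rev, AdMap_apply_mul]; exact hb.2 _ (ha.2 _ hv)
    | inv a _ ha => exact ⟨ha.2, by rw [inv_inv]; exact ha.1⟩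
  exact key.1 v hv

theorem θ_AdMap {k : G} (hk : k ∈ compactSubgroup X) (x : GroupLieAlgebra 𝓘(ℂ, E) G) :
    X.θ (AdMap k x) = AdMap k (X.θ x) := by
  have h1 := X.rePart_add_imPart x
  have h2 := X.θ_add_I_smul ⟨_, AdMap_mem_compactForm X hk (X.rePart x).2⟩
    ⟨_, AdMap_mem_compactForm X hk (X.imPart x).2⟩
  have h3 := X.θ_add_I_smul (X.rePart x) (X.imPart x)
  rw [← h1] at h3
  rw [h3, map_sub, map_smul]
  simp only at h2
  rw [← h2, ← map_smul, ← map_add, ← h1]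

/-- Put z = Ad(k)C − C. Because k ∈ P, z is orthogonal to 𝔭, so z ∈ 𝔫⁺. Because k ∈ U and θC = −C,
also θz = −z, so z ∈ 𝔫⁻. Therefore z = 0. This is the reason why h is well defined as a U-invariant
metric. -/
theorem AdMap_C (hC : C ∈ D.kahlerCone) {k : G} (hk : k ∈ compactSubgroup X)
    (hk' : k ∈ parabolicSubgroup D) :
    AdMap k (C : GroupLieAlgebra 𝓘(ℂ, E) G) = (C : GroupLieAlgebra 𝓘(ℂ, E) G) := by
  have h1 : AdMap k (C : GroupLieAlgebra 𝓘(ℂ, E) G) - C ∈ D.nPos := by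
    rw [X.mem_nPos_iff hC]
    intro y hy
    rw [map_sub, LinearMap.sub_apply, killing_AdMap_left, killing_C_AdMap hC (inv_mem hk') hy,
      sub_self]
  have h2 := X.θ_mem_nNeg h1
  rw [map_sub, θ_AdMap X hk, X.θ_C hC, map_neg, ← neg_sub', ← neg_mem_iff, neg_neg] at h2
  exact sub_eq_zero.mp (X.eq_zero_of_mem_nPos_of_mem_nNeg hC h1 h2)

end Killing
end FlagCR

namespace FlagCR

open ParabolicData

/-! ### Derivatives of curves of endomorphisms and of multilinear maps -/

section HasCDeriv

variable {W W₁ W₂ : Type*} [AddCommGroup W] [Module ℂ W] [FiniteDimensional ℂ W]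
  [AddCommGroup W₁] [Module ℂ W₁] [FiniteDimensional ℂ W₁]
  [AddCommGroup W₂] [Module ℂ W₂] [FiniteDimensional ℂ W₂]

theorem HasCDeriv.apply {A : ℝ → W →ₗ[ℂ] W₁} {A' : W →ₗ[ℂ] W₁} (h : HasCDeriv A A')
    {c : ℝ → W} {w : W} (hc : HasCDeriv c w) :
    HasCDeriv (fun t => A t (c t)) (A' (c 0) + A 0 w) :=
  h.bilin hc LinearMap.id

theorem HasCDeriv.apply_const {A : ℝ → W →ₗ[ℂ] W₁} {A' : W →ₗ[ℂ] W₁} (h : HasCDeriv A A')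
    (w : W) : HasCDeriv (fun t => A t w) (A' w) := by
  simpa using h.apply (hasCDeriv_const w)

theorem hasCDeriv_hom {A : ℝ → W →ₗ[ℂ] W₁} {A' : W →ₗ[ℂ] W₁}
    (h : ∀ w, HasCDeriv (fun t => A t w) (A' w)) : HasCDeriv A A' := by
  intro l
  let b := Module.finBasis ℂ W
  have e : ∀ f : W →ₗ[ℂ] W₁, l f = ∑ j, l ((b.coord j).smulRight (f (b j))) := by
    intro f
    rw [← map_sum]
    congr 1
    ext w
    rw [LinearMap.sum_apply]
    conv_lhs => rw [← b.sum_repr w, map_sum]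
    simp
  rw [e, funext fun t => e (A t)]
  exact HasDerivAt.fun_sum fun j _ =>
    h (b j) (l ∘ₗ (LinearMap.smulRightₗ (b.coord j) : W₁ →ₗ[ℂ] W →ₗ[ℂ] W₁))

theorem HasCDeriv.sum {ι : Type*} (s : Finset ι) {c : ι → ℝ → W} {w : ι → W}
    (h : ∀ i ∈ s, HasCDeriv (c i) (w i)) : HasCDeriv (fun t => ∑ i ∈ s, c i t) (∑ i ∈ s, w i) := by
  intro l
  simp only [map_sum]
  exact HasDerivAt.fun_sum fun i hi => h i hi l

theorem HasCDeriv.smul {a : ℝ → ℂ} {a' : ℂ} (ha : HasDerivAt a a' 0) {c : ℝ → W} {w : W}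
    (h : HasCDeriv c w) : HasCDeriv (fun t => a t • c t) (a' • c 0 + a 0 • w) := by
  intro l
  simp only [map_add, map_smul, smul_eq_mul]
  exact ha.mul (h l)

/-- The Leibniz rule, by induction on n: the first argument is expanded in a basis, and its
coordinates multiply multilinear maps of one argument less. -/
theorem hasCDeriv_multilinear {n : ℕ} (M : MultilinearMap ℂ (fun _ : Fin n => W) W₁)
    {c : Fin n → ℝ → W} {w : Fin n → W} (h : ∀ i, HasCDeriv (c i) (w i)) :
    HasCDeriv (fun t => M fun i => c i t)
      (∑ i, M (Function.update (fun j => c j 0) i (w i))) := by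
  induction n with
  | zero =>
    have e : (fun t => M fun i => c i t) = fun _ => M fun i => c i 0 := by
      funext t; congr 1; funext i; exact i.elim0
    rw [e]
    simpa using hasCDeriv_const (M fun i => c i 0)
  | succ n ih =>
    let b := Module.finBasis ℂ W
    have e : ∀ f : Fin (n + 1) → W,
        M f = ∑ j, b.coord j (f 0) • M.curryLeft (b j) (Fin.tail f) := by
      intro f
      have h1 : M f = M.curryLeft (f 0) (Fin.tail f) := by simp
      rw [h1]
      conv_lhs => rw [← b.sum_repr (f 0), map_sum]
      simp
    rw [funext fun t => e fun i => c i t]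
    have h1 := HasCDeriv.sum Finset.univ fun j _ =>
      HasCDeriv.smul (h 0 (b.coord j)) (ih (M.curryLeft (b j)) fun i => h i.succ)
    have h2 : ∑ i, M (Function.update (fun j => c j 0) i (w i)) =
        ∑ j, ((b.coord j) (w 0) • M.curryLeft (b j) (fun i => c i.succ 0) +
          b.coord j (c 0 0) • ∑ i, M.curryLeft (b j)
            (Function.update (fun k => c k.succ 0) i (w i.succ))) := by
      rw [Fin.sum_univ_succ, Finset.sum_add_distrib]
      congr 1
      · rw [e]
        refine Finset.sum_congr rfl fun j _ => ?_
        rw [Function.update_self]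
        congr 2
      · simp only [Finset.smul_sum]
        rw [Finset.sum_comm]
        refine Finset.sum_congr rfl fun i _ => ?_
        rw [e]
        refine Finset.sum_congr rfl fun j _ => ?_
        congr 2
        funext k
        simp only [Fin.tail, Function.update_apply, Fin.succ_inj]
    rw [h2]
    exact h1

end HasCDeriv

variable {E : Type*} [NormedAddCommGroup E] [NormedSpace ℂ E] [FiniteDimensional ℂ E]
  [CompleteSpace E]
  {G : Type*} [TopologicalSpace G] [ChartedSpace E G] [Group G] [LieGroup 𝓘(ℂ, E) ω G]
  [T2Space G] [LieAlgebra.IsKilling ℂ (GroupLieAlgebra 𝓘(ℂ, E) G)]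
  {D : ParabolicData (GroupLieAlgebra 𝓘(ℂ, E) G)} {C : D.t}
  {W W' : Type*} [AddCommGroup W] [Module ℂ W] [FiniteDimensional ℂ W]
  [AddCommGroup W'] [Module ℂ W'] [FiniteDimensional ℂ W']

theorem hasCDeriv_AdMap {c : ℝ → G} {v : GroupLieAlgebra 𝓘(ℂ, E) G} (hc : HasVel (E := E) c v) :
    HasCDeriv (fun t => AdMap (E := E) (c t)) (LieAlgebra.ad ℂ _ v : Module.End ℂ _) := by
  refine hasCDeriv_hom fun w l => ?_
  have h := hc.hasDerivAt_adc (w : E)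
  let l' : E →L[ℂ] ℂ := LinearMap.toContinuousLinearMap (𝕜 := ℂ) (E := E) l
  exact (l'.restrictScalars ℝ).hasFDerivAt.comp_hasDerivAt 0 h

/-! ### Derivatives of representations of `P` -/

/-- `δ` is the derivative of the representation `ρ` of `P`. -/
def RepDeriv (ρ : Representation ℂ (parabolicSubgroup D) W)
    (δ : D.parabolic →ₗ[ℂ] Module.End ℂ W) : Prop :=
  ∀ (p : ℝ → parabolicSubgroup D) (v : D.parabolic),
    HasVel (E := E) (fun t => (p t : G)) (v : GroupLieAlgebra 𝓘(ℂ, E) G) →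
      HasCDeriv (fun t => ρ (p t)) (δ v)

/-- The one-parameter subgroup of `P` with velocity `v ∈ 𝔭`. -/
noncomputable def expP (hC : C ∈ D.kahlerCone) (v : D.parabolic) (t : ℝ) : parabolicSubgroup D :=
  ⟨lieExp (t • (v : GroupLieAlgebra 𝓘(ℂ, E) G)),
    lieExp_mem_parabolicSubgroup hC ((D.parabolic.restrictScalars ℝ).smul_mem t v.2)⟩

theorem hasVel_expP (hC : C ∈ D.kahlerCone) (v : D.parabolic) :
    HasVel (E := E) (fun t => (expP hC v t : G)) (v : GroupLieAlgebra 𝓘(ℂ, E) G) :=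
  hasVel_lieExp (E := E) (v : GroupLieAlgebra 𝓘(ℂ, E) G)

/-- Near 1 the matrix coefficients extend to holomorphic functions on open subsets of G. Their
complex differentials at 1 give the derivative, which is therefore complex linear in v. -/
theorem IsHolomorphicRep.exists_repDeriv (hC : C ∈ D.kahlerCone)
    {ρ : Representation ℂ (parabolicSubgroup D) W} (hρ : IsHolomorphicRep ρ) :
    ∃ δ, RepDeriv ρ δ := by
  let b := Module.finBasis ℂ W
  choose O hO h1O φ hφ hφρ using fun (w : W) i => hρ w (b.coord i) 1
  let T : W → D.parabolic → W := fun w v =>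
    ∑ i, (mfd ℂ (φ w i) 1 : E →L[ℂ] ℂ) (v : GroupLieAlgebra 𝓘(ℂ, E) G) • b i
  have hT : ∀ (p : ℝ → parabolicSubgroup D) (v : D.parabolic),
      HasVel (E := E) (fun t => (p t : G)) (v : GroupLieAlgebra 𝓘(ℂ, E) G) →
      ∀ w, HasCDeriv (fun t => ρ (p t) w) (T w v) := by
    intro p v hp w
    refine hasCDeriv_of_coord b fun i => ?_
    have e : b.coord i (T w v) =
        (mfd ℂ (φ w i) 1 : E →L[ℂ] ℂ) (v : GroupLieAlgebra 𝓘(ℂ, E) G) :=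
      congrFun (b.repr_sum_self fun i =>
        (mfd ℂ (φ w i) 1 : E →L[ℂ] ℂ) (v : GroupLieAlgebra 𝓘(ℂ, E) G)) i
    have hφ1 : MDifferentiableAt 𝓘(ℂ, E) 𝓘(ℂ, ℂ) (φ w i) 1 :=
      (hφ w i).mdifferentiableAt ((hO w i).mem_nhds (h1O w i))
    have h1 : HasD (φ w i) (1 : G) ((mfd ℂ (φ w i) 1 : E →L[ℂ] ℂ).restrictScalars ℝ) :=
      hφ1.hasMFDerivAt.restrictScalarsReal
    have h2 := (hp.hasDerivAt (1 : G) (F := φ w i) hφ1.restrictScalarsReal).congr_deriv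
      ((LD_eq h1 _).trans (by rw [lmap_one]))
    have h3 : ∀ᶠ t in nhds (0 : ℝ), (p t : G) ∈ O w i := by
      refine hp.2.continuousAt.eventually_mem ((hO w i).mem_nhds ?_)
      have h4 : (p 0 : G) = 1 := hp.1
      simp only [h4]
      exact h1O w i
    rw [e]
    refine h2.congr_of_eventuallyEq (h3.mono fun t ht => ?_)
    simp only [one_mul]
    exact hφρ w i _ ht
  -- The extensions were chosen separately for each w, so linearity in w comes from the uniqueness
  -- of derivatives along expP.
  have hlin : ∀ w w' (a : ℂ) v, T (w + a • w') v = T w v + a • T w' v := by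
    intro w w' a v
    have h := hasVel_expP hC v
    refine (hT _ v h _).unique ?_
    have := (hT _ v h w).add ((hT _ v h w').map (a • LinearMap.id))
    simpa using this
  have h0 : ∀ v, T 0 v = 0 := fun v => by simpa using hlin 0 0 1 v
  refine ⟨{ toFun := fun v =>
              { toFun := fun w => T w v
                map_add' := fun w w' => by simpa using hlin w w' 1 v
                map_smul' := fun a w => by simpa [h0] using hlin 0 w a v }
            map_add' := fun v v' => LinearMap.ext fun w => ?_
            map_smul' := fun a v => LinearMap.ext fun w => ?_ },
    fun p v hp => hasCDeriv_hom (hT p v hp)⟩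
  · change T w (v + v') = T w v + T w v'
    simp only [T]
    rw [← Finset.sum_add_distrib]
    refine Finset.sum_congr rfl fun i _ => ?_
    rw [← add_smul]
    congr 1
    exact map_add (mfd ℂ (φ w i) 1 : E →L[ℂ] ℂ) _ _
  · change T w (a • v) = a • T w v
    simp only [T]
    rw [Finset.smul_sum]
    refine Finset.sum_congr rfl fun i _ => ?_
    rw [smul_smul]
    congr 1
    exact map_smul (mfd ℂ (φ w i) 1 : E →L[ℂ] ℂ) _ _

/-- The derivative of a tensor product of representations. -/
noncomputable def tprodDeriv (δ : D.parabolic →ₗ[ℂ] Module.End ℂ W)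
    (δ' : D.parabolic →ₗ[ℂ] Module.End ℂ W') : D.parabolic →ₗ[ℂ] Module.End ℂ (W ⊗[ℂ] W') where
  toFun v := TensorProduct.map (δ v) 1 + TensorProduct.map 1 (δ' v)
  map_add' v v' := by
    simp only [map_add, TensorProduct.map_add_left, TensorProduct.map_add_right]
    abel
  map_smul' a v := by
    simp only [map_smul, TensorProduct.map_smul_left, TensorProduct.map_smul_right, smul_add,
      RingHom.id_apply]

theorem RepDeriv.tprod {ρ : Representation ℂ (parabolicSubgroup D) W}
    {ρ' : Representation ℂ (parabolicSubgroup D) W'} {δ : D.parabolic →ₗ[ℂ] Module.End ℂ W}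
    {δ' : D.parabolic →ₗ[ℂ] Module.End ℂ W'} (h : RepDeriv ρ δ) (h' : RepDeriv ρ' δ') :
    RepDeriv (ρ.tprod ρ') (tprodDeriv δ δ') := fun p v hp => by
  have h1 : p 0 = 1 := Subtype.ext hp.1
  have h2 := (h p v hp).bilin (h' p v hp) (TensorProduct.mapBilinear (RingHom.id ℂ) W W' W W')
  have e : ρ (p 0) = 1 := by rw [h1, map_one]
  have e' : ρ' (p 0) = 1 := by rw [h1, map_one]
  rw [e, e'] at h2
  exact h2

/-- The derivative of the action of `P` on `𝔤/𝔭`. -/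
noncomputable def tangentDeriv (hC : C ∈ D.kahlerCone) :
    D.parabolic →ₗ[ℂ] Module.End ℂ (TangentFiber D) where
  toFun v := Submodule.mapQ _ _
    (LieAlgebra.ad ℂ (GroupLieAlgebra 𝓘(ℂ, E) G) v : Module.End ℂ (GroupLieAlgebra 𝓘(ℂ, E) G))
    fun _ hw => lie_mem_parabolic hC v.2 hw
  map_add' v v' := by
    ext w
    change D.parabolic.mkQ ⁅(v : GroupLieAlgebra 𝓘(ℂ, E) G) + v', w⁆ =
      D.parabolic.mkQ ⁅(v : GroupLieAlgebra 𝓘(ℂ, E) G), w⁆ +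
        D.parabolic.mkQ ⁅(v' : GroupLieAlgebra 𝓘(ℂ, E) G), w⁆
    rw [add_lie, map_add]
  map_smul' a v := by
    ext w
    change D.parabolic.mkQ ⁅a • (v : GroupLieAlgebra 𝓘(ℂ, E) G), w⁆ =
      a • D.parabolic.mkQ ⁅(v : GroupLieAlgebra 𝓘(ℂ, E) G), w⁆
    rw [smul_lie, map_smul]

theorem tangentDeriv_mkQ (hC : C ∈ D.kahlerCone) (v : D.parabolic)
    (w : GroupLieAlgebra 𝓘(ℂ, E) G) :
    tangentDeriv hC v (D.parabolic.mkQ w) =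
      D.parabolic.mkQ ⁅(v : GroupLieAlgebra 𝓘(ℂ, E) G), w⁆ := rfl

theorem repDeriv_tangentRep (hC : C ∈ D.kahlerCone) :
    RepDeriv (tangentRep D) (tangentDeriv hC) := fun p v hp => by
  refine hasCDeriv_hom fun w => ?_
  obtain ⟨w, rfl⟩ := D.parabolic.mkQ_surjective w
  exact ((hasCDeriv_AdMap hp).apply_const w).map D.parabolic.mkQ

/-- The derivative of the action of `P` on `(𝔤/𝔭)^{⊗m}`. -/
noncomputable def tangentPowDeriv (hC : C ∈ D.kahlerCone) (m : ℕ) :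
    D.parabolic →ₗ[ℂ] Module.End ℂ (⨂[ℂ]^m (TangentFiber D)) where
  toFun v := ∑ i, PiTensorProduct.map (Function.update (fun _ => 1) i (tangentDeriv hC v))
  map_add' v v' := by
    rw [← Finset.sum_add_distrib]
    refine Finset.sum_congr rfl fun i _ => ?_
    rw [map_add, PiTensorProduct.map_update_add]
  map_smul' a v := by
    rw [Finset.smul_sum]
    refine Finset.sum_congr rfl fun i _ => ?_
    rw [map_smul, PiTensorProduct.map_update_smul]
    rfl

theorem tangentPowDeriv_tprod (hC : C ∈ D.kahlerCone) (m : ℕ) (v : D.parabolic)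
    (a : Fin m → TangentFiber D) :
    tangentPowDeriv hC m v (PiTensorProduct.tprod ℂ a) =
      ∑ i, PiTensorProduct.tprod ℂ (Function.update a i (tangentDeriv hC v (a i))) := by
  change (∑ i, PiTensorProduct.map (Function.update (fun _ => 1) i (tangentDeriv hC v)) :
    Module.End ℂ _) _ = _
  rw [LinearMap.sum_apply]
  refine Finset.sum_congr rfl fun i _ => ?_
  rw [PiTensorProduct.map_tprod]
  congr 1
  funext j
  by_cases h : j = i
  · subst h; simp
  · simp [h]

theorem repDeriv_tangentPowRep (hC : C ∈ D.kahlerCone) (m : ℕ) :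
    RepDeriv (tangentPowRep D m) (tangentPowDeriv hC m) := fun p v hp => by
  have h1 : p 0 = 1 := Subtype.ext hp.1
  have h2 := hasCDeriv_multilinear (W := Module.End ℂ (TangentFiber D))
    (W₁ := Module.End ℂ (⨂[ℂ]^m (TangentFiber D)))
    (PiTensorProduct.mapMultilinear ℂ (fun _ : Fin m => TangentFiber D)
      (fun _ : Fin m => TangentFiber D))
    (fun _ => repDeriv_tangentRep hC p v hp)
  rw [h1, map_one] at h2
  exact h2

/-! ### The nilradical acts trivially on simple modules -/

theorem RepDeriv.conj (hC : C ∈ D.kahlerCone) {ρ : Representation ℂ (parabolicSubgroup D) W}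
    {δ : D.parabolic →ₗ[ℂ] Module.End ℂ W} (h : RepDeriv ρ δ) (p : parabolicSubgroup D)
    (v : D.parabolic) :
    ρ p * δ v = δ ⟨AdMap (p : G) v, AdMap_mem_parabolic p.2 v.2⟩ * ρ p := by
  have h1 := h (fun t => p * expP hC v t * p⁻¹)
    ⟨AdMap (p : G) v, AdMap_mem_parabolic p.2 v.2⟩ ((hasVel_expP hC v).conj (p : G))
  have h2 := (h _ v (hasVel_expP hC v)).map
    (LinearMap.mulLeftRight ℂ (ρ p, ρ p⁻¹) : Module.End ℂ W →ₗ[ℂ] Module.End ℂ W)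
  have h3 := h1.unique (h2.congr (Filter.Eventually.of_forall fun t => by
    simp only [map_mul, LinearMap.mulLeftRight_apply]))
  rw [h3, LinearMap.mulLeftRight_apply, mul_assoc, ← map_mul, inv_mul_cancel, map_one, mul_one]

/-- Differentiate ρ(p)δ(w) = δ(Ad(p)w)ρ(p) along p = exp(tv). -/
theorem RepDeriv.commutator (hC : C ∈ D.kahlerCone)
    {ρ : Representation ℂ (parabolicSubgroup D) W} {δ : D.parabolic →ₗ[ℂ] Module.End ℂ W}
    (h : RepDeriv ρ δ) (v w : D.parabolic) :
    δ v * δ w = δ ⟨⁅(v : GroupLieAlgebra 𝓘(ℂ, E) G), (w : GroupLieAlgebra 𝓘(ℂ, E) G)⁆,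
      lie_mem_parabolic hC v.2 w.2⟩ + δ w * δ v := by
  -- A linear extension to all of 𝔤 removes the membership proofs, so that the derivative of Ad as a
  -- map on 𝔤 can be inserted.
  obtain ⟨δ', hδ'⟩ := LinearMap.exists_extend δ
  have he : ∀ z (hz : z ∈ D.parabolic), δ ⟨z, hz⟩ = δ' z := fun z hz => by
    rw [← hδ']; rfl
  have hv := hasVel_expP hC v
  have h0 : expP hC v 0 = 1 := Subtype.ext hv.1
  have h1 := (h _ v hv).map (LinearMap.mulRight ℂ (δ w))
  have h2 := ((hasCDeriv_AdMap hv).apply_const (w : GroupLieAlgebra 𝓘(ℂ, E) G)).map δ'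
  have h3 := h2.bilin (h _ v hv) (LinearMap.mul ℂ (Module.End ℂ W))
  have h4 := h1.unique (h3.congr (Filter.Eventually.of_forall fun t => by
    simp only [LinearMap.mulRight_apply, LinearMap.mul_apply']
    rw [h.conj hC, he]))
  rw [h0, map_one] at h4
  simp only [LinearMap.mulRight_apply, LinearMap.mul_apply', mul_one, OneMemClass.coe_one,
    AdMap_one] at h4
  exact h4.trans (congrArg₂ (· + ·) (he _ _).symm (congrArg (· * δ v) (he w w.2).symm))

/-- The common kernel of 𝔫⁺ is P-stable since Ad(P) preserves 𝔫⁺. It is nonzero: an eigenvector of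
δ(C) whose eigenvalue has maximal real part is killed by each x_α, which would raise the eigenvalue
by α(C) > 0. By simplicity the kernel is everything. -/
theorem RepDeriv.eq_zero_of_isIrreducible (hC : C ∈ D.kahlerCone) (X : D.RootVectors)
    {ρ : Representation ℂ (parabolicSubgroup D) W} {δ : D.parabolic →ₗ[ℂ] Module.End ℂ W}
    (h : RepDeriv ρ δ) (hs : ρ.IsIrreducible) {v : D.parabolic}
    (hv : (v : GroupLieAlgebra 𝓘(ℂ, E) G) ∈ D.nPos) : δ v = 0 := by
  let S : Subrepresentation ρ :=
    { toSubmodule := ⨅ v : {v : D.parabolic // (v : GroupLieAlgebra 𝓘(ℂ, E) G) ∈ D.nPos},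
        LinearMap.ker (δ v)
      apply_mem_toSubmodule := fun p w hw => by
        simp only [Submodule.mem_iInf, LinearMap.mem_ker] at hw ⊢
        intro v
        let v' : D.parabolic := ⟨AdMap (p⁻¹ : G) v, AdMap_mem_parabolic (inv_mem p.2) v.1.2⟩
        have h1 := h.conj hC p v'
        have h2 : (⟨AdMap (p : G) v', AdMap_mem_parabolic p.2 v'.2⟩ : D.parabolic) = v.1 :=
          Subtype.ext (AdMap_apply_inv _ _)
        rw [h2] at h1
        have h3 := congrArg (fun A : Module.End ℂ W => A w) h1
        simp only [Module.End.mul_apply] at h3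
        rw [← h3, hw ⟨v', AdMap_mem_nPos X hC (inv_mem p.2) v.2⟩, map_zero] }
  have hS : S ≠ ⊥ := by
    have hW : Nontrivial W := by
      by_contra hW
      rw [not_nontrivial_iff_subsingleton] at hW
      exact hs.toNontrivial.exists_pair_ne.elim fun a ha => ha.elim fun b hb => hb <|
        Subrepresentation.toSubmodule_injective (Subsingleton.elim _ _)
    let T : Module.End ℂ W := δ ⟨C, cartan_mem_parabolic C⟩
    have hfin : {μ : ℂ | T.HasEigenvalue μ}.Finite := Module.End.finite_hasEigenvalue T
    obtain ⟨μ, hμ, hmax⟩ := Set.exists_max_image _ Complex.re hfin (Module.End.exists_eigenvalue T)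
    obtain ⟨w, hw⟩ := hμ.exists_hasEigenvector
    have key : ∀ α : D.XiPos, δ ⟨X.x α, nPos_le_parabolic (X.mem_nPos α.2)⟩ w = 0 := by
      intro α
      by_contra hne
      have h1 := h.commutator hC ⟨C, cartan_mem_parabolic C⟩
        ⟨X.x α, nPos_le_parabolic (X.mem_nPos α.2)⟩
      have h2 : (⟨⁅(C : GroupLieAlgebra 𝓘(ℂ, E) G), X.x α⁆, lie_mem_parabolic hC
          (cartan_mem_parabolic C) (nPos_le_parabolic (X.mem_nPos α.2))⟩ : D.parabolic) =
          α.1 C • ⟨X.x α, nPos_le_parabolic (X.mem_nPos α.2)⟩ :=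
        Subtype.ext (lie_cartan (X.mem α α.2.1.1) C)
      rw [h2, map_smul] at h1
      have h3 := congrArg (fun A : Module.End ℂ W => A w) h1
      simp only [Module.End.mul_apply, LinearMap.add_apply, LinearMap.smul_apply] at h3
      rw [show δ ⟨C, cartan_mem_parabolic C⟩ w = μ • w from hw.apply_eq_smul, map_smul,
        ← add_smul] at h3
      have h4 : T.HasEigenvalue (α.1 C + μ) :=
        Module.End.hasEigenvalue_of_hasEigenvector
          (Module.End.hasEigenvector_iff.mpr ⟨Module.End.mem_eigenspace_iff.mpr h3, hne⟩)
      have h5 := hmax _ h4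
      have h6 := ((mem_XiPos_iff hC).mp α.2).2
      rw [Complex.add_re] at h5
      linarith
    have hmem : w ∈ S.toSubmodule := by
      refine (Submodule.mem_iInf _).mpr fun v => ?_
      obtain ⟨⟨v, hv⟩, hv'⟩ := v
      change δ ⟨v, hv⟩ w = 0
      obtain ⟨δ', hδ'⟩ := LinearMap.exists_extend δ
      have he : ∀ z (hz : z ∈ D.parabolic), δ ⟨z, hz⟩ = δ' z := fun z hz => by
        rw [← hδ']; rfl
      have h1 : D.nPos ≤ LinearMap.ker (δ'.flip w) := by
        rw [X.nPos_eq_span, Submodule.span_le]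
        rintro _ ⟨α, rfl⟩
        have h2 := key α
        rw [he] at h2
        exact h2
      rw [he]
      exact h1 hv'
    intro h0
    rw [h0] at hmem
    exact hw.2 ((Submodule.mem_bot ℂ).mp hmem)
  have hT := (hs.eq_bot_or_eq_top S).resolve_left hS
  ext w
  have hw : w ∈ S.toSubmodule := by rw [hT]; exact Submodule.mem_top
  have h3 := (Submodule.mem_iInf _).mp hw ⟨v, hv⟩
  exact h3

end FlagCR

namespace FlagCR

open ParabolicData

variable {E : Type*} [NormedAddCommGroup E] [NormedSpace ℂ E] [FiniteDimensional ℂ E]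
  [CompleteSpace E]
  {G : Type*} [TopologicalSpace G] [ChartedSpace E G] [Group G] [LieGroup 𝓘(ℂ, E) ω G]
  [T2Space G] [LieAlgebra.IsKilling ℂ (GroupLieAlgebra 𝓘(ℂ, E) G)]
  {D : ParabolicData (GroupLieAlgebra 𝓘(ℂ, E) G)} {C : D.t} {X : D.RootVectors}
  {W : Type*} [AddCommGroup W] [Module ℂ W] [FiniteDimensional ℂ W]
  {ρ : Representation ℂ (parabolicSubgroup D) W} {δ : D.parabolic →ₗ[ℂ] Module.End ℂ W}
  {F Φ : G → W}

/-! ### Sections in the compact picture -/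

/-- `F` is `P`-equivariant, and its restriction to `U` is the restriction of the smooth
function `Φ`. -/
structure IsCompactlySmooth (X : D.RootVectors) (ρ : Representation ℂ (parabolicSubgroup D) W)
    (F Φ : G → W) : Prop where
  equivariant : ∀ (g : G) (p : parabolicSubgroup D), F (g * p) = ρ p⁻¹ (F g)
  smooth : VSmooth E Φ
  eq_on : ∀ u : compactSubgroup X, F u = Φ u

theorem HasCDeriv.leftInvDeriv_eq {v : GroupLieAlgebra 𝓘(ℂ, E) G} {g : G} {w : W}
    (h : HasCDeriv (fun t : ℝ => F (g * lieExp (t • v))) w) : leftInvDeriv v F g = w := by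
  have h' : leftInvDeriv v F g = curveDeriv fun t : ℝ => F (g * lieExp (t • v)) := by
    rw [leftInvDeriv]
    congr 1
  rw [h', h.curveDeriv_eq]

section

variable {a b : GroupLieAlgebra 𝓘(ℂ, E) G}

/-- The derivative of a section at a point of `U` in the direction of `a + b`, `a ∈ 𝔲`,
`b ∈ 𝔭`. -/
theorem IsCompactlySmooth.hasCDeriv (hC : C ∈ D.kahlerCone) (hF : IsCompactlySmooth X ρ F Φ)
    (hδ : RepDeriv ρ δ) (u : compactSubgroup X) (ha : a ∈ X.compactForm) (hb : b ∈ D.parabolic) :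
    HasCDeriv (fun t : ℝ => F ((u : G) * lieExp (t • (a + b))))
      (leftInvDeriv a Φ u - δ ⟨b, hb⟩ (F u)) := by
  let c : ℝ → G := fun t => lieExp (t • (a + b))
  let ca : ℝ → compactSubgroup X := fun t =>
    ⟨lieExp (t • a), lieExp_mem (X.compactForm.smul_mem t ha)⟩
  let cb : ℝ → parabolicSubgroup D := expP hC ⟨b, hb⟩
  have hc : HasVel (E := E) c (a + b) := hasVel_lieExp (E := E) _
  have hca : HasVel (E := E) (fun t => (ca t : G)) a := hasVel_lieExp (E := E) _
  have hcb : HasVel (E := E) (fun t => (cb t : G)) b := hasVel_expP hC ⟨b, hb⟩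
  -- The error term ε(t) = exp(ta)⁻¹ exp(t(a+b)) exp(tb)⁻¹ has velocity 0. Splitting it into a'(t) ∈
  -- U and p'(t) ∈ P gives exp(t(a+b)) = (exp(ta) a'(t)) (p'(t) exp(tb)).
  have hε : HasVel (E := E) (fun t => ((ca t : G)⁻¹ * c t) * (cb t : G)⁻¹) 0 := by
    have h := (hca.inv.mul hc).mul hcb.inv
    have e : -a + (a + b) + -b = 0 := by abel
    exact e ▸ h
  obtain ⟨a', p', ha', hp', h⟩ := exists_factorization (E := E)
    (S₁ := X.compactForm) (S₂ := D.parabolic.restrictScalars ℝ) (X.compactForm_sup_parabolic hC)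
    (H₁ := compactSubgroup X) (H₂ := parabolicSubgroup D) (fun v hv => lieExp_mem hv)
    (fun v hv => lieExp_mem_parabolicSubgroup hC hv) hε
  have hk : HasVel (E := E) (fun t => ((ca t * a' t : compactSubgroup X) : G)) a := by
    have h := hca.mul ha'
    have e : a + 0 = a := add_zero a
    exact e ▸ h
  have hp : HasVel (E := E) (fun t => (((p' t * cb t)⁻¹ : parabolicSubgroup D) : G))
      ((-⟨b, hb⟩ : D.parabolic) : GroupLieAlgebra 𝓘(ℂ, E) G) := by
    have h := (hp'.mul hcb).inv
    have e : -(0 + b) = -b := by rw [zero_add]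
    have h' : HasVel (E := E) (fun t => ((p' t : G) * (cb t : G))⁻¹) (-b) := e ▸ h
    exact h'
  -- F itself is not assumed differentiable; along the split curve it equals ρ of a curve in P
  -- applied to Φ along a curve in U. The P-factor enters inverted, hence the term −δ(b).
  have h1 := (hδ _ _ hp).apply (hF.smooth.hasCDeriv hk u)
  have e0 : (p' 0 * cb 0)⁻¹ = 1 := Subtype.ext hp.1
  have e1 : ((ca 0 * a' 0 : compactSubgroup X) : G) = 1 := hk.1
  rw [e0, map_one, map_neg, e1, mul_one, ← hF.eq_on, LinearMap.neg_apply, Module.End.one_apply,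
    neg_add_eq_sub] at h1
  refine h1.congr (h.mono fun t ht => ?_)
  have h2 : c t = (ca t * a' t : compactSubgroup X) * (p' t * cb t : parabolicSubgroup D) := by
    have h3 : c t = ca t * ((ca t : G)⁻¹ * c t * (cb t : G)⁻¹) * cb t := by group
    rw [h3, ht]
    push_cast
    group
  change F (u * c t) = _
  rw [h2, ← mul_assoc, hF.equivariant, ← Subgroup.coe_mul, hF.eq_on]
  rfl

theorem IsCompactlySmooth.leftInvDeriv_eq (hC : C ∈ D.kahlerCone) (hF : IsCompactlySmooth X ρ F Φ)
    (hδ : RepDeriv ρ δ) (u : compactSubgroup X) (ha : a ∈ X.compactForm) (hb : b ∈ D.parabolic) :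
    leftInvDeriv (a + b) F (u : G) = leftInvDeriv a Φ u - δ ⟨b, hb⟩ (F u) :=
  (hF.hasCDeriv hC hδ u ha hb).leftInvDeriv_eq

theorem IsCompactlySmooth.hasCDeriv_leftInvDeriv (hC : C ∈ D.kahlerCone)
    (hF : IsCompactlySmooth X ρ F Φ) (hδ : RepDeriv ρ δ) (u : compactSubgroup X)
    (v : GroupLieAlgebra 𝓘(ℂ, E) G) :
    HasCDeriv (fun t : ℝ => F ((u : G) * lieExp (t • v))) (leftInvDeriv v F (u : G)) := by
  have hv : v ∈ X.compactForm ⊔ D.parabolic.restrictScalars ℝ := by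
    rw [X.compactForm_sup_parabolic hC]; exact Submodule.mem_top
  obtain ⟨a, ha, b, hb, rfl⟩ := Submodule.mem_sup.mp hv
  rw [hF.leftInvDeriv_eq hC hδ u ha hb]
  exact hF.hasCDeriv hC hδ u ha hb

end

/-! ### Complexified derivatives -/

/-- The derivative along `x = v₁ + i v₂`, `v₁, v₂ ∈ 𝔲`, extended complex linearly. -/
noncomputable def derivC (X : D.RootVectors) (x : GroupLieAlgebra 𝓘(ℂ, E) G) (Φ : G → W) : G → W :=
  leftInvDeriv (X.rePart x : GroupLieAlgebra 𝓘(ℂ, E) G) Φ +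
    Complex.I • leftInvDeriv (X.imPart x : GroupLieAlgebra 𝓘(ℂ, E) G) Φ

theorem VSmooth.derivC (hΦ : VSmooth E Φ) (x : GroupLieAlgebra 𝓘(ℂ, E) G) :
    VSmooth E (derivC X x Φ) :=
  (hΦ.deriv _).add ((hΦ.deriv _).smul _)

theorem derivC_of_eq {x : GroupLieAlgebra 𝓘(ℂ, E) G}
    {v w : X.compactForm} (h : x = (v : GroupLieAlgebra 𝓘(ℂ, E) G) + Complex.I • w) :
    FlagCR.derivC X x Φ = leftInvDeriv (v : GroupLieAlgebra 𝓘(ℂ, E) G) Φ +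
      Complex.I • leftInvDeriv (w : GroupLieAlgebra 𝓘(ℂ, E) G) Φ := by
  obtain ⟨h1, h2⟩ := X.eq_parts h
  rw [FlagCR.derivC, h1, h2]

theorem VSmooth.derivC_add (hΦ : VSmooth E Φ) (x y : GroupLieAlgebra 𝓘(ℂ, E) G) :
    FlagCR.derivC X (x + y) Φ = FlagCR.derivC X x Φ + FlagCR.derivC X y Φ := by
  have h : x + y = ((X.rePart x + X.rePart y : X.compactForm) : GroupLieAlgebra 𝓘(ℂ, E) G) +
      Complex.I • ((X.imPart x + X.imPart y : X.compactForm) : GroupLieAlgebra 𝓘(ℂ, E) G) := by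
    conv_lhs => rw [X.rePart_add_imPart x, X.rePart_add_imPart y]
    push_cast
    module
  rw [derivC_of_eq h, Submodule.coe_add, Submodule.coe_add, hΦ.deriv_add_left,
    hΦ.deriv_add_left, FlagCR.derivC, FlagCR.derivC]
  module

theorem VSmooth.derivC_smul (hΦ : VSmooth E Φ) (z : ℂ) (x : GroupLieAlgebra 𝓘(ℂ, E) G) :
    FlagCR.derivC X (z • x) Φ = z • FlagCR.derivC X x Φ := by
  have e : ∀ (r : ℝ) (y : GroupLieAlgebra 𝓘(ℂ, E) G), r • y = (r : ℂ) • y := fun r y =>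
    (Complex.coe_smul r y).symm
  have h : z • x = ((z.re • X.rePart x + (-z.im) • X.imPart x : X.compactForm) :
      GroupLieAlgebra 𝓘(ℂ, E) G) + Complex.I •
        ((z.re • X.imPart x + z.im • X.rePart x : X.compactForm) :
          GroupLieAlgebra 𝓘(ℂ, E) G) := by
    conv_lhs => rw [X.rePart_add_imPart x, ← Complex.re_add_im z]
    simp only [Submodule.coe_add, Submodule.coe_smul, e, Complex.ofReal_neg]
    match_scalars
    · ring
    · linear_combination (z.im : ℂ) * Complex.I_mul_I
  rw [derivC_of_eq h, Submodule.coe_add, Submodule.coe_add, hΦ.deriv_add_left,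
    hΦ.deriv_add_left, FlagCR.derivC]
  simp only [Submodule.coe_smul, hΦ.deriv_smul_left]
  conv_rhs => rw [← Complex.re_add_im z]
  rw [Complex.ofReal_neg]
  match_scalars
  · ring
  · linear_combination -(z.im : ℂ) * Complex.I_mul_I

theorem VSmooth.derivC_commutator (hΦ : VSmooth E Φ) (x y : GroupLieAlgebra 𝓘(ℂ, E) G) :
    FlagCR.derivC X x (FlagCR.derivC X y Φ) - FlagCR.derivC X y (FlagCR.derivC X x Φ) =
      FlagCR.derivC X ⁅x, y⁆ Φ := by
  let v := X.rePart x
  let w := X.imPart x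
  let v' := X.rePart y
  let w' := X.imPart y
  have h : ⁅x, y⁆ = ((⟨_, X.lie_mem_compactForm v.2 v'.2⟩ - ⟨_, X.lie_mem_compactForm w.2 w'.2⟩ :
      X.compactForm) : GroupLieAlgebra 𝓘(ℂ, E) G) + Complex.I •
      ((⟨_, X.lie_mem_compactForm v.2 w'.2⟩ + ⟨_, X.lie_mem_compactForm w.2 v'.2⟩ :
        X.compactForm) : GroupLieAlgebra 𝓘(ℂ, E) G) := by
    conv_lhs => rw [X.rePart_add_imPart x, X.rePart_add_imPart y]
    simp only [Submodule.coe_add, Submodule.coe_sub, lie_add, add_lie, lie_smul, smul_lie]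
    match_scalars <;> first
      | ring1
      | linear_combination Complex.I_mul_I
  have hsub : ∀ a b : GroupLieAlgebra 𝓘(ℂ, E) G,
      leftInvDeriv (a - b) Φ = leftInvDeriv a Φ - leftInvDeriv b Φ := fun a b => by
    rw [eq_sub_iff_add_eq, ← hΦ.deriv_add_left, sub_add_cancel]
  rw [derivC_of_eq h, Submodule.coe_add, Submodule.coe_sub, hsub, hΦ.deriv_add_left]
  simp only [← hΦ.deriv_bracket]
  simp only [FlagCR.derivC]
  have d := fun a => hΦ.deriv (a : GroupLieAlgebra 𝓘(ℂ, E) G)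
  simp only [(d _).deriv_add ((d _).smul _), (d _).deriv_smul]
  match_scalars <;> first
      | ring1
      | linear_combination Complex.I_mul_I
      | linear_combination -Complex.I_mul_I

/-- With x = v + iw one has θx = 2v + (−x) and iθx = 2w + ix, each a sum of an element of 𝔲 and one
of 𝔭. In ½(dF(θx) + i dF(iθx)) the 𝔲-parts add up to R_x Φ, and the two 𝔭-parts add up to δ(x)F. -/
theorem IsCompactlySmooth.dbar_eq (hC : C ∈ D.kahlerCone) (hF : IsCompactlySmooth X ρ F Φ)
    (hδ : RepDeriv ρ δ) (u : compactSubgroup X) {x : GroupLieAlgebra 𝓘(ℂ, E) G}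
    (hx : x ∈ D.parabolic) :
    dbar F (u : G) (X.θ x) = derivC X x Φ u + δ ⟨x, hx⟩ (F u) := by
  have hx0 := X.rePart_add_imPart x
  have hθ := X.θ_add_I_smul (X.rePart x) (X.imPart x)
  rw [← hx0] at hθ
  have e1 : X.θ x = (2 : ℝ) • (X.rePart x : GroupLieAlgebra 𝓘(ℂ, E) G) + -x := by
    rw [hθ, ← Complex.coe_smul, Complex.ofReal_ofNat]
    linear_combination (norm := module) (1 : ℂ) • hx0
  have e2 : Complex.I • X.θ x =
      (2 : ℝ) • (X.imPart x : GroupLieAlgebra 𝓘(ℂ, E) G) + Complex.I • x := by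
    have hx1 := congrArg (fun z => Complex.I • z) hx0
    simp only [smul_add, smul_smul, Complex.I_mul_I] at hx1
    rw [hθ, ← Complex.coe_smul, Complex.ofReal_ofNat, smul_sub, smul_smul, Complex.I_mul_I]
    linear_combination (norm := module) (-1 : ℂ) • hx1
  have h1 := hF.leftInvDeriv_eq hC hδ u (X.compactForm.smul_mem (2 : ℝ) (X.rePart x).2)
    (neg_mem hx)
  have h2 := hF.leftInvDeriv_eq hC hδ u (X.compactForm.smul_mem (2 : ℝ) (X.imPart x).2)
    (D.parabolic.smul_mem Complex.I hx)
  have d1 : δ ⟨-x, neg_mem hx⟩ = -δ ⟨x, hx⟩ := map_neg δ ⟨x, hx⟩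
  have d2 : δ ⟨Complex.I • x, D.parabolic.smul_mem Complex.I hx⟩ = Complex.I • δ ⟨x, hx⟩ :=
    map_smul δ Complex.I ⟨x, hx⟩
  rw [← e1, d1, hF.smooth.deriv_smul_left] at h1
  rw [← e2, d2, hF.smooth.deriv_smul_left] at h2
  rw [dbar, h1, h2, derivC]
  simp only [Pi.add_apply, Pi.smul_apply, LinearMap.neg_apply, LinearMap.smul_apply]
  push_cast
  match_scalars
  · ring
  · linear_combination (-1 / 2 : ℂ) * Complex.I_mul_I
  · ring

/-! ### The Cauchy-Riemann operator -/

/-- The right side of the formula solves the defining equations of `crValue`: on the vectors x_α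
because the metric is diagonal there, on 𝔫⁺ by linearity. The solution is unique since c_α ≠ 0. -/
theorem IsCompactlySmooth.metric_crValue_and_eq (hC : C ∈ D.kahlerCone)
    (hF : IsCompactlySmooth X ρ F Φ) (hδ : RepDeriv ρ δ) (u : compactSubgroup X) :
    (∀ x ∈ D.nPos, TensorProduct.rid ℂ W (LinearMap.lTensor W (D.metricForm C x)
      (crValue X C F u)) = dbar F u (X.θ x)) ∧
    crValue X C F u = ∑ α : D.XiPos, ((cval C α)⁻¹ • (derivC X (X.x α) Φ u +
      δ ⟨X.x α, nPos_le_parabolic (X.mem_nPos α.2)⟩ (F u))) ⊗ₜ X.yNeg α := by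
  have key : ∃ τ : W ⊗[ℂ] D.nNeg, (τ = ∑ α : D.XiPos, ((cval C α)⁻¹ • (derivC X (X.x α) Φ u +
      δ ⟨X.x α, nPos_le_parabolic (X.mem_nPos α.2)⟩ (F u))) ⊗ₜ X.yNeg α) ∧
      ∀ x ∈ D.nPos, TensorProduct.rid ℂ W (LinearMap.lTensor W (D.metricForm C x) τ) =
        dbar F u (X.θ x) := by
    refine ⟨_, rfl, fun x hx => ?_⟩
    have hx' : x ∈ Submodule.span ℂ (Set.range fun α : D.XiPos => X.x α) := by
      rwa [← X.nPos_eq_span]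
    rw [hF.dbar_eq hC hδ u (nPos_le_parabolic hx)]
    obtain ⟨δ', hδ'⟩ := LinearMap.exists_extend δ
    have he : ∀ z (hz : z ∈ D.parabolic), δ ⟨z, hz⟩ = δ' z := fun z hz => by
      rw [← hδ']; rfl
    simp only [he]
    clear hx
    induction hx' using Submodule.span_induction with
    | mem x hx =>
      obtain ⟨α, rfl⟩ := hx
      simp only
      rw [X.metric_sum_tmul, smul_inv_smul₀ (cval_ne_zero hC α.2)]
    | zero =>
      have h0 : D.metricForm C 0 = 0 := by
        simpa using metricForm_smul (D := D) (C := C) (0 : ℂ) 0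
      have h1 := hF.smooth.derivC_smul (X := X) (0 : ℂ) 0
      rw [zero_smul, zero_smul] at h1
      rw [h0, h1, LinearMap.lTensor_zero]
      simp
    | add x y _ _ hx hy =>
      rw [metricForm_add, LinearMap.lTensor_add, LinearMap.add_apply, map_add, hx, hy,
        hF.smooth.derivC_add, map_add, Pi.add_apply, LinearMap.add_apply]
      abel
    | smul a x _ hx =>
      rw [metricForm_smul, LinearMap.lTensor_smul, LinearMap.smul_apply, map_smul, hx,
        hF.smooth.derivC_smul, map_smul, Pi.smul_apply, LinearMap.smul_apply, smul_add]
  obtain ⟨τ, h1, h2⟩ := key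
  have h3 := Classical.epsilon_spec (p := fun τ : W ⊗[ℂ] D.nNeg => ∀ x ∈ D.nPos,
      TensorProduct.rid ℂ W (LinearMap.lTensor W (D.metricForm C x) τ) = dbar F (u : G) (X.θ x))
    ⟨τ, h2⟩
  refine ⟨h3, ?_⟩
  rw [← h1]
  exact X.metric_unique hC fun x hx => (h3 x hx).trans (h2 x hx).symm

/-- Move k to the right through the exponential, k exp(tv) = exp(t Ad(k)v) k, and apply
equivariance. -/
theorem IsCompactlySmooth.dbar_mul (hC : C ∈ D.kahlerCone) (hF : IsCompactlySmooth X ρ F Φ)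
    (hδ : RepDeriv ρ δ) (u : compactSubgroup X) (k : parabolicSubgroup D)
    (v : GroupLieAlgebra 𝓘(ℂ, E) G) :
    dbar F ((u : G) * k) v = ρ k⁻¹ (dbar F u (AdMap (k : G) v)) := by
  have key : ∀ v : GroupLieAlgebra 𝓘(ℂ, E) G, leftInvDeriv v F ((u : G) * k) =
      ρ k⁻¹ (leftInvDeriv (AdMap (k : G) v) F u) := by
    intro v
    have h1 := (hF.hasCDeriv_leftInvDeriv hC hδ u (AdMap (k : G) v)).map (ρ k⁻¹)
    refine HasCDeriv.leftInvDeriv_eq (h1.congr (Filter.Eventually.of_forall fun t => ?_))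
    have h2 : t • AdMap (k : G) v = AdMap (k : G) (t • v) := by
      rw [← Complex.coe_smul, ← Complex.coe_smul, map_smul]
    simp only
    rw [h2, lieExp_AdMap, ← hF.equivariant]
    congr 1
    group
  rw [dbar, key, key, dbar, map_smul, map_smul, map_add, map_smul]

theorem AdMap_mem_nNeg (hC : C ∈ D.kahlerCone) {k : G} (hk : k ∈ compactSubgroup X)
    (hk' : k ∈ parabolicSubgroup D) {v : GroupLieAlgebra 𝓘(ℂ, E) G} (hv : v ∈ D.nNeg) :
    AdMap k v ∈ D.nNeg := by
  have h : D.nNeg ≤ D.nNeg.comap (AdMap k) := by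
    conv_lhs => rw [X.nNeg_eq_span]
    rw [Submodule.span_le]
    rintro _ ⟨α, rfl⟩
    change AdMap k (X.x (-α)) ∈ D.nNeg
    have h1 : X.x (-α.1) = -X.θ (X.x α) := by rw [X.θ_x α.2.1.1, neg_neg]
    rw [h1, map_neg, ← θ_AdMap X hk]
    exact neg_mem (X.θ_mem_nNeg (AdMap_mem_nPos X hC hk' (X.mem_nPos α.2)))
  exact h hv

/-- For k ∈ U ∩ P, Ad(k) commutes with θ, preserves 𝔫⁺ and 𝔫⁻, and fixes C, so it respects the
pairing B(C, [x, y]). The transported tensor then solves the equations that characterize the value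
at uk. -/
theorem IsCompactlySmooth.crValue_mul (hC : C ∈ D.kahlerCone) (hF : IsCompactlySmooth X ρ F Φ)
    (hδ : RepDeriv ρ δ) (u k : compactSubgroup X) (hk : (k : G) ∈ parabolicSubgroup D) :
    LinearMap.lTensor W (nNegToFiber D) (crValue X C F ((u * k : compactSubgroup X) : G)) =
      ρ.tprod (tangentRep D) (⟨k, hk⟩ : parabolicSubgroup D)⁻¹
        (LinearMap.lTensor W (nNegToFiber D) (crValue X C F u)) := by
  let p : parabolicSubgroup D := ⟨k, hk⟩
  let A : D.nNeg →ₗ[ℂ] D.nNeg := (AdMap (k⁻¹ : G)).restrict fun v hv =>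
    AdMap_mem_nNeg (X := X) hC (inv_mem k.2) (inv_mem hk) hv
  have h1 : crValue X C F ((u * k : compactSubgroup X) : G) =
      TensorProduct.map (ρ p⁻¹) A (crValue X C F u) := by
    refine X.metric_unique hC fun x hx => ?_
    rw [(hF.metric_crValue_and_eq hC hδ (u * k)).1 x hx]
    have h2 := hF.dbar_mul hC hδ u p (X.θ x)
    have h3 := (hF.metric_crValue_and_eq hC hδ u).1 _ (AdMap_mem_nPos X hC hk hx)
    rw [← θ_AdMap X k.2, ← h3] at h2
    refine h2.trans ?_
    have h4 : D.metricForm C x ∘ₗ A = D.metricForm C (AdMap (k : G) x) := by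
      ext n
      change killingForm ℂ _ (C : GroupLieAlgebra 𝓘(ℂ, E) G) ⁅x, AdMap (k⁻¹ : G) n⁆ =
        killingForm ℂ _ (C : GroupLieAlgebra 𝓘(ℂ, E) G) ⁅AdMap (k : G) x, n⁆
      conv_rhs => rw [← AdMap_C X hC k.2 hk, killing_AdMap_left, AdMap_lie, AdMap_inv_apply]
    rw [← h4]
    generalize crValue X C F (u : G) = τ
    induction τ using TensorProduct.induction_on with
    | zero => simp
    | tmul w n => simp
    | add τ τ' h h' => simp only [map_add, h, h']
  rw [h1]
  generalize crValue X C F (u : G) = τ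
  induction τ using TensorProduct.induction_on with
  | zero => simp
  | tmul w n => rfl
  | add τ τ' h h' => simp only [map_add, h, h']

/-- Two factorizations of the same element differ by an element of U ∩ P, for which `crValue_mul`
applies; so the factorization chosen in the definition does not matter. -/
theorem IsCompactlySmooth.cauchyRiemann_mul (hC : C ∈ D.kahlerCone)
    (hF : IsCompactlySmooth X ρ F Φ) (hδ : RepDeriv ρ δ) (u : compactSubgroup X)
    (p : parabolicSubgroup D) :
    cauchyRiemann X C ρ F ((u : G) * p) = ρ.tprod (tangentRep D) p⁻¹
      (LinearMap.lTensor W (nNegToFiber D) (crValue X C F u)) := by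
  have h : ∃ (u' : compactSubgroup X) (p' : parabolicSubgroup D), (u : G) * p = u' * p' :=
    ⟨u, p, rfl⟩
  rw [cauchyRiemann, dif_pos h]
  have h1 := h.choose_spec.choose_spec
  generalize h.choose_spec.choose = p' at h1
  generalize h.choose = u' at h1
  have hk : ((u⁻¹ * u' : compactSubgroup X) : G) = (p * p'⁻¹ : parabolicSubgroup D) := by
    push_cast
    rw [inv_mul_eq_iff_eq_mul, ← mul_assoc, eq_mul_inv_iff_mul_eq, h1]
  have hk' : ((u⁻¹ * u' : compactSubgroup X) : G) ∈ parabolicSubgroup D := hk ▸ SetLike.coe_mem _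
  have h2 := hF.crValue_mul hC hδ u (u⁻¹ * u') hk'
  have h3 : (⟨_, hk'⟩ : parabolicSubgroup D) = p * p'⁻¹ := Subtype.ext hk
  rw [h3, mul_inv_cancel_left] at h2
  rw [h2, ← Module.End.mul_apply, ← map_mul]
  congr 2
  group

theorem IsCompactlySmooth.cauchyRiemann_equivariant (hC : C ∈ D.kahlerCone)
    (hF : IsCompactlySmooth X ρ F Φ) (hδ : RepDeriv ρ δ) (g : G) (p : parabolicSubgroup D) :
    cauchyRiemann X C ρ F (g * p) = ρ.tprod (tangentRep D) p⁻¹ (cauchyRiemann X C ρ F g) := by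
  by_cases h : ∃ (u : compactSubgroup X) (p' : parabolicSubgroup D), g = u * p'
  · obtain ⟨u, p', rfl⟩ := h
    rw [mul_assoc, ← Subgroup.coe_mul, hF.cauchyRiemann_mul hC hδ, hF.cauchyRiemann_mul hC hδ,
      ← Module.End.mul_apply, ← map_mul, mul_inv_rev]
  -- UP is stable under right multiplication by P, so off UP both sides are 0.
  · have h' : ¬ ∃ (u : compactSubgroup X) (p' : parabolicSubgroup D), g * p = u * p' := by
      rintro ⟨u, p', h1⟩
      refine h ⟨u, p' * p⁻¹, ?_⟩
      push_cast
      rw [← mul_assoc, ← h1, mul_inv_cancel_right]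
    rw [cauchyRiemann, dif_neg h', cauchyRiemann, dif_neg h, map_zero]

theorem IsCompactlySmooth.cauchyRiemann_apply (hC : C ∈ D.kahlerCone)
    (hF : IsCompactlySmooth X ρ F Φ) (hδ : RepDeriv ρ δ) (u : compactSubgroup X) :
    cauchyRiemann X C ρ F (u : G) = ∑ α : D.XiPos, ((cval C α)⁻¹ • (derivC X (X.x α) Φ u +
      δ ⟨X.x α, nPos_le_parabolic (X.mem_nPos α.2)⟩ (F u))) ⊗ₜ D.parabolic.mkQ (X.y α) := by
  have h := hF.cauchyRiemann_mul hC hδ u 1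
  rw [inv_one, map_one, OneMemClass.coe_one, mul_one, Module.End.one_apply,
    (hF.metric_crValue_and_eq hC hδ u).2, map_sum] at h
  exact h

end FlagCR

namespace FlagCR

/-! ### Symmetrized products -/

section Symmetrized

variable {I A : Type*}

/-- `c_β = c_{β₁} (c_{β₁} + c_{β₂}) ⋯ (c_{β₁} + ⋯ + c_{β_m})`. -/
def partialSumProd (c : I → ℂ) {m : ℕ} (β : Fin m → I) : ℂ :=
  ∏ k : Fin m, ∑ j ∈ Finset.Iic k, c (β j)

theorem partialSumProd_snoc (c : I → ℂ) {m : ℕ} (β : Fin m → I) (γ : I) :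
    partialSumProd c (Fin.snoc β γ : Fin (m + 1) → I) =
      partialSumProd c β * ((∑ j, c (β j)) + c γ) := by
  rw [partialSumProd, Fin.prod_univ_castSucc]
  congr 1
  · refine Finset.prod_congr rfl fun k _ => ?_
    rw [← Fin.map_castSuccEmb_Iic, Finset.sum_map]
    simp
  · have h : (Finset.Iic (Fin.last m)) = Finset.univ := by
      ext i; simp [Fin.le_last]
    rw [h, Fin.sum_univ_castSucc]
    simp

theorem insertNth_castSucc_snoc {m : ℕ} (k : Fin (m + 1)) (γ δ : I) (β : Fin m → I) :
    (k.castSucc.insertNth γ (Fin.snoc β δ : Fin (m + 1) → I) : Fin (m + 2) → I) =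
      Fin.snoc (k.insertNth γ β : Fin (m + 1) → I) δ := by
  rw [Fin.insertNth_eq_iff]
  refine ⟨by simp, ?_⟩
  funext j
  induction j using Fin.lastCases with
  | last => simp [Fin.removeNth]
  | cast j => simp [Fin.removeNth, Fin.castSucc_succAbove_castSucc]

variable [Ring A] [Algebra ℂ A]

/-- `R_β = R_{β_m} ⋯ R_{β_1}`. -/
def tupleProd (R : I → A) {m : ℕ} (β : Fin m → I) : A :=
  (List.ofFn β).foldl (fun a i => R i * a) 1

theorem tupleProd_snoc (R : I → A) {m : ℕ} (β : Fin m → I) (γ : I) :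
    tupleProd R (Fin.snoc β γ : Fin (m + 1) → I) = R γ * tupleProd R β := by
  rw [tupleProd, List.ofFn_succ', List.concat_eq_append, List.foldl_append]
  simp [tupleProd]

variable [Fintype I] [DecidableEq I] {c : I → ℂ} {R : I → A} {K : I → I → I → ℂ}

theorem sum_ne_zero_of_re_pos (hc : ∀ i, 0 < (c i).re) {m : ℕ} (β : Fin m → I) (γ : I) :
    (∑ j, c (β j)) + c γ ≠ 0 := fun h => by
  have h1 := congrArg Complex.re h
  rw [Complex.add_re, Complex.re_sum, Complex.zero_re] at h1
  have h2 : 0 ≤ ∑ j, (c (β j)).re := Finset.sum_nonneg fun j _ => (hc _).le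
  linarith [hc γ]

/-- The γ is inserted at every place of β. Induction on the length of β splits off its last entry δ:
either γ comes after δ, or γ is inserted into the shorter tuple and R_δ is applied last. In the
second case R_δ still has to be moved past R_γ, and the commutator is the summand in which δ itself
is replaced. -/
theorem sum_insertNth (hc : ∀ i, 0 < (c i).re) (hK : ∀ i j k, K i j k ≠ 0 → c k = c i + c j)
    (hR : ∀ i j, R i * R j = R j * R i + ∑ k, K i j k • R k) {m : ℕ} (β : Fin m → I) (γ : I) :
    ∑ k : Fin (m + 1), (partialSumProd c (k.insertNth γ β : Fin (m + 1) → I))⁻¹ •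
        tupleProd R (k.insertNth γ β : Fin (m + 1) → I) =
      (c γ)⁻¹ • ((partialSumProd c β)⁻¹ • (R γ * tupleProd R β) +
        ∑ i, ∑ k, K (β i) γ k • (partialSumProd c (Function.update β i k))⁻¹ •
          tupleProd R (Function.update β i k)) := by
  induction m with
  | zero =>
    have e : ((0 : Fin 1).insertNth γ β : Fin 1 → I) = Fin.snoc β γ := by
      rw [← Fin.insertNth_last']; rfl
    rw [Fin.sum_univ_succ]
    simp only [Finset.univ_eq_empty, Finset.sum_empty, add_zero]
    rw [e, partialSumProd_snoc, tupleProd_snoc]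
    simp [partialSumProd]
  | succ m ih =>
    obtain ⟨β, δ, rfl⟩ : ∃ (β' : Fin m → I) (δ : I), β = Fin.snoc β' δ :=
      ⟨Fin.init β, β (Fin.last m), (Fin.snoc_init_self β).symm⟩
    rw [Fin.sum_univ_castSucc]
    simp only [insertNth_castSucc_snoc, Fin.insertNth_last', partialSumProd_snoc, tupleProd_snoc]
    have hs : ∀ k : Fin (m + 1), ∑ j, c ((k.insertNth γ β : Fin (m + 1) → I) j) =
        (∑ j, c (β j)) + c γ := fun k => by
      rw [Fin.sum_univ_succAbove _ k]
      simp [add_comm]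
    set s := ∑ j, c (β j) with hs'
    set P := tupleProd R β
    set T := ∑ i, ∑ k, K (β i) γ k • (partialSumProd c (Function.update β i k))⁻¹ •
          tupleProd R (Function.update β i k) with hT
    -- The insertions before δ: the last partial sum is s + c_γ + c_δ for all of them, so it factors
    -- out and the induction hypothesis applies.
    have h1 : ∑ k : Fin (m + 1), (partialSumProd c (k.insertNth γ β : Fin (m + 1) → I) *
        ((∑ j, c ((k.insertNth γ β : Fin (m + 1) → I) j)) + c δ))⁻¹ •
          (R δ * tupleProd R (k.insertNth γ β : Fin (m + 1) → I)) =
        (s + c γ + c δ)⁻¹ • (c γ)⁻¹ • ((partialSumProd c β)⁻¹ • (R δ * (R γ * P)) + R δ * T) := by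
      have h2 := congrArg (fun x => (s + c γ + c δ)⁻¹ • (R δ * x)) (ih β)
      simp only [mul_smul_comm, mul_add] at h2
      rw [← h2, Finset.mul_sum, Finset.smul_sum]
      refine Finset.sum_congr rfl fun k _ => ?_
      rw [hs, mul_inv, mul_comm, mul_smul, mul_smul_comm]
    -- Correction terms that alter an entry of the shorter tuple, and those that alter δ. Whenever K
    -- ≠ 0 the replacement adds c_γ to the total, so both kinds end in the same factor s + c_γ +
    -- c_δ.
    have h3 : ∑ i : Fin (m + 1), ∑ k, K ((Fin.snoc β δ : Fin (m + 1) → I) i) γ k •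
        (partialSumProd c (Function.update (Fin.snoc β δ : Fin (m + 1) → I) i k))⁻¹ •
          tupleProd R (Function.update (Fin.snoc β δ : Fin (m + 1) → I) i k) =
        (s + c γ + c δ)⁻¹ • (R δ * T) + (s + c γ + c δ)⁻¹ • (partialSumProd c β)⁻¹ •
          ((∑ k, K δ γ k • R k) * P) := by
      rw [Fin.sum_univ_castSucc]
      congr 1
      · simp only [hT, Finset.mul_sum, Finset.smul_sum]
        refine Finset.sum_congr rfl fun i _ => Finset.sum_congr rfl fun k _ => ?_
        rw [← Fin.snoc_update, partialSumProd_snoc, tupleProd_snoc, Fin.snoc_castSucc]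
        by_cases h0 : K (β i) γ k = 0
        · simp [h0]
        · have h4 : ∑ j, c (Function.update β i k j) = s + c γ := by
            rw [hs', ← Finset.add_sum_erase _ _ (Finset.mem_univ i),
              ← Finset.add_sum_erase _ (fun j => c (β j)) (Finset.mem_univ i),
              Function.update_self, hK _ _ _ h0]
            rw [Finset.sum_congr rfl fun j hj => by
              rw [Function.update_of_ne (Finset.ne_of_mem_erase hj)]]
            ring
          rw [h4, mul_smul_comm, mul_smul_comm, mul_inv, smul_smul, smul_smul, smul_smul]
          congr 1
          ring
      · simp only [Finset.sum_mul, Finset.smul_sum]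
        refine Finset.sum_congr rfl fun k _ => ?_
        rw [Fin.update_snoc_last, partialSumProd_snoc, tupleProd_snoc, Fin.snoc_last, ← hs']
        by_cases h0 : K δ γ k = 0
        · simp [h0]
        · rw [hK _ _ _ h0, smul_mul_assoc, mul_inv, smul_smul, smul_smul, smul_smul]
          congr 1
          rw [show s + (c δ + c γ) = s + c γ + c δ by ring]
          ring
    have h5 : R δ * (R γ * P) = R γ * (R δ * P) + (∑ k, K δ γ k • R k) * P := by
      rw [← mul_assoc, hR, add_mul, mul_assoc]
    have h6 : ∑ j, c ((Fin.snoc β δ : Fin (m + 1) → I) j) = s + c δ := by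
      rw [Fin.sum_univ_castSucc]
      simp [hs']
    rw [h1, h3, h5, h6]
    have n1 : s + c γ + c δ ≠ 0 := by
      have := sum_ne_zero_of_re_pos hc (Fin.snoc β δ : Fin (m + 1) → I) γ
      rw [h6] at this
      rwa [add_right_comm]
    have n2 : s + c δ ≠ 0 := sum_ne_zero_of_re_pos hc β δ
    have n3 : c γ ≠ 0 := fun h => by
      have := hc γ
      rw [h] at this
      exact lt_irrefl _ this
    -- Partial fractions 1/(a(a+b)) + 1/(b(a+b)) = 1/(ab) with a = c_γ and b = s + c_δ. This
    -- combines the two contributions to R_γ R_δ P.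
    have key : (s + c γ + c δ)⁻¹ * (c γ)⁻¹ + (s + c δ)⁻¹ * (s + c δ + c γ)⁻¹ =
        (c γ)⁻¹ * (s + c δ)⁻¹ := by
      rw [add_right_comm s] at n1 ⊢
      field_simp
    have key' := congrArg (fun z => (partialSumProd c β)⁻¹ * z) key
    simp only [mul_inv]
    match_scalars
    · linear_combination key'
    · ring
    · ring

/-- `∑_σ c_{σ(α)}⁻¹ R_{σ(α)}`. -/
noncomputable def symProd (c : I → ℂ) (R : I → A) {m : ℕ} (α : Fin m → I) : A :=
  ∑ σ : Equiv.Perm (Fin m), (partialSumProd c (α ∘ σ))⁻¹ • tupleProd R (α ∘ σ)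

/-- The permutation of `Fin (m + 1)` with `k ↦ m` that is `σ` on the other elements. -/
def insertPerm {m : ℕ} (k : Fin (m + 1)) (σ : Equiv.Perm (Fin m)) : Equiv.Perm (Fin (m + 1)) :=
  (finSuccEquiv' k).trans (σ.optionCongr.trans (finSuccEquiv' (Fin.last m)).symm)

theorem snoc_comp_insertPerm {m : ℕ} (k : Fin (m + 1)) (σ : Equiv.Perm (Fin m)) (α : Fin m → I)
    (γ : I) : (Fin.snoc α γ : Fin (m + 1) → I) ∘ insertPerm k σ = k.insertNth γ (α ∘ σ) := by
  rw [Fin.eq_insertNth_iff]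
  constructor
  · simp [insertPerm]
  · funext j
    simp [insertPerm, Fin.removeNth]

/-- The place k is recovered as the preimage of the last index, and σ from the other values; the
cardinalities agree. -/
theorem insertPerm_bijective (m : ℕ) : Function.Bijective
    (fun x : Fin (m + 1) × Equiv.Perm (Fin m) => insertPerm x.1 x.2) := by
  rw [Fintype.bijective_iff_injective_and_card]
  constructor
  · rintro ⟨k, σ⟩ ⟨k', σ'⟩ h
    simp only at h
    have hk : k = k' := by
      have h1 : insertPerm k' σ' k = Fin.last m := by
        rw [← h]; simp [insertPerm]
      have h2 : insertPerm k' σ' k' = Fin.last m := by simp [insertPerm]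
      exact (insertPerm k' σ').injective (h1.trans h2.symm)
    subst hk
    refine Prod.ext rfl (Equiv.ext fun j => ?_)
    have h1 := congrArg (fun τ : Equiv.Perm (Fin (m + 1)) => τ (k.succAbove j)) h
    simpa [insertPerm] using h1
  · rw [Fintype.card_prod, Fintype.card_perm, Fintype.card_perm, Fintype.card_fin,
      Fintype.card_fin, Nat.factorial_succ]

/-- The recursion that matches one application of D̄. Permutations of the longer tuple are pairs of
an insertion place for γ and a permutation of α, and the sum over the places is `sum_insertNth`. -/
theorem symProd_snoc (hc : ∀ i, 0 < (c i).re) (hK : ∀ i j k, K i j k ≠ 0 → c k = c i + c j)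
    (hR : ∀ i j, R i * R j = R j * R i + ∑ k, K i j k • R k) {m : ℕ} (α : Fin m → I) (γ : I) :
    symProd c R (Fin.snoc α γ : Fin (m + 1) → I) =
      (c γ)⁻¹ • (R γ * symProd c R α +
        ∑ i, ∑ k, K (α i) γ k • symProd c R (Function.update α i k)) := by
  rw [symProd, ← (insertPerm_bijective m).sum_comp, Fintype.sum_prod_type_right]
  simp only [snoc_comp_insertPerm, sum_insertNth hc hK hR]
  rw [← Finset.smul_sum, Finset.sum_add_distrib]
  congr 2
  · simp only [symProd, Finset.mul_sum, mul_smul_comm]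
  · simp only [symProd, Finset.smul_sum]
    -- Replacing the entry i after permuting by σ is replacing the entry σ(i) before; reindexing i
    -- by σ gives correction terms indexed by the entries of α.
    have e : ∀ σ : Equiv.Perm (Fin m), ∑ i, ∑ k, K ((α ∘ σ) i) γ k •
        (partialSumProd c (Function.update (α ∘ σ) i k))⁻¹ •
          tupleProd R (Function.update (α ∘ σ) i k) =
        ∑ i, ∑ k, K (α i) γ k • (partialSumProd c (Function.update α i k ∘ σ))⁻¹ •
          tupleProd R (Function.update α i k ∘ σ) := by
      intro σ
      refine Fintype.sum_equiv σ _ _ fun i => ?_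
      refine Finset.sum_congr rfl fun k _ => ?_
      have h : Function.update α (σ i) k ∘ σ = Function.update (α ∘ σ) i k := by
        rw [Function.update_comp_equiv, Equiv.symm_apply_apply]
      rw [h, Function.comp_apply]
    rw [Finset.sum_congr rfl fun σ _ => e σ, Finset.sum_comm]
    refine Finset.sum_congr rfl fun i _ => ?_
    rw [Finset.sum_comm]

end Symmetrized

end FlagCR

namespace FlagCR

open ParabolicData

variable {E : Type*} [NormedAddCommGroup E] [NormedSpace ℂ E] [FiniteDimensional ℂ E]
  [CompleteSpace E]
  {G : Type*} [TopologicalSpace G] [ChartedSpace E G] [Group G] [LieGroup 𝓘(ℂ, E) ω G]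
  [T2Space G] [LieAlgebra.IsKilling ℂ (GroupLieAlgebra 𝓘(ℂ, E) G)]
  {D : ParabolicData (GroupLieAlgebra 𝓘(ℂ, E) G)} {C : D.t} {X : D.RootVectors}
  {V : Type*} [AddCommGroup V] [Module ℂ V] [FiniteDimensional ℂ V]
  {ρ : Representation ℂ (parabolicSubgroup D) V} {F : G → V}

/-! ### Complexified derivatives as endomorphisms of the space of smooth functions -/

variable (E G V) in
/-- The space of smooth functions from `G` to `V`. -/
def smoothFunctions : Submodule ℂ (G → V) where
  carrier := {Φ | VSmooth E Φ}
  add_mem' := VSmooth.add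
  zero_mem' := vSmooth_zero
  smul_mem' a _ h := h.smul a

variable (V) in
/-- The derivative along `x`, as an endomorphism of the space of smooth functions. -/
noncomputable def derivEnd (X : D.RootVectors) (x : GroupLieAlgebra 𝓘(ℂ, E) G) :
    Module.End ℂ (smoothFunctions E G V) where
  toFun Φ := ⟨derivC X x Φ, VSmooth.derivC Φ.2 x⟩
  map_add' Φ Ψ := by
    have h : VSmooth E (Φ : G → V) := Φ.2
    have h' : VSmooth E (Ψ : G → V) := Ψ.2
    refine Subtype.ext ?_
    simp only [Submodule.coe_add, derivC, h.deriv_add h', smul_add]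
    abel
  map_smul' a Φ := by
    have h : VSmooth E (Φ : G → V) := Φ.2
    refine Subtype.ext ?_
    simp only [Submodule.coe_smul, derivC, h.deriv_smul, RingHom.id_apply, smul_add]
    rw [smul_comm]

theorem coe_derivEnd_apply (x : GroupLieAlgebra 𝓘(ℂ, E) G) (Φ : smoothFunctions E G V) :
    (derivEnd V X x Φ : G → V) = derivC X x Φ := rfl

theorem derivEnd_commutator (x y : GroupLieAlgebra 𝓘(ℂ, E) G) :
    derivEnd V X x * derivEnd V X y = derivEnd V X y * derivEnd V X x + derivEnd V X ⁅x, y⁆ := by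
  refine LinearMap.ext fun Φ => Subtype.ext ?_
  have h : VSmooth E (Φ : G → V) := Φ.2
  have h1 := h.derivC_commutator (X := X) x y
  rw [sub_eq_iff_eq_add'] at h1
  exact h1

theorem derivEnd_smul (z : ℂ) (x : GroupLieAlgebra 𝓘(ℂ, E) G) :
    derivEnd V X (z • x) = z • derivEnd V X x := by
  refine LinearMap.ext fun Φ => Subtype.ext ?_
  have h : VSmooth E (Φ : G → V) := Φ.2
  exact h.derivC_smul z x

theorem VSmooth.derivC_map {W W' : Type*} [AddCommGroup W] [Module ℂ W] [FiniteDimensional ℂ W]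
    [AddCommGroup W'] [Module ℂ W'] [FiniteDimensional ℂ W'] {Φ : G → W} (hΦ : VSmooth E Φ)
    (A : W →ₗ[ℂ] W') (x : GroupLieAlgebra 𝓘(ℂ, E) G) :
    FlagCR.derivC X x (fun g => A (Φ g)) = fun g => A (FlagCR.derivC X x Φ g) := by
  funext g
  simp only [FlagCR.derivC, Pi.add_apply, Pi.smul_apply, hΦ.deriv_map, map_add, map_smul]

theorem derivC_sum {W : Type*} [AddCommGroup W] [Module ℂ W] [FiniteDimensional ℂ W]
    {ι : Type*} (s : Finset ι) {Φ : ι → G → W} (hΦ : ∀ i, VSmooth E (Φ i))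
    (x : GroupLieAlgebra 𝓘(ℂ, E) G) : derivC X x (∑ i ∈ s, Φ i) = ∑ i ∈ s, derivC X x (Φ i) := by
  have h := congrArg Subtype.val (map_sum (derivEnd W X x)
    (fun i => (⟨Φ i, hΦ i⟩ : smoothFunctions E G W)) s)
  rw [coe_derivEnd_apply, Submodule.coe_sum, Submodule.coe_sum] at h
  exact h

/-! ### Structure constants -/

open Classical in
/-- The structure constants of `𝔫⁺` in the basis `x_α`. -/
noncomputable def structConst (X : D.RootVectors) (α β γ : D.XiPos) : ℂ :=
  if α.1 + β.1 = γ.1 then X.N α β else 0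

theorem structConst_add {α β γ : D.XiPos} (h : structConst X α β γ ≠ 0) :
    cval C γ = cval C α + cval C β := by
  have h1 : α.1 + β.1 = γ.1 := by
    by_contra h1
    exact h (if_neg h1)
  rw [cval, ← h1]
  rfl

theorem cval_re_pos (hC : C ∈ D.kahlerCone) (α : D.XiPos) : 0 < (cval C α).re := by
  exact ((mem_XiPos_iff hC).mp α.2).2

theorem derivEnd_mul (hC : C ∈ D.kahlerCone) (α β : D.XiPos) :
    derivEnd V X (X.x α) * derivEnd V X (X.x β) =
      derivEnd V X (X.x β) * derivEnd V X (X.x α) +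
        ∑ γ : D.XiPos, structConst X α β γ • derivEnd V X (X.x γ) := by
  have h0 : α.1 + β.1 ≠ 0 := fun h => by
    have h1 : cval C α + cval C β = 0 := by
      rw [cval, cval, ← LinearMap.add_apply, h, LinearMap.zero_apply]
    have h2 := congrArg Complex.re h1
    rw [Complex.add_re, Complex.zero_re] at h2
    linarith [cval_re_pos hC α, cval_re_pos hC β]
  rw [derivEnd_commutator, X.lie_x_x α.2.1.1 β.2.1.1 h0, derivEnd_smul]
  congr 1
  by_cases hN : X.N α β = 0
  · simp [structConst, hN]
  · rw [Finset.sum_eq_single ⟨α.1 + β.1, X.add_mem_XiPos hC α.2 β.2 hN⟩]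
    · simp [structConst]
    · intro γ _ h
      rw [structConst, if_neg fun h1 => h (Subtype.ext h1.symm), zero_smul]
    · simp

theorem ctuple_eq (C : D.t) {m : ℕ} (β : Fin m → D.XiPos) :
    ctuple C β = partialSumProd (fun α : D.XiPos => cval C α) β := by
  simp only [ctuple, partialSumProd, cval, LinearMap.sum_apply]

/-! ### The iterated Cauchy-Riemann operator -/

/-- The map that exchanges a with the i-th entry of β is an involution on pairs (β, a). It serves to
shift index changes from the tensors y_β to their coefficients. -/
theorem sum_sum_update {ι I M : Type*} [Fintype ι] [DecidableEq ι] [Fintype I] [AddCommMonoid M]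
    (i : ι) (g : (ι → I) → I → M) :
    ∑ β, ∑ a, g β a = ∑ β, ∑ a, g (Function.update β i a) (β i) := by
  rw [← Fintype.sum_prod_type', ← Fintype.sum_prod_type']
  have h : Function.Involutive
      fun x : (ι → I) × I => (Function.update x.1 i x.2, x.1 i) := fun x => by simp
  exact (Equiv.sum_comp h.toPerm fun x => g x.1 x.2).symm

/-- The Leibniz rule together with the formula for [x_γ, y_β] modulo 𝔭. -/
theorem tangentPowDeriv_ytuple (hC : C ∈ D.kahlerCone) {m : ℕ} (γ : D.XiPos)
    (β : Fin m → D.XiPos) :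
    open Classical in
    tangentPowDeriv hC m ⟨X.x γ, nPos_le_parabolic (X.mem_nPos γ.2)⟩ (ytuple X β) =
      ∑ i, ∑ α : D.XiPos, structConst X α γ (β i) • ytuple X (Function.update β i α) := by
  classical
  rw [ytuple, tangentPowDeriv_tprod]
  refine Finset.sum_congr rfl fun i _ => ?_
  rw [tangentDeriv_mkQ, X.mkQ_lie_x_y hC, MultilinearMap.map_update_sum]
  refine Finset.sum_congr rfl fun α _ => ?_
  have h : (if α.1 + γ.1 = (β i).1 then X.N α γ • D.parabolic.mkQ (X.y α) else 0) =
      structConst X α γ (β i) • D.parabolic.mkQ (X.y α) := by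
    rw [structConst]
    split_ifs <;> simp
  rw [h, MultilinearMap.map_update_smul, ytuple]
  congr 2
  funext j
  by_cases hj : j = i
  · subst hj; simp
  · simp [hj]

theorem appendFactor_rep (m : ℕ) (p : parabolicSubgroup D)
    (τ : (V ⊗[ℂ] ⨂[ℂ]^m (TangentFiber D)) ⊗[ℂ] TangentFiber D) :
    appendFactor V (TangentFiber D) m
        (((ρ.tprod (tangentPowRep D m)).tprod (tangentRep D)) p τ) =
      (ρ.tprod (tangentPowRep D (m + 1))) p (appendFactor V (TangentFiber D) m τ) := by
  induction τ using TensorProduct.induction_on with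
  | zero => simp only [map_zero]
  | add τ τ' h h' => simp only [map_add, h, h']
  | tmul σ b =>
    induction σ using TensorProduct.induction_on with
    | zero => simp only [map_zero, TensorProduct.zero_tmul]
    | add τ τ' h h' => simp only [map_add, TensorProduct.add_tmul, h, h']
    | tmul v a =>
      induction a using PiTensorProduct.induction_on with
      | add τ τ' h h' => simp only [map_add, TensorProduct.add_tmul, TensorProduct.tmul_add, h, h']
      | smul_tprod r a =>
        rw [TensorProduct.tmul_smul, ← TensorProduct.smul_tmul', map_smul, map_smul, map_smul,
          map_smul, appendFactor_tmul]
        congr 1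
        change appendFactor V (TangentFiber D) m ((ρ p v ⊗ₜ PiTensorProduct.map _ _) ⊗ₜ _) =
          ρ p v ⊗ₜ PiTensorProduct.map _ _
        rw [PiTensorProduct.map_tprod, PiTensorProduct.map_tprod, appendFactor_tmul]
        congr 2
        funext j
        induction j using Fin.lastCases with
        | last => simp
        | cast j => simp

theorem iteratedCR_succ (m : ℕ) (g : G) : iteratedCR X C ρ F (m + 1) g =
    appendFactor V (TangentFiber D) m
      (cauchyRiemann X C (ρ.tprod (tangentPowRep D m)) (iteratedCR X C ρ F m) g) := rfl

open Classical in
-- The induction on m. Besides the formula on U it carries equivariance and a smooth extension to G,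
-- which is what makes D̄^m F an admissible argument for the next application of D̄.
theorem isCompactlySmooth_iteratedCR (hC : C ∈ D.kahlerCone) (hρ : IsHolomorphicRep ρ)
    (hsimple : ρ.IsIrreducible)
    (hF : ∀ (g : G) (p : parabolicSubgroup D), F (g * p) = ρ p⁻¹ (F g))
    {Ψ : smoothFunctions E G V} (hΨ : (Ψ : G → V) = F) (m : ℕ) :
    IsCompactlySmooth X (ρ.tprod (tangentPowRep D m)) (iteratedCR X C ρ F m)
      (∑ α : Fin m → D.XiPos, fun g => ((symProd (fun α : D.XiPos => cval C α)
        (fun α : D.XiPos => derivEnd V X (X.x α)) α Ψ : smoothFunctions E G V) :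
          G → V) g ⊗ₜ ytuple X α) := by
  obtain ⟨δ, hδ⟩ := hρ.exists_repDeriv hC
  have hs : ∀ (v : smoothFunctions E G V) (m : ℕ) (z : ⨂[ℂ]^m (TangentFiber D)),
      VSmooth E fun g => (v : G → V) g ⊗ₜ[ℂ] z := fun v m z =>
    VSmooth.map v.2 ((TensorProduct.mk ℂ V (⨂[ℂ]^m (TangentFiber D))).flip z)
  induction m with
  | zero =>
    refine ⟨fun g p => ?_, vSmooth_sum _ fun α _ => hs _ _ _, fun u => ?_⟩
    · change F (g * p) ⊗ₜ _ = ρ p⁻¹ (F g) ⊗ₜ PiTensorProduct.map _ _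
      rw [hF, PiTensorProduct.map_tprod]
      congr 2
      exact Subsingleton.elim _ _
    · rw [Fintype.sum_unique]
      simp only [symProd, Fintype.sum_unique, partialSumProd, tupleProd, ytuple,
        Finset.univ_eq_empty, Finset.prod_empty, inv_one, one_smul, List.ofFn_zero, List.foldl_nil,
        Module.End.one_apply, hΨ]
      change F u ⊗ₜ _ = F u ⊗ₜ _
      congr 2
      exact Subsingleton.elim _ _
  | succ m ih =>
    have hδm := hδ.tprod (repDeriv_tangentPowRep hC m)
    refine ⟨fun g p => ?_, vSmooth_sum _ fun α _ => hs _ _ _, fun u => ?_⟩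
    · rw [iteratedCR_succ, iteratedCR_succ, ih.cauchyRiemann_equivariant hC hδm, appendFactor_rep]
    · rw [iteratedCR_succ, ih.cauchyRiemann_apply hC hδm, ih.eq_on]
      set c : D.XiPos → ℂ := fun α => cval C α
      set R : D.XiPos → Module.End ℂ (smoothFunctions E G V) := fun α => derivEnd V X (X.x α)
      have key : ∀ γ : D.XiPos, (c γ)⁻¹ • (derivC X (X.x γ) (∑ α : Fin m → D.XiPos, fun g =>
          (symProd c R α Ψ : G → V) g ⊗ₜ[ℂ] ytuple X α) u +
          tprodDeriv δ (tangentPowDeriv hC m) ⟨X.x γ, nPos_le_parabolic (X.mem_nPos γ.2)⟩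
            ((∑ α : Fin m → D.XiPos, fun g => (symProd c R α Ψ : G → V) g ⊗ₜ[ℂ] ytuple X α)
              (u : G))) =
          ∑ α : Fin m → D.XiPos, (symProd c R (Fin.snoc α γ : Fin (m + 1) → D.XiPos) Ψ : G → V) u
            ⊗ₜ[ℂ] ytuple X α := by
        intro γ
        have h1 : derivC X (X.x γ) (∑ α : Fin m → D.XiPos, fun g =>
            (symProd c R α Ψ : G → V) g ⊗ₜ[ℂ] ytuple X α) u =
            ∑ α : Fin m → D.XiPos, ((R γ * symProd c R α) Ψ : G → V) u ⊗ₜ[ℂ] ytuple X α := by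
          rw [derivC_sum _ fun α => hs _ _ _, Finset.sum_apply]
          refine Finset.sum_congr rfl fun α _ => ?_
          exact congrFun (VSmooth.derivC_map (symProd c R α Ψ).2
            ((TensorProduct.mk ℂ V (⨂[ℂ]^m (TangentFiber D))).flip (ytuple X α)) (X.x γ)) u
        have h2 : ∀ (v : V) (β : Fin m → D.XiPos), tprodDeriv δ (tangentPowDeriv hC m)
            ⟨X.x γ, nPos_le_parabolic (X.mem_nPos γ.2)⟩ (v ⊗ₜ[ℂ] ytuple X β) =
            ∑ i, ∑ α : D.XiPos, (structConst X α γ (β i) • v) ⊗ₜ[ℂ]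
              ytuple X (Function.update β i α) := by
          intro v β
          change δ _ v ⊗ₜ[ℂ] _ + v ⊗ₜ[ℂ] tangentPowDeriv hC m _ _ = _
          -- Simplicity of V enters here: x_γ acts only through the tangent factors.
          rw [hδ.eq_zero_of_isIrreducible hC X hsimple (X.mem_nPos γ.2), tangentPowDeriv_ytuple,
            LinearMap.zero_apply, TensorProduct.zero_tmul, zero_add, TensorProduct.tmul_sum]
          simp only [TensorProduct.tmul_sum, TensorProduct.smul_tmul]
        -- After the exchange of indices, the coefficient of y_α collects the tuples obtained from α
        -- by changing one entry, as in `symProd_snoc`.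
        rw [h1, Finset.sum_apply, map_sum, Finset.sum_congr rfl fun β _ => h2 _ β,
          Finset.sum_comm, Finset.sum_congr rfl fun i _ => sum_sum_update i _, Finset.sum_comm,
          ← Finset.sum_add_distrib, Finset.smul_sum]
        refine Finset.sum_congr rfl fun α _ => ?_
        rw [symProd_snoc (cval_re_pos hC) (fun _ _ _ => structConst_add) (derivEnd_mul hC)]
        simp only [Function.update_idem, Function.update_eq_self, Function.update_self,
          ← TensorProduct.sum_tmul, ← TensorProduct.add_tmul, TensorProduct.smul_tmul',
          LinearMap.smul_apply, LinearMap.add_apply, LinearMap.sum_apply, Submodule.coe_smul,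
          Submodule.coe_add, Submodule.coe_sum, Pi.smul_apply, Pi.add_apply, Finset.sum_apply]
        rfl
      rw [← (Fin.snocEquiv fun _ : Fin (m + 1) => D.XiPos).sum_comp, map_sum]
      conv_rhs => rw [Finset.sum_apply]
      simp only [Fintype.sum_prod_type]
      refine Finset.sum_congr rfl fun γ _ => ?_
      rw [key, TensorProduct.sum_tmul, map_sum]
      refine Finset.sum_congr rfl fun α _ => ?_
      rw [ytuple, appendFactor_tmul, ytuple]
      congr 2
      funext j
      induction j using Fin.lastCases with
      | last => simp
      | cast j => simp

/-! ### The compact picture -/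

/-- The curves used on U are the exponential curves in directions of 𝔲, so only the values of Φ on U
enter; the decomposition of x is unique, which settles the choice in `rightDerivC`. -/
theorem rightDerivC_eq {Φ : G → V} (x : GroupLieAlgebra 𝓘(ℂ, E) G)
    {f : compactSubgroup X → V} (hf : ∀ u, f u = Φ u) (u : compactSubgroup X) :
    rightDerivC X x f u = derivC X x Φ u := by
  have h : ∃ v : X.compactForm × X.compactForm,
      x = (v.1 : GroupLieAlgebra 𝓘(ℂ, E) G) + Complex.I • (v.2 : GroupLieAlgebra 𝓘(ℂ, E) G) :=
    ⟨(X.rePart x, X.imPart x), X.rePart_add_imPart x⟩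
  have h1 : ∀ v : X.compactForm, rightDeriv X v f u =
      leftInvDeriv (v : GroupLieAlgebra 𝓘(ℂ, E) G) Φ u := fun v => by
    rw [rightDeriv, leftInvDeriv]
    congr 1
    funext t
    rw [hf]
    rfl
  rw [rightDerivC, dif_pos h, derivC_of_eq h.choose_spec, h1, h1]
  rfl

theorem rightDerivTuple_eq (Ψ : smoothFunctions E G V) {f : compactSubgroup X → V}
    (hf : ∀ u, f u = (Ψ : G → V) u) {m : ℕ} (β : Fin m → D.XiPos) (u : compactSubgroup X) :
    rightDerivTuple X β f u =
      (tupleProd (fun α : D.XiPos => derivEnd V X (X.x α)) β Ψ : G → V) u := by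
  induction m generalizing u with
  | zero => exact hf u
  | succ m ih =>
    obtain ⟨β, γ, rfl⟩ : ∃ (β' : Fin m → D.XiPos) (γ : D.XiPos), β = Fin.snoc β' γ :=
      ⟨Fin.init β, β (Fin.last m), (Fin.snoc_init_self β).symm⟩
    have h : rightDerivTuple X (Fin.snoc β γ : Fin (m + 1) → D.XiPos) f =
        rightDerivC X (X.x γ) (rightDerivTuple X β f) := by
      rw [rightDerivTuple, List.ofFn_succ', List.concat_eq_append]
      simp [rightDerivTuple, List.flatMap_append, List.foldl_append]
    rw [h, tupleProd_snoc, rightDerivC_eq _ (ih β)]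
    rfl

end FlagCR

theorem mainTheorem6
    {E : Type*} [NormedAddCommGroup E] [NormedSpace ℂ E] [FiniteDimensional ℂ E] [CompleteSpace E]
    {G : Type*} [TopologicalSpace G] [ChartedSpace E G] [Group G] [LieGroup 𝓘(ℂ, E) ω G]
    [T2Space G] [SimplyConnectedSpace G]
    [LieAlgebra.IsSimple ℂ (GroupLieAlgebra 𝓘(ℂ, E) G)]
    (D : FlagCR.ParabolicData (GroupLieAlgebra 𝓘(ℂ, E) G))
    (X : D.RootVectors)
    (C : D.t) (hC : C ∈ D.kahlerCone)
    {V : Type*} [AddCommGroup V] [Module ℂ V] [FiniteDimensional ℂ V]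
    (ρ : Representation ℂ (FlagCR.parabolicSubgroup D) V)
    (hρ : FlagCR.IsHolomorphicRep ρ) (hsimple : ρ.IsIrreducible)
    (m : ℕ) (F : G → V) (hF : FlagCR.IsSmoothSection ρ F)
    (f : FlagCR.compactSubgroup X → V) (hf : ∀ u, f u = F u)
    (u : FlagCR.compactSubgroup X) :
    FlagCR.iteratedCR X C ρ F m u =
      ∑ α : Fin m → D.XiPos,
        (∑ σ : Equiv.Perm (Fin m),
          (FlagCR.ParabolicData.ctuple C (α ∘ σ))⁻¹ •
            FlagCR.rightDerivTuple X (α ∘ σ) f u) ⊗ₜ[ℂ] FlagCR.ytuple X α := by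
  -- For m = 0 the section F is its own smooth extension.
  let Ψ : FlagCR.smoothFunctions E G V := ⟨F, fun l => hF.smooth l⟩
  rw [(FlagCR.isCompactlySmooth_iteratedCR (X := X) hC hρ hsimple hF.equivariant
    (show (Ψ : G → V) = F from rfl) m).eq_on u, Finset.sum_apply]
  refine Finset.sum_congr rfl fun α _ => ?_
  simp only [FlagCR.ctuple_eq, FlagCR.rightDerivTuple_eq Ψ hf, FlagCR.symProd,
    LinearMap.sum_apply, LinearMap.smul_apply, Submodule.coe_sum, Submodule.coe_smul,
    Finset.sum_apply, Pi.smul_apply]
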